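/- Let $\Omega$ be a finite metric tree with vertex set $V$ and nonempty edge set $E$, in which each edge $e$ is identified with an interval $(0,l_e)$, $l_e>0$, and let $\Gamma$ be the set of its leaves (vertices of degree $1$). All functions are real-valued. Let $L^2(\Omega)=\bigoplus_{e}L^2(0,l_e)$, let $H^1(\Omega)$ be the space of continuous functions on $\Omega$ whose restriction to each edge $e$ lies in $H^1(0,l_e)$, with norm $(\|y\|_{L^2}^2+\|\partial_x y\|_{L^2}^2)^{1/2}$, and let $H^1_0(\Omega)=\{y\in H^1(\Omega): y|_\Gamma=0\}$. For $T>0$ put $E^1=C([0,T];H^1(\Omega))\cap C^1([0,T];L^2(\Omega))$ with $$\|u\|_{E^1}=\sup_{t\in[0,T]}\|u(\cdot,t)\|_{H^1(\Omega)}+\sup_{t\in[0,T]}\|\partial_t u(\cdot,t)\|_{L^2(\Omega)} .$$ For $k\in\mathbb N$, the space $H^{k+1/2}([0,T];\mathbb R^{|\Gamma|})$ consists of the $f=(f_v)_{v\in\Gamma}$ with weak derivatives $f_v^{(j)}\in L^2(0,T)$ for $j\le k$ and finite norm $$\|f\|_{H^{k+1/2}}^2=\sum_{v\in\Gamma}\Big(\sum_{j=0}^k\|f_v^{(j)}\|_{L^2(0,T)}^2+\int_0^T\!\!\int_0^T\frac{|f_v^{(k)}(s)-f_v^{(k)}(t)|^2}{|s-t|^2}\,ds\,dt\Big).$$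 Let $T>0$ and $q\in L^\infty(\Omega)$. There is a constant $C$ depending only on $T$, $q$ and $\Omega$ such that the following holds for all $F\in L^1([0,T];L^2(\Omega))$ and all $f\in H^{3/2}([0,T];\mathbb R^{|\Gamma|})$ with $f=0$ near $t=0$ and near $t=T$. The problem $$\begin{cases}(\partial_t^2-\partial_x^2)u+qu=F & \text{in }(\Omega\setminus V)\times(0,T),\\ u=f & \text{on }\Gamma\times(0,T),\\ u|_{t=0}=0,\quad \partial_t u|_{t=0}=0 & \text{in }\Omega,\\ u\text{ satisfies the Kirchhoff-Neumann condition on }V\setminus\Gamma\end{cases}$$ (at each vertex of $V\setminus\Gamma$, $u$ is continuous and the sum of its outward derivatives along the incident edges vanishes) has a unique weak solution $u\in E^1$, and $$\|u\|_{E^1}\le C\big(\|f\|_{H^{3/2}([0,T];\mathbb R^{|\Gamma|})}+\|F\|_{L^1([0,T];L^2(\Omega))}\big).$$ Here $u\in E^1$ is a weak solution if it satisfies the boundary and initial conditions and, for every $\varphi\in H^1_0(\Omega)$, $$\frac{d}{dt}(\partial_t u,\varphi)_{L^2(\Omega)}+(\partial_x u,\partial_x\varphi)_{L^2(\Omega)}+(qu,\varphi)_{L^2(\Omega)}=(F,\varphi)_{L^2(\Omega)}$$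 in the sense of distributions on $(0,T)$, the condition on the outward derivatives being the natural condition contained in this equation. If, in addition, $F\in C^1([0,T];L^2(\Omega))$, $F|_{t=0}=0$ and $f\in H^{7/2}([0,T];\mathbb R^{|\Gamma|})$, then $u|_e(\cdot,t)\in H^2([0,l_e])$ for every edge $e\in E$ and every $t\in[0,T]$. -/

import Mathlib

open MeasureTheory Set

noncomputable section

/-- The Hilbert space `L²(0,l)` of real-valued functions. -/
abbrev IntervalL2 (l : ℝ) : Type := Lp ℝ 2 (volume.restrict (Ioo (0 : ℝ) l))

/-- `φ ∈ C_c^∞((0,l))`. -/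
def IsTestFunction (l : ℝ) (φ : ℝ → ℝ) : Prop :=
  ContDiff ℝ (⊤ : ℕ∞) φ ∧ HasCompactSupport φ ∧ tsupport φ ⊆ Ioo 0 l

/-- `g ∈ L²(0,l)` is the weak derivative of `y ∈ L²(0,l)` on `(0,l)`. -/
def IsWeakDeriv {l : ℝ} (y g : IntervalL2 l) : Prop :=
  ∀ φ : ℝ → ℝ, IsTestFunction l φ →
    ∫ x in Ioo 0 l, y x * deriv φ x = - ∫ x in Ioo 0 l, g x * φ x

/-- `y ∈ H²(0,l)`. -/
def MemH2 {l : ℝ} (y : IntervalL2 l) : Prop :=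
  ∃ g h : IntervalL2 l, IsWeakDeriv y g ∧ IsWeakDeriv g h

open Classical in
/-- The weak derivative in `L²(0,l)` (it is unique); `0` if there is none. -/
def weakDeriv {l : ℝ} (y : IntervalL2 l) : IntervalL2 l :=
  if h : ∃ g, IsWeakDeriv y g then h.choose else 0

/-- The square of the Gagliardo seminorm of order `1/2` on `(0,l)`:
`∬ |g(s) - g(t)|² / |s - t|² ds dt`. -/
def gagliardoHalfSq {l : ℝ} (g : IntervalL2 l) : ENNReal :=
  ∫⁻ p : ℝ × ℝ, ENNReal.ofReal (((g p.1 - g p.2) / (p.1 - p.2)) ^ 2)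
    ∂((volume.restrict (Ioo (0 : ℝ) l)).prod (volume.restrict (Ioo (0 : ℝ) l)))

/-- Membership in the fractional Sobolev (Sobolev-Slobodeckij) space `H^{k+1/2}(0,l)`: the weak
derivatives up to order `k` exist in `L²(0,l)`, and the `k`-th one has finite Gagliardo seminorm
of order `1/2`. -/
def MemHHalf (k : ℕ) {l : ℝ} (y : IntervalL2 l) : Prop :=
  (∀ j < k, ∃ g, IsWeakDeriv (weakDeriv^[j] y) g) ∧ gagliardoHalfSq (weakDeriv^[k] y) < ⊤

/-- The square of the norm of `H^{k+1/2}(0,l)`. -/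
def hHalfNormSq (k : ℕ) {l : ℝ} (y : IntervalL2 l) : ℝ :=
  (∑ j ∈ Finset.range (k + 1), ‖weakDeriv^[j] y‖ ^ 2) + (gagliardoHalfSq (weakDeriv^[k] y)).toReal

/-- The norm of `H^{k+1/2}([0,T]; ℝ^ι)` for a finite index set `ι`. -/
def hHalfNorm (k : ℕ) {T : ℝ} {ι : Type*} [Fintype ι] (f : ι → IntervalL2 T) : ℝ :=
  √(∑ i, hHalfNormSq k (f i))

/-- `f = 0` (almost everywhere) near `t = 0` and near `t = T`. -/
def VanishesNearEnds {T : ℝ} (f : IntervalL2 T) : Prop :=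
  ∃ δ > 0, ∀ᵐ t ∂(volume.restrict (Ioo (0 : ℝ) T)), t < δ ∨ T - δ < t → f t = 0

/-- A metric tree with vertices `V` and edges `E`: a combinatorial tree on `V`, whose edges are
indexed by `E`, each edge `e` being identified with the interval `(0, len e)`, in such a way that
`0` corresponds to the endpoint `src e` and `len e` to the endpoint `tgt e`. -/
structure MetricTree (V E : Type*) where
  graph : SimpleGraph V
  isTree : graph.IsTree
  edge : E ≃ graph.edgeSet
  src : E → V
  tgt : E → V
  edge_eq : ∀ e, (edge e : Sym2 V) = s(src e, tgt e)
  len : E → ℝ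
  len_pos : ∀ e, 0 < len e

namespace MetricTree

variable {V E : Type*} [Fintype V] [Fintype E]

open Classical in
/-- The leaves: the vertices with exactly one incident edge. -/
def leaves (Ω : MetricTree V E) : Finset V :=
  {v | ({e | Ω.src e = v ∨ Ω.tgt e = v} : Finset E).card = 1}

/-- `L²(Ω)`, the Hilbert sum of the spaces `L²(0, len e)`. -/
abbrev L2 (Ω : MetricTree V E) : Type _ := PiLp 2 (fun e : E => IntervalL2 (Ω.len e))

/-- `L^∞(Ω)` (real-valued functions). -/
abbrev LInfty (Ω : MetricTree V E) : Type _ :=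
  (e : E) → Lp ℝ ⊤ (volume.restrict (Ioo (0 : ℝ) (Ω.len e)))

/-- `y` has a continuous representative on the whole metric tree, with the value `w v` at each
vertex `v` (every edge being closed up by its two endpoints). -/
def HasVertexValues (Ω : MetricTree V E) (y : Ω.L2) (w : V → ℝ) : Prop :=
  ∀ e, ∃ Y : ℝ → ℝ, ContinuousOn Y (Icc 0 (Ω.len e)) ∧
    y e =ᵐ[volume.restrict (Ioo 0 (Ω.len e))] Y ∧ Y 0 = w (Ω.src e) ∧ Y (Ω.len e) = w (Ω.tgt e)

end MetricTree

section Closure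

lemma IsTestFunction.integrable_mul {l : ℝ} {φ : ℝ → ℝ} (hφ : IsTestFunction l φ)
    (y : IntervalL2 l) : IntegrableOn (fun x => y x * φ x) (Ioo 0 l) := by
  have h2 : MemLp φ 2 (volume.restrict (Ioo (0 : ℝ) l)) :=
    (hφ.1.continuous.memLp_of_hasCompactSupport hφ.2.1).restrict _
  exact (Lp.memLp y).integrable_mul h2

lemma IsTestFunction.deriv {l : ℝ} {φ : ℝ → ℝ} (hφ : IsTestFunction l φ) :
    IsTestFunction l (deriv φ) := by
  refine ⟨?_, hφ.2.1.deriv, (closure_mono support_deriv_subset).trans ?_⟩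
  · exact hφ.1.iterate_deriv 1
  · simpa [tsupport] using hφ.2.2

lemma IsWeakDeriv.zero {l : ℝ} : IsWeakDeriv (0 : IntervalL2 l) 0 := by
  intro φ _
  have e1 : ∀ ψ : ℝ → ℝ, ∫ x in Ioo 0 l, (0 : IntervalL2 l) x * ψ x = 0 := by
    intro ψ
    refine integral_eq_zero_of_ae ?_
    have h := Lp.coeFn_zero ℝ 2 (volume.restrict (Ioo (0 : ℝ) l))
    filter_upwards [h] with x hx
    rw [hx]
    simp
  rw [e1, e1, neg_zero]

lemma IsWeakDeriv.add {l : ℝ} {y g y' g' : IntervalL2 l} (h : IsWeakDeriv y g)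
    (h' : IsWeakDeriv y' g') : IsWeakDeriv (y + y') (g + g') := by
  intro φ hφ
  have e1 : ∀ a b : IntervalL2 l, ∀ ψ : ℝ → ℝ, IsTestFunction l ψ →
      ∫ x in Ioo 0 l, (a + b : IntervalL2 l) x * ψ x =
        (∫ x in Ioo 0 l, a x * ψ x) + ∫ x in Ioo 0 l, b x * ψ x := by
    intro a b ψ hψ
    rw [← integral_add (hψ.integrable_mul a) (hψ.integrable_mul b)]
    refine integral_congr_ae ((Lp.coeFn_add a b).mono fun x hx => ?_)
    change (a + b : IntervalL2 l) x * ψ x = a x * ψ x + b x * ψ x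
    rw [hx, Pi.add_apply, add_mul]
  rw [e1 _ _ _ hφ.deriv, e1 _ _ _ hφ, h φ hφ, h' φ hφ]
  ring

lemma IsWeakDeriv.smul {l : ℝ} {y g : IntervalL2 l} (c : ℝ) (h : IsWeakDeriv y g) :
    IsWeakDeriv (c • y) (c • g) := by
  intro φ hφ
  have e1 : ∀ a : IntervalL2 l, ∀ ψ : ℝ → ℝ,
      ∫ x in Ioo 0 l, (c • a : IntervalL2 l) x * ψ x = c * ∫ x in Ioo 0 l, a x * ψ x := by
    intro a ψ
    rw [← integral_const_mul]
    exact integral_congr_ae ((Lp.coeFn_smul c a).mono fun x hx => by simp [hx, mul_assoc])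
  rw [e1, e1, h φ hφ]
  ring

end Closure

namespace MetricTree

variable {V E : Type*} [Fintype V] [Fintype E]

/-- `H¹(Ω)`: the continuous functions on the metric tree that belong to `H¹(0, len e)` on each
edge `e`. An element is stored as the pair `(y, y')` of the function and its weak derivative
(which is determined by `y`), so that the inherited norm is `(‖y‖² + ‖y'‖²)^{1/2}`. -/
def H1 (Ω : MetricTree V E) : Submodule ℝ (WithLp 2 (Ω.L2 × Ω.L2)) where
  carrier := {p | (∀ e, IsWeakDeriv (p.fst e) (p.snd e)) ∧ ∃ w, Ω.HasVertexValues p.fst w}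
  zero_mem' := by
    refine ⟨fun e => IsWeakDeriv.zero, fun _ => 0, fun e => ⟨0, continuousOn_const, ?_, rfl, rfl⟩⟩
    exact Lp.coeFn_zero ..
  add_mem' := by
    rintro p r ⟨hp, w, hw⟩ ⟨hr, z, hz⟩
    refine ⟨fun e => (hp e).add (hr e), w + z, fun e => ?_⟩
    obtain ⟨Y, h1, h2, h3, h4⟩ := hw e
    obtain ⟨Z, k1, k2, k3, k4⟩ := hz e
    refine ⟨Y + Z, h1.add k1, ?_, by simp [h3, k3], by simp [h4, k4]⟩
    exact (Lp.coeFn_add (p.fst e) (r.fst e)).trans (h2.add k2)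
  smul_mem' := by
    rintro c p ⟨hp, w, hw⟩
    refine ⟨fun e => (hp e).smul c, c • w, fun e => ?_⟩
    obtain ⟨Y, h1, h2, h3, h4⟩ := hw e
    refine ⟨c • Y, h1.const_smul c, ?_, by simp [h3], by simp [h4]⟩
    exact (Lp.coeFn_smul c (p.fst e)).trans (h2.const_smul c)

variable {Ω : MetricTree V E}

/-- The embedding `H¹(Ω) → L²(Ω)`. -/
def toL2 (y : Ω.H1) : Ω.L2 := y.1.fst

/-- The weak derivative `∂ₓ : H¹(Ω) → L²(Ω)`. -/
def dx (y : Ω.H1) : Ω.L2 := y.1.snd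

/-- The value of `y ∈ H¹(Ω)` at a vertex, i.e. the value of its continuous representative (it is
unique, since every vertex is an endpoint of an edge as soon as there is an edge). -/
def trace (y : Ω.H1) (v : V) : ℝ := y.2.2.choose v

/-- `y ∈ H¹₀(Ω)`: `y` vanishes at all the leaves. -/
def VanishesOnLeaves (y : Ω.H1) : Prop := ∀ v ∈ Ω.leaves, trace y v = 0

/-- `E¹ = C([0,T]; H¹(Ω)) ∩ C¹([0,T]; L²(Ω))`. The values of `u` outside `[0,T]` are irrelevant. -/
def MemE1 (T : ℝ) (u : ℝ → Ω.H1) : Prop :=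
  ContinuousOn u (Icc 0 T) ∧ ContDiffOn ℝ 1 (fun t => toL2 (u t)) (Icc 0 T)

/-- The time derivative `∂ₜu(·,t) ∈ L²(Ω)` on `[0,T]` (one-sided at the two ends). -/
def dt (T : ℝ) (u : ℝ → Ω.H1) (t : ℝ) : Ω.L2 :=
  derivWithin (fun s => toL2 (u s)) (Icc 0 T) t

/-- The norm of `E¹`. -/
def e1Norm (T : ℝ) (u : ℝ → Ω.H1) : ℝ :=
  (⨆ t : Icc (0 : ℝ) T, ‖u t‖) + ⨆ t : Icc (0 : ℝ) T, ‖dt T u t‖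

/-- The bilinear form `∫_Ω q y z dx`. -/
def potentialForm (q : Ω.LInfty) (y z : Ω.L2) : ℝ :=
  ∑ e, ∫ x in Ioo 0 (Ω.len e), q e x * y e x * z e x

/-- `u ∈ E¹` is a (weak) solution of
* `∂ₜ²u - ∂ₓ²u + q u = F` on `(Ω ∖ V) × (0,T)`,
* `u = f` on `Γ × (0,T)`, where `Γ` is the set of leaves,
* `u = 0` and `∂ₜu = 0` at `t = 0`,
* the Kirchhoff-Neumann condition on `V ∖ Γ`.

The equation is required in the usual variational sense: for every `φ ∈ H¹₀(Ω)`,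
`d/dt (∂ₜu, φ) + (∂ₓu, ∂ₓφ) + (q u, φ) = (F, φ)` in the sense of distributions on `(0,T)`. Of the
Kirchhoff-Neumann condition, the continuity at the vertices is contained in `u(t) ∈ H¹(Ω)`, and the
vanishing of the sum of the outward derivatives at each vertex of `V ∖ Γ` is the natural condition
contained in the variational equation, as `φ` is arbitrary at those vertices. -/
structure IsSolution (T : ℝ) (q : Ω.LInfty) (F : Lp Ω.L2 1 (volume.restrict (Ioo (0 : ℝ) T)))
    (f : Ω.leaves → IntervalL2 T) (u : ℝ → Ω.H1) : Prop where
  memE1 : MemE1 T u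
  equation : ∀ φ : Ω.H1, VanishesOnLeaves φ → ∀ ψ : ℝ → ℝ, IsTestFunction T ψ →
    - (∫ t in Ioo 0 T, deriv ψ t * inner ℝ (dt T u t) (toL2 φ))
      + (∫ t in Ioo 0 T, ψ t * (inner ℝ (dx (u t)) (dx φ) + potentialForm q (toL2 (u t)) (toL2 φ)))
      = ∫ t in Ioo 0 T, ψ t * inner ℝ (F t) (toL2 φ)
  boundary : ∀ v : Ω.leaves, ∀ᵐ t ∂(volume.restrict (Ioo (0 : ℝ) T)), trace (u t) v = f v t
  initial : u 0 = 0
  initial_dt : dt T u 0 = 0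

end MetricTree

end

/-!
The initial-boundary value problem is reduced to an abstract wave equation by subtracting an
explicit lift of the boundary data.

*The abstract wave equation.* Let `j : V → H` be an injective bounded map with dense range between
real Hilbert spaces, and let `A` be the operator of the form `⟪u, φ⟫_V`. The inverse of the generator
`(u, p) ↦ (p, -A u)` of the wave equation `u'' + A u = F` is the *bounded* skew operator
`K (u, p) = (-j† p, j u)` on `V × H` (`waveInverse`). Hence no unbounded operators and no semigroup
theory are needed: solving `z' = K⁻¹ z + P z + F` means solving `K z(t) = ∫₀ᵗ (z + K P z + K F)`, and
the Yosida approximations, with the bounded dissipative operators `(K - ε)⁻¹` in place of `K⁻¹`,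
converge uniformly on `[0,T]` when `F` is of class `C¹` (`exists_integral_solution_of_contDiff`). The
energy estimate `‖z(t)‖ ≤ exp(‖P‖ T) ∫ ‖F‖` extends this to `F ∈ L¹` by density. This yields
`exists_abstract_wave` and `abstract_wave_unique`. They are applied with `V = H¹₀(Ω)` and `H = L²(Ω)`,
where the bounded operator `q - 1` is absorbed in `P`.

*The lift.* Close to a leaf, boundary data `f` propagate into the adjacent edge as the travelling wave
`f(t - d)`, where `d` is the distance to the leaf. Multiplied by the cutoff `χ = (1 - d/l)²`, which
vanishes to second order at the other end of the edge, it satisfies the wave equation with the source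
`2 χ' f'(t - d) - χ'' f(t - d)`, up to the sign of the first term given by the orientation of the
edge. As the second derivatives of `f` cancel, `f ∈ H¹` suffices for a source in `C([0,T]; L²)`, and
the seminorm of order `1/2` is not needed for the estimate. That `f` vanishes near `t = 0` makes the
lift compatible with the zero initial data. `exists_isMildSolution` adds the lift and the solution of
the abstract problem.

*Weak solutions.* Existence and uniqueness are proved for the equation integrated once in time
(`IsMildSolution`). By the du Bois-Reymond lemma this is equivalent to the equation in the sense of
distributions (`IsMildSolution.isSolution` and `IsSolution.isMildSolution`).

*Regularity.* If `F = G` is of class `C¹` with `G(0) = 0`, let `v` be the solution for the data `G'`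
and `f'`. Its primitive in time solves the problem for `G` and `f`, so it is `u`
(`IsMildSolution.integral`). Therefore `∂ₜ²u = ∂ₜv` is continuous with values in `L²(Ω)`, the equation
holds at every time, and it says that `∂ₓu` has the weak derivative `∂ₜ²u + q u - G` in `L²` on each
edge.
-/

noncomputable section

/-! ### Evolution equations with bounded dissipative generators -/

section DissipativeEvolution

open Filter Topology
open scoped RealInnerProductSpace

variable {X : Type*} [NormedAddCommGroup X] [InnerProductSpace ℝ X]

/-- Duhamel's formula. -/
lemma exists_hasDerivAt_linear [CompleteSpace X] (A : X →L[ℝ] X) {F : ℝ → X} (hF : Continuous F)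
    (z₀ : X) : ∃ z : ℝ → X, z 0 = z₀ ∧ ∀ t, HasDerivAt z (A (z t) + F t) t := by
  have hexp : ∀ t : ℝ, HasDerivAt (fun s : ℝ => NormedSpace.exp (s • A))
      (A * NormedSpace.exp (t • A)) t := fun t => hasDerivAt_exp_smul_const' A t
  have hc : Continuous fun s : ℝ => NormedSpace.exp ((-s) • A) := by
    have h1 : Continuous fun s : ℝ => NormedSpace.exp (s • A) :=
      continuous_iff_continuousAt.2 fun t => (hexp t).continuousAt
    exact h1.comp continuous_neg
  have hG : Continuous fun s : ℝ => NormedSpace.exp ((-s) • A) (F s) := hc.clm_apply hF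
  refine ⟨fun t => NormedSpace.exp (t • A)
    (z₀ + ∫ s in (0 : ℝ)..t, NormedSpace.exp ((-s) • A) (F s)), by simp, fun t => ?_⟩
  have h2 : HasDerivAt (fun t => z₀ + ∫ s in (0 : ℝ)..t, NormedSpace.exp ((-s) • A) (F s))
      (NormedSpace.exp ((-t) • A) (F t)) t :=
    (intervalIntegral.integral_hasDerivAt_right (hG.intervalIntegrable _ _)
      hG.aestronglyMeasurable.stronglyMeasurableAtFilter hG.continuousAt).const_add _
  have h3 := (hexp t).clm_apply h2
  convert h3 using 1
  let _ : NormedAlgebra ℚ (X →L[ℝ] X) := NormedAlgebra.restrictScalars ℚ ℝ _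
  have h4 : NormedSpace.exp (t • A) * NormedSpace.exp ((-t) • A) = 1 := by
    have hcomm : Commute (t • A) ((-t) • A) :=
      ((Commute.refl A).smul_left t).smul_right (-t)
    rw [← NormedSpace.exp_add_of_commute hcomm, ← add_smul]
    simp
  have h5 : NormedSpace.exp (t • A) (NormedSpace.exp ((-t) • A) (F t)) = F t := by
    rw [← mul_apply_eq_comp, h4]; rfl
  rw [h5]
  rfl

/-- The energy estimate for `z' = A z + F` when `A` is quasi-dissipative. -/
lemma norm_le_of_quasiDissipative {A : X →L[ℝ] X} {ω : ℝ} (hω : 0 ≤ ω)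
    (hA : ∀ x, ⟪A x, x⟫ ≤ ω * ‖x‖ ^ 2) {F : ℝ → X} (hF : Continuous F) {z : ℝ → X}
    (hz : ∀ t, HasDerivAt z (A (z t) + F t) t) {t : ℝ} (ht : 0 ≤ t) :
    ‖z t‖ ≤ Real.exp (ω * t) * (‖z 0‖ + ∫ s in (0 : ℝ)..t, ‖F s‖) := by
  -- `‖z‖` is regularized to `√(δ² + ‖z‖²)`, which is differentiable
  have key : ∀ δ : ℝ, 0 < δ →
      ‖z t‖ ≤ Real.exp (ω * t) * ((δ + ‖z 0‖) + ∫ s in (0 : ℝ)..t, ‖F s‖) := by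
    intro δ hδ
    set n : ℝ → ℝ := fun s => √(δ ^ 2 + ‖z s‖ ^ 2) with hn
    have hpos : ∀ s, 0 < δ ^ 2 + ‖z s‖ ^ 2 := fun s => by positivity
    have hnpos : ∀ s, 0 < n s := fun s => Real.sqrt_pos.2 (hpos s)
    have hnsq : ∀ s, n s ^ 2 = δ ^ 2 + ‖z s‖ ^ 2 := fun s => Real.sq_sqrt (hpos s).le
    have hzn : ∀ s, ‖z s‖ ≤ n s := fun s => Real.le_sqrt_of_sq_le (by nlinarith [sq_nonneg δ])
    have hdn : ∀ s, HasDerivAt n (⟪z s, A (z s) + F s⟫ / n s) s := by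
      intro s
      have h1 := (((hz s).norm_sq).const_add (δ ^ 2)).sqrt (hpos s).ne'
      convert h1 using 1
      have := (hnpos s).ne'
      change _ = 2 * _ / (2 * n s)
      field_simp
    have hle : ∀ s, ⟪z s, A (z s) + F s⟫ / n s ≤ ω * n s + ‖F s‖ := by
      intro s
      rw [div_le_iff₀ (hnpos s), inner_add_right, real_inner_comm]
      have h1 := hA (z s)
      have h2 := real_inner_le_norm (z s) (F s)
      have h3 : ‖z s‖ * ‖F s‖ ≤ n s * ‖F s‖ := by gcongr; exact hzn s
      have h4 : ω * ‖z s‖ ^ 2 ≤ ω * n s ^ 2 := by gcongr; exact hzn s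
      nlinarith
    have hdF : ∀ s, HasDerivAt (fun r => ∫ s in (0 : ℝ)..r, ‖F s‖) ‖F s‖ s := fun s =>
      intervalIntegral.integral_hasDerivAt_right (hF.norm.intervalIntegrable _ _)
        hF.norm.aestronglyMeasurable.stronglyMeasurableAtFilter hF.norm.continuousAt
    set g : ℝ → ℝ := fun s => Real.exp (-ω * s) * n s - ∫ r in (0 : ℝ)..s, ‖F r‖ with hg
    have hdg : ∀ s, HasDerivAt g (Real.exp (-ω * s) * (-ω) * n s
        + Real.exp (-ω * s) * (⟪z s, A (z s) + F s⟫ / n s) - ‖F s‖) s := by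
      intro s
      have h1 : HasDerivAt (fun s => Real.exp (-ω * s)) (Real.exp (-ω * s) * (-ω)) s := by
        simpa using ((hasDerivAt_id s).const_mul (-ω)).exp
      exact (h1.mul (hdn s)).sub (hdF s)
    have hanti : AntitoneOn g (Ici 0) := by
      refine antitoneOn_of_deriv_nonpos (convex_Ici 0)
        (fun s _ => (hdg s).continuousAt.continuousWithinAt)
        (fun s _ => (hdg s).differentiableAt.differentiableWithinAt) fun s hs => ?_
      rw [interior_Ici] at hs
      rw [(hdg s).deriv]
      have e0 : Real.exp (-ω * s) ≤ 1 := by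
        rw [Real.exp_le_one_iff]; nlinarith [hs.out]
      have e1 := Real.exp_pos (-ω * s)
      have h1 := mul_le_mul_of_nonneg_left (hle s) e1.le
      have h2 := mul_le_mul_of_nonneg_right e0 (norm_nonneg (F s))
      nlinarith
    have h0 := hanti (mem_Ici.2 le_rfl) (mem_Ici.2 ht) ht
    simp only [hg, mul_zero, Real.exp_zero, one_mul, intervalIntegral.integral_same,
      sub_zero] at h0
    have hn0 : n 0 ≤ δ + ‖z 0‖ :=
      Real.sqrt_le_iff.2 ⟨by positivity, by nlinarith [norm_nonneg (z 0)]⟩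
    have h1 : Real.exp (-ω * t) * n t ≤ δ + ‖z 0‖ + ∫ s in (0 : ℝ)..t, ‖F s‖ := by linarith
    have h2 := mul_le_mul_of_nonneg_left h1 (Real.exp_pos (ω * t)).le
    rw [← mul_assoc, ← Real.exp_add] at h2
    have h3 : ω * t + -ω * t = 0 := by ring
    rw [h3, Real.exp_zero, one_mul] at h2
    exact (hzn t).trans h2
  have hlim : Tendsto (fun δ : ℝ => Real.exp (ω * t) * ((δ + ‖z 0‖) + ∫ s in (0 : ℝ)..t, ‖F s‖))
      (𝓝[>] 0) (𝓝 (Real.exp (ω * t) * ((0 + ‖z 0‖) + ∫ s in (0 : ℝ)..t, ‖F s‖))) :=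
    (Continuous.tendsto (by fun_prop) 0).mono_left nhdsWithin_le_nhds
  rw [zero_add] at hlim
  exact ge_of_tendsto hlim (eventually_nhdsWithin_of_forall fun δ hδ => key δ hδ)

/-- The resolvent `(K - ε)⁻¹` of a skew operator `K`; it exists by the Lax-Milgram theorem, as
`⟪(ε - K) x, x⟫ = ε ‖x‖²`. -/
lemma exists_resolvent_of_skew [CompleteSpace X] {K : X →L[ℝ] X} (hK : ∀ x, ⟪K x, x⟫ = 0) {ε : ℝ}
    (hε : 0 < ε) : ∃ R : X →L[ℝ] X, ∀ x, K (R x) - ε • R x = x := by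
  let S : X →L[ℝ] X := ε • ContinuousLinearMap.id ℝ X - K
  have hS : IsCoercive ((innerSL ℝ).comp S) := by
    refine ⟨ε, hε, fun x => ?_⟩
    have h : (innerSL ℝ).comp S x x = ε * (‖x‖ * ‖x‖) := by
      simp [S, hK, sq]
    rw [h, mul_assoc]
  have hSe : ∀ x, hS.continuousLinearEquivOfBilin x = S x := fun x =>
    (hS.unique_continuousLinearEquivOfBilin (v := x) (f := S x) fun w => rfl).symm
  refine ⟨-(hS.continuousLinearEquivOfBilin.symm : X →L[ℝ] X), fun x => ?_⟩
  have h1 : S (hS.continuousLinearEquivOfBilin.symm x) = x := by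
    rw [← hSe, ContinuousLinearEquiv.apply_symm_apply]
  have h2 : ε • hS.continuousLinearEquivOfBilin.symm x
      - K (hS.continuousLinearEquivOfBilin.symm x) = x := h1
  change K (-hS.continuousLinearEquivOfBilin.symm x)
    - ε • (-hS.continuousLinearEquivOfBilin.symm x) = x
  rw [map_neg, smul_neg, sub_neg_eq_add, neg_add_eq_sub]
  exact h2

lemma hasDerivAt_integral_of_continuous {Y : Type*} [NormedAddCommGroup Y] [NormedSpace ℝ Y]
    [CompleteSpace Y] {g : ℝ → Y} (hg : Continuous g) (t : ℝ) :
    HasDerivAt (fun r => ∫ s in (0 : ℝ)..r, g s) (g t) t :=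
  intervalIntegral.integral_hasDerivAt_right (hg.intervalIntegrable _ _)
    hg.aestronglyMeasurable.stronglyMeasurableAtFilter hg.continuousAt

/-- Two differentiable curves with the same derivative and the same initial value agree. -/
lemma eq_of_hasDerivAt_eq {Y : Type*} [NormedAddCommGroup Y] [NormedSpace ℝ Y]
    {f g f' : ℝ → Y} (hf : ∀ t, HasDerivAt f (f' t) t) (hg : ∀ t, HasDerivAt g (f' t) t)
    (h0 : f 0 = g 0) (t : ℝ) : f t = g t := by
  have h1 : ∀ t, HasDerivAt (fun s => f s - g s) 0 t := fun t => by
    simpa only [sub_self] using (hf t).fun_sub (hg t)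
  have h2 := is_const_of_deriv_eq_zero (fun t => (h1 t).differentiableAt)
    (fun t => (h1 t).deriv) t 0
  simpa [h0, sub_eq_zero] using h2

/-- The Yosida approximations `z' = (K - ε)⁻¹ z + P z + F` of the evolution equation generated by
`K⁻¹ + P`. The term `b = (K - ε)⁻¹ z` is bounded uniformly in `ε`, because `z'` solves the same
equation with `F'` in place of `F`. -/
lemma exists_yosida_approx [CompleteSpace X] {K : X →L[ℝ] X} (hK : ∀ x, ⟪K x, x⟫ = 0)
    (P : X →L[ℝ] X) {F : ℝ → X} (hF : ContDiff ℝ 1 F) (T : ℝ) :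
    ∃ D : ℝ, ∀ ε : ℝ, 0 < ε → ∃ z b : ℝ → X, z 0 = 0 ∧ Continuous b ∧
      (∀ t, HasDerivAt z (b t + P (z t) + F t) t) ∧ (∀ t, K (b t) - ε • b t = z t) ∧
      (∀ t ∈ Icc 0 T, ‖z t‖ ≤ Real.exp (‖P‖ * T) * ∫ s in (0 : ℝ)..T, ‖F s‖) ∧
      ∀ t ∈ Icc 0 T, ‖b t‖ ≤ D := by
  have hFc := hF.continuous
  have hF'c : Continuous (deriv F) := hF.continuous_deriv le_rfl
  have hFd : ∀ t, HasDerivAt F (deriv F t) t := fun t =>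
    (hF.differentiable one_ne_zero t).hasDerivAt
  obtain ⟨B, hB⟩ := isCompact_Icc.exists_bound_of_continuousOn (hFc.continuousOn (s := Icc 0 T))
  set N := Real.exp (‖P‖ * T) * ∫ s in (0 : ℝ)..T, ‖F s‖ with hN
  set N' := Real.exp (‖P‖ * T) * (‖F 0‖ + ∫ s in (0 : ℝ)..T, ‖deriv F s‖) with hN'
  refine ⟨N' + ‖P‖ * N + B, fun ε hε => ?_⟩
  obtain ⟨R, hR⟩ := exists_resolvent_of_skew hK hε
  -- `(K - ε)⁻¹` is dissipative
  have hRd : ∀ x, ⟪(R + P) x, x⟫ ≤ ‖P‖ * ‖x‖ ^ 2 := by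
    intro x
    have h1 : ⟪R x, x⟫ = -(ε * ‖R x‖ ^ 2) := by
      calc ⟪R x, x⟫ = ⟪R x, K (R x) - ε • R x⟫ := by rw [hR]
        _ = -(ε * ‖R x‖ ^ 2) := by
          rw [inner_sub_right, real_inner_comm, hK, inner_smul_right, real_inner_self_eq_norm_sq]
          ring
    have h2 : ⟪P x, x⟫ ≤ ‖P‖ * ‖x‖ ^ 2 := by
      calc ⟪P x, x⟫ ≤ ‖P x‖ * ‖x‖ := real_inner_le_norm _ _
        _ ≤ (‖P‖ * ‖x‖) * ‖x‖ := by gcongr; exact P.le_opNorm x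
        _ = ‖P‖ * ‖x‖ ^ 2 := by ring
    have h3 : ⟪(R + P) x, x⟫ = ⟪R x, x⟫ + ⟪P x, x⟫ := inner_add_left _ _ _
    rw [h3, h1]
    nlinarith [mul_nonneg hε.le (sq_nonneg ‖R x‖)]
  -- `v = z'` is obtained first, from the differentiated equation
  obtain ⟨v, hv0, hv⟩ := exists_hasDerivAt_linear (R + P) hF'c (F 0)
  have hvc : Continuous v := continuous_iff_continuousAt.2 fun t => (hv t).continuousAt
  set z : ℝ → X := fun t => ∫ s in (0 : ℝ)..t, v s with hz
  have hz0 : z 0 = 0 := by simp [hz]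
  have hzv : ∀ t, HasDerivAt z (v t) t := hasDerivAt_integral_of_continuous hvc
  have hveq : ∀ t, v t = (R + P) (z t) + F t := by
    refine eq_of_hasDerivAt_eq hv (fun t => ?_) (by rw [hz0, hv0]; simp)
    exact ((R + P).hasFDerivAt.comp_hasDerivAt t (hzv t)).add (hFd t)
  have hzd : ∀ t, HasDerivAt z ((R + P) (z t) + F t) t := fun t => hveq t ▸ hzv t
  have hzc : Continuous z := continuous_iff_continuousAt.2 fun t => (hzv t).continuousAt
  have hmono : ∀ G : ℝ → X, Continuous G → ∀ t ∈ Icc (0 : ℝ) T, ∀ a : ℝ, 0 ≤ a →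
      Real.exp (‖P‖ * t) * (a + ∫ s in (0 : ℝ)..t, ‖G s‖) ≤
        Real.exp (‖P‖ * T) * (a + ∫ s in (0 : ℝ)..T, ‖G s‖) := by
    intro G hG t ht a ha
    have h1 : ∫ s in (0 : ℝ)..t, ‖G s‖ ≤ ∫ s in (0 : ℝ)..T, ‖G s‖ :=
      intervalIntegral.integral_mono_interval le_rfl ht.1 ht.2
        (Eventually.of_forall fun s => norm_nonneg _) (hG.norm.intervalIntegrable _ _)
    have h0 : 0 ≤ ∫ s in (0 : ℝ)..t, ‖G s‖ :=
      intervalIntegral.integral_nonneg ht.1 fun s _ => norm_nonneg _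
    have h2 : Real.exp (‖P‖ * t) ≤ Real.exp (‖P‖ * T) :=
      Real.exp_le_exp.2 (mul_le_mul_of_nonneg_left ht.2 (norm_nonneg _))
    gcongr
  have hzb : ∀ t ∈ Icc 0 T, ‖z t‖ ≤ N := by
    intro t ht
    have h1 := norm_le_of_quasiDissipative (norm_nonneg P) hRd hFc hzd ht.1
    rw [hz0, norm_zero] at h1
    have h2 := hmono F hFc t ht 0 le_rfl
    rw [zero_add (∫ s in (0 : ℝ)..T, ‖F s‖)] at h2
    exact h1.trans h2
  have hvb : ∀ t ∈ Icc 0 T, ‖v t‖ ≤ N' := by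
    intro t ht
    have h1 := norm_le_of_quasiDissipative (norm_nonneg P) hRd hF'c hv ht.1
    rw [hv0] at h1
    exact h1.trans (hmono _ hF'c t ht _ (norm_nonneg _))
  refine ⟨z, fun t => R (z t), hz0, R.continuous.comp hzc, hzd, fun t => hR _, hzb, fun t ht => ?_⟩
  have h1 : R (z t) = v t - P (z t) - F t := by
    rw [hveq t]
    change R (z t) = (R (z t) + P (z t)) + F t - P (z t) - F t
    abel
  change ‖R (z t)‖ ≤ _
  rw [h1]
  calc ‖v t - P (z t) - F t‖ ≤ ‖v t‖ + ‖P (z t)‖ + ‖F t‖ :=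
        (norm_sub_le _ _).trans (add_le_add_left (norm_sub_le _ _) _)
    _ ≤ N' + ‖P‖ * N + B := by
      gcongr
      · exact hvb t ht
      · exact (P.le_opNorm _).trans (by gcongr; exact hzb t ht)
      · exact hB t ht

/-- A uniform limit of continuous curves. -/
lemma exists_uniform_limit {Y : Type*} [NormedAddCommGroup Y] [CompleteSpace Y] {s : Set ℝ}
    {z : ℕ → ℝ → Y} (hz : ∀ n, ContinuousOn (z n) s) {a : ℕ → ℝ} (ha : Tendsto a atTop (𝓝 0))
    (h : ∀ n m, ∀ t ∈ s, ‖z n t - z m t‖ ≤ a n + a m) :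
    ∃ y : ℝ → Y, ContinuousOn y s ∧ ∀ t ∈ s, Tendsto (fun n => z n t) atTop (𝓝 (y t)) := by
  have hU : UniformCauchySeqOn z atTop s := by
    rw [Metric.uniformCauchySeqOn_iff]
    intro ε hε
    obtain ⟨N, hN⟩ := (ha.eventually (gt_mem_nhds (half_pos hε))).exists_forall_of_atTop
    refine ⟨N, fun m hm n hn t ht => ?_⟩
    rw [dist_eq_norm]
    linarith [h m n t ht, hN m hm, hN n hn]
  have hlim : ∀ t, ∃ y, t ∈ s → Tendsto (fun n => z n t) atTop (𝓝 y) := by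
    intro t
    by_cases ht : t ∈ s
    · obtain ⟨y, hy⟩ := cauchySeq_tendsto_of_complete (hU.cauchySeq ht)
      exact ⟨y, fun _ => hy⟩
    · exact ⟨0, fun h => absurd h ht⟩
  choose y hy using hlim
  refine ⟨y, ?_, fun t ht => hy t ht⟩
  exact (hU.tendstoUniformlyOn_of_tendsto fun t ht => hy t ht).continuousOn
    (Frequently.of_forall hz)

end DissipativeEvolution

/-! ### Evolution equations generated by the inverse of a skew operator -/

section SkewInverse

open Filter Topology
open scoped RealInnerProductSpace

variable {X : Type*} [NormedAddCommGroup X] [InnerProductSpace ℝ X]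

/-- Solvability of the evolution equation `z' = K⁻¹ z + P z + F`, `z(0) = 0`, written as
`K z(t) = ∫₀ᵗ (z + K P z + K F)`, for a continuously differentiable forcing `F`. The Yosida
approximations for two parameters `ε` and `ε'` differ by `O(√ε + √ε')` on `[0,T]`. -/
lemma exists_integral_solution_of_contDiff [CompleteSpace X] {K : X →L[ℝ] X}
    (hK : ∀ x, ⟪K x, x⟫ = 0) (P : X →L[ℝ] X) {F : ℝ → X} (hF : ContDiff ℝ 1 F) {T : ℝ}
    (hT : 0 ≤ T) :
    ∃ z : ℝ → X, ContinuousOn z (Icc 0 T) ∧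
      (∀ t ∈ Icc 0 T, K (z t) = ∫ s in (0 : ℝ)..t, (z s + K (P (z s)) + K (F s))) ∧
      ∀ t ∈ Icc 0 T, ‖z t‖ ≤ Real.exp (‖P‖ * T) * ∫ s in (0 : ℝ)..T, ‖F s‖ := by
  have hFc := hF.continuous
  obtain ⟨D, hD⟩ := exists_yosida_approx hK P hF T
  set N := Real.exp (‖P‖ * T) * ∫ s in (0 : ℝ)..T, ‖F s‖ with hN
  set ε : ℕ → ℝ := fun n => 1 / ((n : ℝ) + 1) with hε
  have hεpos : ∀ n, 0 < ε n := fun n => by positivity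
  have hε0 : Tendsto ε atTop (𝓝 0) := tendsto_one_div_add_atTop_nhds_zero_nat
  choose z b hz0 hbc hzd hbz hzN hbD using fun n => hD (ε n) (hεpos n)
  have hzc : ∀ n, Continuous (z n) := fun n =>
    continuous_iff_continuousAt.2 fun t => (hzd n t).continuousAt
  have hD0 : 0 ≤ D := (norm_nonneg _).trans (hbD 0 0 ⟨le_rfl, hT⟩)
  -- monotonicity of the Yosida approximations, with an error `O(ε n + ε m)`
  have hmon : ∀ n m, ∀ t ∈ Icc 0 T,
      ⟪b n t - b m t, z n t - z m t⟫ ≤ 2 * D ^ 2 * (ε n + ε m) := by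
    intro n m t ht
    have h1 : z n t - z m t = K (b n t - b m t) - (ε n • b n t - ε m • b m t) := by
      rw [← hbz n t, ← hbz m t, map_sub]; abel
    rw [h1, inner_sub_right, real_inner_comm, hK, zero_sub]
    have h2 : ‖b n t - b m t‖ ≤ 2 * D := by
      linarith [norm_sub_le (b n t) (b m t), hbD n t ht, hbD m t ht]
    have h3 : ‖ε n • b n t - ε m • b m t‖ ≤ D * (ε n + ε m) := by
      refine (norm_sub_le _ _).trans ?_
      rw [norm_smul, norm_smul, Real.norm_of_nonneg (hεpos n).le, Real.norm_of_nonneg (hεpos m).le]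
      nlinarith [mul_le_mul_of_nonneg_left (hbD n t ht) (hεpos n).le,
        mul_le_mul_of_nonneg_left (hbD m t ht) (hεpos m).le]
    calc -⟪b n t - b m t, ε n • b n t - ε m • b m t⟫
        ≤ ‖b n t - b m t‖ * ‖ε n • b n t - ε m • b m t‖ :=
          (neg_le_abs _).trans (abs_real_inner_le_norm _ _)
      _ ≤ (2 * D) * (D * (ε n + ε m)) := by gcongr
      _ = 2 * D ^ 2 * (ε n + ε m) := by ring
  set ω := ‖P‖ with hω
  set M := Real.exp (2 * ω * T) * (4 * D ^ 2 * T) with hM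
  have hM0 : 0 ≤ M := by positivity
  -- Gronwall's inequality for `‖z n - z m‖²`
  have hCauchy : ∀ n m, ∀ t ∈ Icc 0 T, ‖z n t - z m t‖ ^ 2 ≤ M * (ε n + ε m) := by
    intro n m t ht
    set w : ℝ → X := fun s => z n s - z m s with hw
    set w' : ℝ → X := fun s => (b n s - b m s) + P (w s) with hw'
    have hwd : ∀ s, HasDerivAt w (w' s) s := by
      intro s
      convert (hzd n s).fun_sub (hzd m s) using 1
      simp only [hw', hw, map_sub]
      abel
    set c := 4 * D ^ 2 * (ε n + ε m) with hc
    have hc0 : 0 ≤ c := by have := hεpos n; have := hεpos m; positivity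
    set g : ℝ → ℝ := fun s => Real.exp (-(2 * ω) * s) * ‖w s‖ ^ 2 - c * s with hg
    have hgd : ∀ s, HasDerivAt g (Real.exp (-(2 * ω) * s) * (-(2 * ω)) * ‖w s‖ ^ 2
        + Real.exp (-(2 * ω) * s) * (2 * ⟪w s, w' s⟫) - c) s := by
      intro s
      have h1 : HasDerivAt (fun s => Real.exp (-(2 * ω) * s))
          (Real.exp (-(2 * ω) * s) * (-(2 * ω))) s := by
        simpa using ((hasDerivAt_id s).const_mul (-(2 * ω))).exp
      have h2 : HasDerivAt (fun s => c * s) c s := by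
        simpa using (hasDerivAt_id s).const_mul c
      exact (h1.mul (hwd s).norm_sq).sub h2
    have hanti : AntitoneOn g (Icc 0 T) := by
      refine antitoneOn_of_deriv_nonpos (convex_Icc 0 T)
        (fun s _ => (hgd s).continuousAt.continuousWithinAt)
        (fun s _ => (hgd s).differentiableAt.differentiableWithinAt) fun s hs => ?_
      rw [interior_Icc] at hs
      rw [(hgd s).deriv]
      have e0 : Real.exp (-(2 * ω) * s) ≤ 1 := by
        rw [Real.exp_le_one_iff]
        nlinarith [hs.1, norm_nonneg P, mul_nonneg (norm_nonneg P) hs.1.le]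
      have e1 := Real.exp_pos (-(2 * ω) * s)
      have h1 : ⟪w s, w' s⟫ ≤ 2 * D ^ 2 * (ε n + ε m) + ω * ‖w s‖ ^ 2 := by
        have h2 : ⟪w s, P (w s)⟫ ≤ ω * ‖w s‖ ^ 2 := by
          calc ⟪w s, P (w s)⟫ ≤ ‖w s‖ * ‖P (w s)‖ := real_inner_le_norm _ _
            _ ≤ ‖w s‖ * (ω * ‖w s‖) := by gcongr; exact P.le_opNorm _
            _ = ω * ‖w s‖ ^ 2 := by ring
        have h3 := hmon n m s ⟨hs.1.le, hs.2.le⟩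
        simp only [hw', inner_add_right]
        rw [real_inner_comm] at h3
        exact add_le_add h3 h2
      have h2 := mul_le_mul_of_nonneg_left h1 e1.le
      have h3 := mul_le_mul_of_nonneg_right e0 hc0
      nlinarith
    have h0 := hanti ⟨le_rfl, hT⟩ ht ht.1
    have hw0 : w 0 = 0 := by simp [hw, hz0]
    simp only [hg, hw0, norm_zero, mul_zero, sub_zero] at h0
    norm_num at h0
    have h1 : Real.exp (2 * ω * t) * (Real.exp (-(2 * ω * t)) * ‖w t‖ ^ 2)
        ≤ Real.exp (2 * ω * t) * (c * t) := by gcongr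
    rw [← mul_assoc, ← Real.exp_add, add_neg_cancel, Real.exp_zero, one_mul] at h1
    refine h1.trans ?_
    calc Real.exp (2 * ω * t) * (c * t) ≤ Real.exp (2 * ω * T) * (c * T) := by
          have h2 : 2 * ω * t ≤ 2 * ω * T :=
            mul_le_mul_of_nonneg_left ht.2 (mul_nonneg zero_le_two (norm_nonneg P))
          have := ht.1
          gcongr
          exact ht.2
      _ = M * (ε n + ε m) := by simp only [hM, hc]; ring
  obtain ⟨y, hyc, hy⟩ : ∃ y : ℝ → X, ContinuousOn y (Icc 0 T) ∧
      ∀ t ∈ Icc 0 T, Tendsto (fun n => z n t) atTop (𝓝 (y t)) := by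
    refine exists_uniform_limit (a := fun n => √(M * ε n)) (fun n => (hzc n).continuousOn) ?_ ?_
    · have h1 : Tendsto (fun n => √(M * ε n)) atTop (𝓝 √(M * 0)) :=
        (Real.continuous_sqrt.tendsto _).comp (hε0.const_mul M)
      simpa using h1
    · intro n m t ht
      refine (Real.le_sqrt_of_sq_le (hCauchy n m t ht)).trans ?_
      rw [mul_add]
      have h1 := Real.sq_sqrt (mul_nonneg hM0 (hεpos n).le)
      have h2 := Real.sq_sqrt (mul_nonneg hM0 (hεpos m).le)
      refine Real.sqrt_le_iff.2 ⟨by positivity, ?_⟩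
      nlinarith [Real.sqrt_nonneg (M * ε n), Real.sqrt_nonneg (M * ε m)]
  refine ⟨y, hyc, fun t ht => ?_, fun t ht => le_of_tendsto (hy t ht).norm
    (Eventually.of_forall fun n => hzN n t ht)⟩
  have hsub : ∀ s ∈ uIoc 0 t, s ∈ Icc 0 T := by
    intro s hs
    rw [uIoc_of_le ht.1] at hs
    exact ⟨hs.1.le, hs.2.trans ht.2⟩
  -- the equation solved by `z n`, to which `K - ε n` has been applied
  have happ : ∀ n, K (z n t) - ε n • (z n t - ∫ s in (0 : ℝ)..t, (P (z n s) + F s)) =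
      ∫ s in (0 : ℝ)..t, (z n s + K (P (z n s)) + K (F s)) := by
    intro n
    have hPc : Continuous fun s => P (z n s) + F s := (P.continuous.comp (hzc n)).add hFc
    have hRc : Continuous fun s => z n s + K (P (z n s)) + K (F s) :=
      ((hzc n).add (K.continuous.comp (P.continuous.comp (hzc n)))).add (K.continuous.comp hFc)
    refine eq_of_hasDerivAt_eq
      (f := fun r => K (z n r) - ε n • (z n r - ∫ s in (0 : ℝ)..r, (P (z n s) + F s)))
      (f' := fun s => z n s + K (P (z n s)) + K (F s)) (fun s => ?_)
      (fun s => hasDerivAt_integral_of_continuous hRc s) (by simp [hz0]) t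
    have h1 := (K.hasFDerivAt.comp_hasDerivAt s (hzd n s)).fun_sub
      (((hzd n s).fun_sub (hasDerivAt_integral_of_continuous hPc s)).const_smul (ε n))
    refine h1.congr_deriv ?_
    rw [← hbz n s]
    simp only [map_add, map_sub, map_smul, smul_sub, smul_add]
    abel
  have hL1 : Tendsto (fun n => K (z n t) -
      ε n • (z n t - ∫ s in (0 : ℝ)..t, (P (z n s) + F s))) atTop (𝓝 (K (y t) - 0)) := by
    refine ((K.continuous.tendsto _).comp (hy t ht)).sub ?_
    have hI : Tendsto (fun n => ∫ s in (0 : ℝ)..t, (P (z n s) + F s)) atTop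
        (𝓝 (∫ s in (0 : ℝ)..t, (P (y s) + F s))) := by
      obtain ⟨B, hB⟩ :=
        isCompact_Icc.exists_bound_of_continuousOn (hFc.continuousOn (s := Icc 0 T))
      refine intervalIntegral.tendsto_integral_filter_of_dominated_convergence
        (fun _ => ω * N + B) (Eventually.of_forall fun n =>
          ((P.continuous.comp (hzc n)).add hFc).aestronglyMeasurable)
        (Eventually.of_forall fun n => Eventually.of_forall fun s hs => ?_)
        intervalIntegrable_const (Eventually.of_forall fun s hs => ?_)
      · refine (norm_add_le _ _).trans (add_le_add ((P.le_opNorm _).trans ?_) (hB s (hsub s hs)))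
        gcongr
        exact hzN n s (hsub s hs)
      · exact ((P.continuous.tendsto _).comp (hy s (hsub s hs))).add_const _
    simpa using hε0.smul ((hy t ht).sub hI)
  have hL2 : Tendsto (fun n => ∫ s in (0 : ℝ)..t, (z n s + K (P (z n s)) + K (F s))) atTop
      (𝓝 (∫ s in (0 : ℝ)..t, (y s + K (P (y s)) + K (F s)))) := by
    obtain ⟨B, hB⟩ := isCompact_Icc.exists_bound_of_continuousOn
      ((K.continuous.comp hFc).continuousOn (s := Icc 0 T))
    refine intervalIntegral.tendsto_integral_filter_of_dominated_convergence
      (fun _ => N + ‖K‖ * (ω * N) + B) (Eventually.of_forall fun n =>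
        (((hzc n).add (K.continuous.comp (P.continuous.comp (hzc n)))).add
          (K.continuous.comp hFc)).aestronglyMeasurable)
      (Eventually.of_forall fun n => Eventually.of_forall fun s hs => ?_)
      intervalIntegrable_const (Eventually.of_forall fun s hs => ?_)
    · have h1 := hzN n s (hsub s hs)
      refine (norm_add_le _ _).trans (add_le_add ((norm_add_le _ _).trans
        (add_le_add h1 ((K.le_opNorm _).trans ?_))) (hB s (hsub s hs)))
      gcongr
      exact (P.le_opNorm _).trans (by gcongr)
    · have h1 := hy s (hsub s hs)
      exact (h1.add ((K.continuous.tendsto _).comp ((P.continuous.tendsto _).comp h1))).add_const _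
  rw [sub_zero] at hL1
  exact tendsto_nhds_unique hL1 ((funext happ : _) ▸ hL2)

/-- Uniqueness for `z' = K⁻¹ z + Q K z`, `z(0) = 0`. For `y = K z` one has `y' = z + K Q y` with
`⟪z, y⟫ = 0`, so that `‖y‖²` satisfies a linear differential inequality. -/
lemma eq_zero_of_integral_equation [CompleteSpace X] {K : X →L[ℝ] X} (hK : ∀ x, ⟪K x, x⟫ = 0)
    (hinj : ∀ x, K x = 0 → x = 0) (Q : X →L[ℝ] X) {T : ℝ} {z : ℝ → X}
    (hz : ContinuousOn z (Icc 0 T))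
    (h : ∀ t ∈ Icc 0 T, K (z t) = ∫ s in (0 : ℝ)..t, (z s + K (Q (K (z s))))) :
    ∀ t ∈ Icc 0 T, z t = 0 := by
  set g : ℝ → X := fun s => z s + K (Q (K (z s))) with hg
  have hgc : ContinuousOn g (Icc 0 T) := by
    exact hz.add ((K.continuous.comp (Q.continuous.comp K.continuous)).comp_continuousOn hz)
  set f : ℝ → ℝ := fun t => ‖K (z t)‖ ^ 2 with hf
  have hfc : ContinuousOn f (Icc 0 T) := ((K.continuous.comp_continuousOn hz).norm).pow 2
  have hd : ∀ t ∈ Ico 0 T, HasDerivWithinAt f (2 * ⟪K (z t), g t⟫) (Ici t) t := by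
    intro t ht
    have hTpos : 0 ≤ T := ht.1.trans ht.2.le
    have hint : IntervalIntegrable g volume 0 t :=
      (hgc.mono (Icc_subset_Icc_right ht.2.le)).intervalIntegrable_of_Icc ht.1
    have hnhds : Icc 0 T ∈ 𝓝[>] t :=
      mem_of_superset (Ioo_mem_nhdsGT ht.2) fun s hs => ⟨ht.1.trans hs.1.le, hs.2.le⟩
    have h1 : HasDerivWithinAt (fun r => ∫ s in (0 : ℝ)..r, g s) (g t) (Ici t) t := by
      refine intervalIntegral.integral_hasDerivWithinAt_right hint
        (t := Ioi t) ⟨Icc 0 T, hnhds, hgc.aestronglyMeasurable measurableSet_Icc⟩ ?_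
      exact (hgc t ⟨ht.1, ht.2.le⟩).mono_of_mem_nhdsWithin hnhds
    have h2 : HasDerivWithinAt (fun r => K (z r)) (g t) (Ici t) t := by
      refine h1.congr_of_eventuallyEq ?_ (h t ⟨ht.1, ht.2.le⟩)
      have : Icc 0 T ∈ 𝓝[≥] t :=
        mem_of_superset (Ico_mem_nhdsGE ht.2) fun s hs => ⟨ht.1.trans hs.1, hs.2.le⟩
      filter_upwards [this] with r hr using h r hr
    exact h2.norm_sq
  have hbound : ∀ t ∈ Ico 0 T, ‖2 * ⟪K (z t), g t⟫‖ ≤ (2 * ‖K.comp Q‖) * ‖f t‖ := by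
    intro t _
    have h1 : ⟪K (z t), g t⟫ = ⟪K (z t), (K.comp Q) (K (z t))⟫ := by
      simp only [hg, inner_add_right, hK, zero_add]; rfl
    rw [h1, norm_mul, Real.norm_eq_abs, abs_two, hf, norm_pow, norm_norm, mul_assoc]
    gcongr
    calc ‖⟪K (z t), (K.comp Q) (K (z t))⟫‖ ≤ ‖K (z t)‖ * ‖(K.comp Q) (K (z t))‖ :=
          norm_inner_le_norm _ _
      _ ≤ ‖K (z t)‖ * (‖K.comp Q‖ * ‖K (z t)‖) := by
          gcongr; exact (K.comp Q).le_opNorm _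
      _ = ‖K.comp Q‖ * ‖K (z t)‖ ^ 2 := by ring
  intro t ht
  have hT : (0 : ℝ) ∈ Icc 0 T := ⟨le_rfl, ht.1.trans ht.2⟩
  have h0 : f 0 = 0 := by simp [hf, h 0 hT]
  have h1 := eq_zero_of_abs_deriv_le_mul_abs_self_of_eq_zero_right hfc hd h0 hbound t ht
  apply hinj
  simpa [hf] using h1

/-- Solvability of `z' = K⁻¹ z + Q K z + Φ`, `z(0) = 0`, in integrated form, for an integrable
forcing `Φ`: approximation of `Φ` by smooth functions, with the energy estimate for differences. -/
lemma exists_integral_solution [CompleteSpace X] {K : X →L[ℝ] X} (hK : ∀ x, ⟪K x, x⟫ = 0)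
    (hinj : ∀ x, K x = 0 → x = 0) (Q : X →L[ℝ] X) {T : ℝ} (hT : 0 ≤ T) {Φ : ℝ → X}
    (hΦ : Integrable Φ (volume.restrict (Ioo 0 T))) :
    ∃ z : ℝ → X, ContinuousOn z (Icc 0 T) ∧
      (∀ t ∈ Icc 0 T, K (z t) =
        (∫ s in (0 : ℝ)..t, (z s + K (Q (K (z s))))) + K (∫ s in (0 : ℝ)..t, Φ s)) ∧
      ∀ t ∈ Icc 0 T, ‖z t‖ ≤ Real.exp (‖Q.comp K‖ * T) * ∫ s in Ioo 0 T, ‖Φ s‖ := by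
  set ω := ‖Q.comp K‖ with hω
  set a : ℕ → ℝ := fun n => 1 / ((n : ℝ) + 1) with ha
  have hapos : ∀ n, 0 < a n := fun n => by positivity
  have ha0 : Tendsto a atTop (𝓝 0) := tendsto_one_div_add_atTop_nhds_zero_nat
  have happrox : ∀ n, ∃ G : ℝ → X, ContDiff ℝ 1 G ∧
      ∫ s in Ioo 0 T, ‖Φ s - G s‖ ≤ a n := by
    intro n
    obtain ⟨G, -, hG, hle⟩ := MemLp.exist_eLpNorm_sub_le ENNReal.one_ne_top le_rfl
      (memLp_one_iff_integrable.2 hΦ) (hapos n)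
    refine ⟨G, hG.of_le (by exact_mod_cast le_top), ?_⟩
    have h1 : ∫ s in Ioo 0 T, ‖Φ s - G s‖ =
        (eLpNorm (Φ - G) 1 (volume.restrict (Ioo 0 T))).toReal := by
      rw [eLpNorm_one_eq_lintegral_enorm, integral_norm_eq_lintegral_enorm]
      · rfl
      · exact hΦ.aestronglyMeasurable.sub hG.continuous.aestronglyMeasurable
    rw [h1]
    exact ENNReal.toReal_le_of_le_ofReal (hapos n).le hle
  choose G hG hGa using happrox
  have hGc : ∀ n, Continuous (G n) := fun n => (hG n).continuous
  have hGi : ∀ n, Integrable (G n) (volume.restrict (Ioo 0 T)) := fun n =>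
    ((hGc n).integrableOn_Icc (a := 0) (b := T)).mono_set Ioo_subset_Icc_self
  have hconv : ∀ g : ℝ → ℝ, ∫ s in (0 : ℝ)..T, g s = ∫ s in Ioo 0 T, g s := fun g => by
    rw [intervalIntegral.integral_of_le hT, integral_Ioc_eq_integral_Ioo]
  choose z hzc hz hzb using fun n => exists_integral_solution_of_contDiff hK (Q.comp K) (hG n) hT
  have hPc : ∀ {w : ℝ → X}, ContinuousOn w (Icc 0 T) →
      ContinuousOn (fun s => w s + K (Q (K (w s)))) (Icc 0 T) := fun hw =>
    hw.add ((K.continuous.comp (Q.continuous.comp K.continuous)).comp_continuousOn hw)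
  have hii : ∀ {w : ℝ → X}, ContinuousOn w (Icc 0 T) → ∀ t ∈ Icc 0 T,
      IntervalIntegrable w volume 0 t := fun hw t ht =>
    (hw.mono (Icc_subset_Icc_right ht.2)).intervalIntegrable_of_Icc ht.1
  have hdiff : ∀ n m, ∀ t ∈ Icc 0 T, ‖z n t - z m t‖ ≤
      Real.exp (ω * T) * a n + Real.exp (ω * T) * a m := by
    intro n m t ht
    obtain ⟨y, hyc, hy, hyb⟩ :=
      exists_integral_solution_of_contDiff hK (Q.comp K) ((hG n).sub (hG m)) hT
    have h1 : z n t - z m t - y t = 0 := by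
      refine eq_zero_of_integral_equation hK hinj Q (T := T) (z := fun s => z n s - z m s - y s)
        (((hzc n).sub (hzc m)).sub hyc) (fun r hr => ?_) t ht
      have hKG : ∀ n, IntervalIntegrable (fun s => K (G n s)) volume 0 r := fun n =>
        (K.continuous.comp (hGc n)).intervalIntegrable _ _
      have i1 := fun n => (hii (hPc (hzc n)) r hr).add (hKG n)
      have i2 : IntervalIntegrable
          (fun s => y s + K (Q (K (y s))) + K (G n s - G m s)) volume 0 r :=
        (hii (hPc hyc) r hr).add
          ((K.continuous.comp ((hGc n).sub (hGc m))).intervalIntegrable _ _)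
      have e1 := hz n r hr
      have e2 := hz m r hr
      have e3 := hy r hr
      simp only [ContinuousLinearMap.comp_apply] at e1 e2 e3
      rw [map_sub, map_sub, e1, e2, e3, ← intervalIntegral.integral_sub (i1 n) (i1 m),
        ← intervalIntegral.integral_sub ((i1 n).sub (i1 m)) i2]
      refine intervalIntegral.integral_congr fun s _ => ?_
      simp only [map_sub]
      abel
    rw [sub_eq_zero.1 h1, ← mul_add]
    refine (hyb t ht).trans ?_
    gcongr
    rw [hconv]
    have hi : ∀ n, Integrable (fun s => ‖Φ s - G n s‖) (volume.restrict (Ioo 0 T)) := fun n =>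
      (hΦ.sub (hGi n)).norm
    calc ∫ s in Ioo 0 T, ‖(G n - G m) s‖
        ≤ ∫ s in Ioo 0 T, (‖Φ s - G n s‖ + ‖Φ s - G m s‖) := by
          refine integral_mono ((hGi n).sub (hGi m)).norm ((hi n).add (hi m)) fun s => ?_
          rw [← norm_neg (Φ s - G n s)]
          refine le_trans (le_of_eq ?_) (norm_add_le _ _)
          congr 1
          simp
      _ = (∫ s in Ioo 0 T, ‖Φ s - G n s‖) + ∫ s in Ioo 0 T, ‖Φ s - G m s‖ :=
          integral_add (hi n) (hi m)
      _ ≤ a n + a m := add_le_add (hGa n) (hGa m)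
  obtain ⟨y, hyc, hy⟩ : ∃ y : ℝ → X, ContinuousOn y (Icc 0 T) ∧
      ∀ t ∈ Icc 0 T, Tendsto (fun n => z n t) atTop (𝓝 (y t)) := by
    refine exists_uniform_limit (a := fun n => Real.exp (ω * T) * a n) hzc ?_ hdiff
    simpa using ha0.const_mul (Real.exp (ω * T))
  have hGnorm : ∀ n, ∫ s in Ioo 0 T, ‖G n s‖ ≤ (∫ s in Ioo 0 T, ‖Φ s‖) + a n := by
    intro n
    have hi : Integrable (fun s => ‖Φ s - G n s‖) (volume.restrict (Ioo 0 T)) :=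
      (hΦ.sub (hGi n)).norm
    calc ∫ s in Ioo 0 T, ‖G n s‖ ≤ ∫ s in Ioo 0 T, (‖Φ s‖ + ‖Φ s - G n s‖) := by
          refine integral_mono (hGi n).norm (hΦ.norm.add hi) fun s => ?_
          refine le_trans (le_of_eq ?_) (norm_sub_le _ _)
          congr 1
          abel
      _ = (∫ s in Ioo 0 T, ‖Φ s‖) + ∫ s in Ioo 0 T, ‖Φ s - G n s‖ := integral_add hΦ.norm hi
      _ ≤ _ := by gcongr; exact hGa n
  have hzb' : ∀ n, ∀ t ∈ Icc 0 T,
      ‖z n t‖ ≤ Real.exp (ω * T) * ((∫ s in Ioo 0 T, ‖Φ s‖) + a n) := by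
    intro n t ht
    refine (hzb n t ht).trans ?_
    rw [hconv]
    gcongr
    exact hGnorm n
  refine ⟨y, hyc, fun t ht => ?_, fun t ht => ?_⟩
  · have hsub : ∀ s ∈ uIoc 0 t, s ∈ Icc 0 T := by
      intro s hs
      rw [uIoc_of_le ht.1] at hs
      exact ⟨hs.1.le, hs.2.trans ht.2⟩
    have hΦi : ∀ {g : ℝ → X}, Integrable g (volume.restrict (Ioo 0 T)) →
        IntervalIntegrable g volume 0 t := fun hg => by
      rw [intervalIntegrable_iff_integrableOn_Ioo_of_le ht.1]
      exact IntegrableOn.mono_set hg (Ioo_subset_Ioo_right ht.2)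
    have e1 : ∀ n, K (z n t) = (∫ s in (0 : ℝ)..t, (z n s + K (Q (K (z n s)))))
        + K (∫ s in (0 : ℝ)..t, G n s) := by
      intro n
      have hKG : IntervalIntegrable (fun s => K (G n s)) volume 0 t :=
        (K.continuous.comp (hGc n)).intervalIntegrable _ _
      rw [hz n t ht, ← K.intervalIntegral_comp_comm (hΦi (hGi n)),
        ← intervalIntegral.integral_add (hii (hPc (hzc n)) t ht) hKG]
      rfl
    have l1 : Tendsto (fun n => ∫ s in (0 : ℝ)..t, (z n s + K (Q (K (z n s))))) atTop
        (𝓝 (∫ s in (0 : ℝ)..t, (y s + K (Q (K (y s)))))) := by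
      set B := Real.exp (ω * T) * ((∫ s in Ioo 0 T, ‖Φ s‖) + 1) with hB
      have hzB : ∀ n, ∀ s ∈ Icc 0 T, ‖z n s‖ ≤ B := fun n s hs => (hzb' n s hs).trans <| by
        have : a n ≤ 1 := by
          rw [ha, div_le_one (by positivity)]
          linarith [(Nat.cast_nonneg n : (0 : ℝ) ≤ n)]
        rw [hB]
        gcongr
      refine intervalIntegral.tendsto_integral_filter_of_dominated_convergence
        (fun _ => B + ‖K.comp (Q.comp K)‖ * B) (Eventually.of_forall fun n =>
          (hii (hPc (hzc n)) t ht).aestronglyMeasurable_restrict_uIoc)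
        (Eventually.of_forall fun n => Eventually.of_forall fun s hs => ?_)
        intervalIntegrable_const (Eventually.of_forall fun s hs => ?_)
      · have h1 := hzB n s (hsub s hs)
        refine (norm_add_le _ _).trans (add_le_add h1 ?_)
        exact ((K.comp (Q.comp K)).le_opNorm (z n s)).trans
          (mul_le_mul_of_nonneg_left h1 (norm_nonneg _))
      · have h1 := hy s (hsub s hs)
        exact h1.add (((K.comp (Q.comp K)).continuous.tendsto _).comp h1)
    have l2 : Tendsto (fun n => ∫ s in (0 : ℝ)..t, G n s) atTop
        (𝓝 (∫ s in (0 : ℝ)..t, Φ s)) := by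
      refine tendsto_iff_norm_sub_tendsto_zero.2 ?_
      refine squeeze_zero (fun n => norm_nonneg _) (fun n => ?_) ha0
      rw [← intervalIntegral.integral_sub (hΦi (hGi n)) (hΦi hΦ), ← norm_neg,
        ← intervalIntegral.integral_neg]
      refine (intervalIntegral.norm_integral_le_integral_norm ht.1).trans ?_
      rw [intervalIntegral.integral_of_le ht.1, integral_Ioc_eq_integral_Ioo]
      refine le_trans ?_ (hGa n)
      have hi : IntegrableOn (fun s => ‖Φ s - G n s‖) (Ioo 0 T) := (hΦ.sub (hGi n)).norm
      simp only [neg_sub]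
      exact setIntegral_mono_set hi (Eventually.of_forall fun s => norm_nonneg _)
        (Ioo_subset_Ioo_right ht.2).eventuallyLE
    have l3 := l1.add ((K.continuous.tendsto _).comp l2)
    refine tendsto_nhds_unique ((K.continuous.tendsto _).comp (hy t ht)) ?_
    convert l3 using 1
    funext n
    exact e1 n
  · have l1 : Tendsto (fun n => Real.exp (ω * T) * ((∫ s in Ioo 0 T, ‖Φ s‖) + a n)) atTop
        (𝓝 (Real.exp (ω * T) * ((∫ s in Ioo 0 T, ‖Φ s‖) + 0))) :=
      (ha0.const_add _).const_mul _
    rw [add_zero] at l1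
    exact le_of_tendsto_of_tendsto' (hy t ht).norm l1 fun n => hzb' n t ht

end SkewInverse

/-! ### The abstract wave equation -/

section AbstractWave

open Filter Topology
open scoped RealInnerProductSpace

lemma withLp_prod_ext {V H : Type*} {x y : WithLp 2 (V × H)} (h1 : x.fst = y.fst)
    (h2 : x.snd = y.snd) : x = y := by
  apply WithLp.ofLp_injective
  exact Prod.ext h1 h2

variable {V H : Type*} [NormedAddCommGroup V] [InnerProductSpace ℝ V]
  [NormedAddCommGroup H] [InnerProductSpace ℝ H]

/-- The map `(a, b) ↦ (0, -M b)`; composed with `waveInverse j` it is the perturbation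
`(u, p) ↦ (0, -M j u)` of the wave equation by the operator `M`. -/
def wavePerturbation (V : Type*) [NormedAddCommGroup V] [InnerProductSpace ℝ V] (M : H →L[ℝ] H) :
    WithLp 2 (V × H) →L[ℝ] WithLp 2 (V × H) :=
  (WithLp.prodContinuousLinearEquiv 2 ℝ V H).symm.toContinuousLinearMap.comp
    ((0 : WithLp 2 (V × H) →L[ℝ] V).prod (-(M.comp (WithLp.sndL 2 ℝ V H))))

lemma wavePerturbation_fst (M : H →L[ℝ] H) (z : WithLp 2 (V × H)) :
    (wavePerturbation V M z).fst = 0 := rfl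

lemma wavePerturbation_snd (M : H →L[ℝ] H) (z : WithLp 2 (V × H)) :
    (wavePerturbation V M z).snd = -M z.snd := rfl

variable [CompleteSpace V] [CompleteSpace H]

/-- For an embedding `j : V → H` with associated operator `A` (`⟪A u, j φ⟫_H = ⟪u, φ⟫_V`), the
inverse `(u, p) ↦ (-j† p, j u)` of the generator `(u, p) ↦ (p, -A u)` of the wave equation. -/
def waveInverse (j : V →L[ℝ] H) : WithLp 2 (V × H) →L[ℝ] WithLp 2 (V × H) :=
  (WithLp.prodContinuousLinearEquiv 2 ℝ V H).symm.toContinuousLinearMap.comp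
    ((-(j.adjoint.comp (WithLp.sndL 2 ℝ V H))).prod (j.comp (WithLp.fstL 2 ℝ V H)))

lemma waveInverse_fst (j : V →L[ℝ] H) (z : WithLp 2 (V × H)) :
    (waveInverse j z).fst = -j.adjoint z.snd := rfl

lemma waveInverse_snd (j : V →L[ℝ] H) (z : WithLp 2 (V × H)) :
    (waveInverse j z).snd = j z.fst := rfl

lemma waveInverse_skew (j : V →L[ℝ] H) (z : WithLp 2 (V × H)) : ⟪waveInverse j z, z⟫ = 0 := by
  rw [WithLp.prod_inner_apply]
  change ⟪(waveInverse j z).fst, z.fst⟫ + ⟪(waveInverse j z).snd, z.snd⟫ = 0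
  rw [waveInverse_fst, waveInverse_snd, inner_neg_left, ContinuousLinearMap.adjoint_inner_left,
    real_inner_comm, neg_add_cancel]

lemma waveInverse_injective {j : V →L[ℝ] H} (hj : ∀ x, j x = 0 → x = 0)
    (hd : ∀ y : H, (∀ φ, ⟪y, j φ⟫ = 0) → y = 0) (z : WithLp 2 (V × H))
    (hz : waveInverse j z = 0) : z = 0 := by
  have h1 := waveInverse_fst j z
  have h2 := waveInverse_snd j z
  rw [hz] at h1 h2
  refine withLp_prod_ext (hj _ h2.symm) (hd _ fun φ => ?_)
  rw [← ContinuousLinearMap.adjoint_inner_left, ← neg_eq_zero, ← inner_neg_left, ← h1]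
  exact inner_zero_left _

lemma waveInverse_perturbation_fst (j : V →L[ℝ] H) (M : H →L[ℝ] H) (z : WithLp 2 (V × H)) :
    (waveInverse j (wavePerturbation V M (waveInverse j z))).fst = j.adjoint (M (j z.fst)) := by
  rw [waveInverse_fst, wavePerturbation_snd, waveInverse_snd, map_neg, neg_neg]

lemma waveInverse_perturbation_snd (j : V →L[ℝ] H) (M : H →L[ℝ] H) (z : WithLp 2 (V × H)) :
    (waveInverse j (wavePerturbation V M (waveInverse j z))).snd = 0 := by
  rw [waveInverse_snd, wavePerturbation_fst, map_zero]

/-- Weak solutions of the abstract wave equation `u'' + (A + M) u = F` with zero initial data,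
where `⟪A u, φ⟫ = ⟪u, φ⟫_V`; here `p = u'`, and the equation is integrated once in time. -/
theorem exists_abstract_wave (j : V →L[ℝ] H) (hj : ∀ x, j x = 0 → x = 0)
    (hd : ∀ y : H, (∀ φ, ⟪y, j φ⟫ = 0) → y = 0) (M : H →L[ℝ] H) {T : ℝ} (hT : 0 ≤ T) :
    ∃ C : ℝ, 0 ≤ C ∧ ∀ F : ℝ → H, Integrable F (volume.restrict (Ioo 0 T)) →
      ∃ (u : ℝ → V) (p : ℝ → H), Continuous u ∧ Continuous p ∧
        (∀ t ∈ Icc 0 T, j (u t) = ∫ s in (0 : ℝ)..t, p s) ∧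
        (∀ t ∈ Icc 0 T, ∀ φ, ⟪p t, j φ⟫ + ∫ s in (0 : ℝ)..t, (⟪u s, φ⟫ + ⟪M (j (u s)), j φ⟫) =
          ∫ s in (0 : ℝ)..t, ⟪F s, j φ⟫) ∧
        ∀ t ∈ Icc 0 T, ‖u t‖ ≤ C * (∫ s in Ioo 0 T, ‖F s‖) ∧
          ‖p t‖ ≤ C * (∫ s in Ioo 0 T, ‖F s‖) := by
  set K := waveInverse j with hKdef
  set Q := wavePerturbation V M with hQdef
  refine ⟨Real.exp (‖Q.comp K‖ * T), (Real.exp_pos _).le, fun F hF => ?_⟩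
  let ι : H →L[ℝ] WithLp 2 (V × H) :=
    (WithLp.prodContinuousLinearEquiv 2 ℝ V H).symm.toContinuousLinearMap.comp
      (ContinuousLinearMap.inr ℝ V H)
  have hι : ∀ h, ‖ι h‖ = ‖h‖ := fun h => WithLp.norm_toLp_snd 2 V H h
  obtain ⟨z, hzc, hz, hzb⟩ := exists_integral_solution (waveInverse_skew j)
    (waveInverse_injective hj hd) Q hT (ι.integrable_comp hF)
  -- the solution is extended by constants outside `[0,T]`
  set w : ℝ → WithLp 2 (V × H) := fun t => z (projIcc 0 T hT t) with hw
  have hwc : Continuous w :=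
    hzc.comp_continuous (continuous_subtype_val.comp continuous_projIcc) fun t =>
      (projIcc 0 T hT t).2
  have hwz : ∀ t ∈ Icc 0 T, w t = z t := fun t ht => by simp only [hw, projIcc_of_mem hT ht]
  have hfst : Continuous fun t => (w t).fst := (WithLp.fstL 2 ℝ V H).continuous.comp hwc
  have hsnd : Continuous fun t => (w t).snd := (WithLp.sndL 2 ℝ V H).continuous.comp hwc
  have heq : ∀ t ∈ Icc 0 T, K (w t) =
      (∫ s in (0 : ℝ)..t, (w s + K (Q (K (w s))))) + K (∫ s in (0 : ℝ)..t, ι (F s)) := by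
    intro t ht
    rw [hwz t ht, hz t ht]
    congr 1
    refine intervalIntegral.integral_congr fun s hs => ?_
    rw [uIcc_of_le ht.1] at hs
    simp only [hwz s ⟨hs.1, hs.2.trans ht.2⟩]
    rfl
  have hgc : Continuous fun s => w s + K (Q (K (w s))) :=
    hwc.add (K.continuous.comp (Q.continuous.comp (K.continuous.comp hwc)))
  have hFi : ∀ t ∈ Icc 0 T, IntervalIntegrable F volume 0 t := fun t ht => by
    rw [intervalIntegrable_iff_integrableOn_Ioo_of_le ht.1]
    exact IntegrableOn.mono_set hF (Ioo_subset_Ioo_right ht.2)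
  refine ⟨fun t => (w t).fst, fun t => (w t).snd, hfst, hsnd, fun t ht => ?_,
    fun t ht φ => ?_, fun t ht => ?_⟩
  · have h1 := congrArg (WithLp.sndL 2 ℝ V H) (heq t ht)
    rw [map_add, ← ContinuousLinearMap.intervalIntegral_comp_comm _ (hgc.intervalIntegrable _ _),
      ι.intervalIntegral_comp_comm (hFi t ht)] at h1
    have h2 : WithLp.sndL 2 ℝ V H (K (ι (∫ s in (0 : ℝ)..t, F s))) = 0 := by
      change j (0 : V) = 0
      exact map_zero j
    rw [h2, add_zero] at h1
    refine h1.trans (intervalIntegral.integral_congr fun s _ => ?_)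
    change (w s).snd + (K (Q (K (w s)))).snd = (w s).snd
    rw [waveInverse_perturbation_snd, add_zero]
  · let L : WithLp 2 (V × H) →L[ℝ] ℝ := (innerSL ℝ φ).comp (WithLp.fstL 2 ℝ V H)
    have h1 := congrArg L (heq t ht)
    rw [map_add, ← ContinuousLinearMap.intervalIntegral_comp_comm _ (hgc.intervalIntegrable _ _),
      ι.intervalIntegral_comp_comm (hFi t ht)] at h1
    have h2 : L (K (ι (∫ s in (0 : ℝ)..t, F s))) = -∫ s in (0 : ℝ)..t, ⟪F s, j φ⟫ := by
      change ⟪φ, -j.adjoint (∫ s in (0 : ℝ)..t, F s)⟫ = _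
      rw [inner_neg_right, ContinuousLinearMap.adjoint_inner_right]
      have := (innerSL ℝ (j φ)).intervalIntegral_comp_comm (hFi t ht)
      simp only [innerSL_apply_apply] at this
      rw [← this]
      simp only [real_inner_comm]
    have h3 : L (K (w t)) = -⟪(w t).snd, j φ⟫ := by
      change ⟪φ, -j.adjoint (w t).snd⟫ = _
      rw [inner_neg_right, ContinuousLinearMap.adjoint_inner_right, real_inner_comm]
    have h4 : ∀ s, L (w s + K (Q (K (w s)))) =
        ⟪(w s).fst, φ⟫ + ⟪M (j (w s).fst), j φ⟫ := by
      intro s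
      change ⟪φ, (w s).fst + (K (Q (K (w s)))).fst⟫ = _
      rw [waveInverse_perturbation_fst, inner_add_right, ContinuousLinearMap.adjoint_inner_right,
        real_inner_comm, real_inner_comm (j φ)]
    rw [h2, h3] at h1
    simp only [h4] at h1
    linarith
  · have h1 : ‖w t‖ ≤ Real.exp (‖Q.comp K‖ * T) * ∫ s in Ioo 0 T, ‖F s‖ := by
      have h2 := hzb t ht
      simp only [hι] at h2
      rw [hwz t ht]
      exact h2
    exact ⟨(WithLp.norm_fst_le _ _).trans h1, (WithLp.norm_snd_le _ _).trans h1⟩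

/-- Uniqueness of the weak solution of the abstract wave equation with zero initial data. -/
theorem abstract_wave_unique (j : V →L[ℝ] H) (hj : ∀ x, j x = 0 → x = 0)
    (hd : ∀ y : H, (∀ φ, ⟪y, j φ⟫ = 0) → y = 0) (M : H →L[ℝ] H) {T : ℝ}
    {u : ℝ → V} {p : ℝ → H} (hu : ContinuousOn u (Icc 0 T)) (hp : ContinuousOn p (Icc 0 T))
    (h1 : ∀ t ∈ Icc 0 T, j (u t) = ∫ s in (0 : ℝ)..t, p s)
    (h2 : ∀ t ∈ Icc 0 T, ∀ φ,
      ⟪p t, j φ⟫ + ∫ s in (0 : ℝ)..t, (⟪u s, φ⟫ + ⟪M (j (u s)), j φ⟫) = 0) :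
    ∀ t ∈ Icc 0 T, u t = 0 := by
  set K := waveInverse j with hKdef
  set Q := wavePerturbation V M with hQdef
  set z : ℝ → WithLp 2 (V × H) := fun t => WithLp.toLp 2 (u t, p t) with hz
  have hzc : ContinuousOn z (Icc 0 T) :=
    (WithLp.prodContinuousLinearEquiv 2 ℝ V H).symm.continuous.comp_continuousOn (hu.prodMk hp)
  have h3 := eq_zero_of_integral_equation (waveInverse_skew j) (waveInverse_injective hj hd) Q hzc
    (fun t ht => ?_)
  · intro t ht
    exact congrArg WithLp.fst (h3 t ht)
  · have hgc : ContinuousOn (fun s => z s + K (Q (K (z s)))) (Icc 0 T) :=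
      hzc.add ((K.continuous.comp (Q.continuous.comp K.continuous)).comp_continuousOn hzc)
    have hgi : IntervalIntegrable (fun s => z s + K (Q (K (z s)))) volume 0 t :=
      (hgc.mono (Icc_subset_Icc_right ht.2)).intervalIntegrable_of_Icc ht.1
    refine withLp_prod_ext (ext_inner_left ℝ fun φ => ?_) ?_
    · let L : WithLp 2 (V × H) →L[ℝ] ℝ := (innerSL ℝ φ).comp (WithLp.fstL 2 ℝ V H)
      change ⟪φ, -j.adjoint (p t)⟫ = L (∫ s in (0 : ℝ)..t, (z s + K (Q (K (z s)))))
      rw [← ContinuousLinearMap.intervalIntegral_comp_comm _ hgi, inner_neg_right,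
        ContinuousLinearMap.adjoint_inner_right, real_inner_comm]
      have h4 : ∀ s, L (z s + K (Q (K (z s)))) = ⟪u s, φ⟫ + ⟪M (j (u s)), j φ⟫ := by
        intro s
        change ⟪φ, u s + (K (Q (K (z s)))).fst⟫ = _
        rw [waveInverse_perturbation_fst, inner_add_right,
          ContinuousLinearMap.adjoint_inner_right, real_inner_comm, real_inner_comm (j φ)]
        rfl
      simp only [h4]
      linarith [h2 t ht φ]
    · change j (u t) = WithLp.sndL 2 ℝ V H (∫ s in (0 : ℝ)..t, (z s + K (Q (K (z s)))))
      rw [← ContinuousLinearMap.intervalIntegral_comp_comm _ hgi, h1 t ht]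
      refine intervalIntegral.integral_congr fun s _ => ?_
      change p s = p s + (K (Q (K (z s)))).snd
      rw [waveInverse_perturbation_snd, add_zero]

end AbstractWave

/-! ### Absolutely continuous functions and weak derivatives -/

section Primitive

open Filter Topology

/-- `Y` is absolutely continuous on `[0,l]` with (integrable) derivative `g`. -/
def IsPrimitiveOn (l : ℝ) (Y g : ℝ → ℝ) : Prop :=
  IntegrableOn g (Ioo 0 l) ∧ ∀ x ∈ Icc 0 l, Y x = Y 0 + ∫ s in (0 : ℝ)..x, g s

lemma intervalIntegrable_of_integrableOn_Ioo {E : Type*} [NormedAddCommGroup E] {l : ℝ}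
    {g : ℝ → E} (hg : IntegrableOn g (Ioo 0 l)) {x : ℝ} (hx : x ∈ Icc 0 l) :
    IntervalIntegrable g volume 0 x := by
  rw [intervalIntegrable_iff_integrableOn_Ioo_of_le hx.1]
  exact hg.mono_set (Ioo_subset_Ioo_right hx.2)

lemma setIntegral_Ioo_eq_intervalIntegral {E : Type*} [NormedAddCommGroup E] [NormedSpace ℝ E]
    {l : ℝ} (hl : 0 ≤ l) (g : ℝ → E) : ∫ x in Ioo 0 l, g x = ∫ x in (0 : ℝ)..l, g x := by
  rw [intervalIntegral.integral_of_le hl, integral_Ioc_eq_integral_Ioo]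

namespace IsPrimitiveOn

variable {l : ℝ} {Y g Z h : ℝ → ℝ}

lemma integral_eq (hY : IsPrimitiveOn l Y g) (hl : 0 ≤ l) :
    ∫ x in Ioo 0 l, g x = Y l - Y 0 := by
  rw [setIntegral_Ioo_eq_intervalIntegral hl, hY.2 l ⟨hl, le_rfl⟩]
  ring

lemma mono (hY : IsPrimitiveOn l Y g) {x : ℝ} (hx : x ≤ l) : IsPrimitiveOn x Y g :=
  ⟨hY.1.mono_set (Ioo_subset_Ioo_right hx), fun y hy => hY.2 y ⟨hy.1, hy.2.trans hx⟩⟩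

lemma congr (hY : IsPrimitiveOn l Y g) (hg : ∀ᵐ x ∂volume.restrict (Ioo 0 l), g x = h x) :
    IsPrimitiveOn l Y h := by
  refine ⟨hY.1.congr_fun_ae hg, fun x hx => ?_⟩
  rw [hY.2 x hx, ← setIntegral_Ioo_eq_intervalIntegral hx.1,
    ← setIntegral_Ioo_eq_intervalIntegral hx.1]
  congr 1
  exact integral_congr_ae (ae_restrict_of_ae_restrict_of_subset (Ioo_subset_Ioo_right hx.2) hg)

lemma of_hasDerivAt (hY : ∀ x, HasDerivAt Y (g x) x) (hg : Continuous g) :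
    IsPrimitiveOn l Y g := by
  refine ⟨(hg.integrableOn_Icc (a := 0) (b := l)).mono_set Ioo_subset_Icc_self, fun x _ => ?_⟩
  rw [intervalIntegral.integral_eq_sub_of_hasDerivAt (fun y _ => hY y)
    (hg.intervalIntegrable _ _)]
  ring

lemma const (c : ℝ) : IsPrimitiveOn l (fun _ => c) fun _ => 0 :=
  of_hasDerivAt (fun x => hasDerivAt_const x c) continuous_const

lemma add (hY : IsPrimitiveOn l Y g) (hZ : IsPrimitiveOn l Z h) :
    IsPrimitiveOn l (fun x => Y x + Z x) fun x => g x + h x := by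
  refine ⟨hY.1.add hZ.1, fun x hx => ?_⟩
  rw [intervalIntegral.integral_add (intervalIntegrable_of_integrableOn_Ioo hY.1 hx)
    (intervalIntegrable_of_integrableOn_Ioo hZ.1 hx)]
  have h1 := hY.2 x hx
  have h2 := hZ.2 x hx
  linarith

lemma const_mul (c : ℝ) (hY : IsPrimitiveOn l Y g) :
    IsPrimitiveOn l (fun x => c * Y x) fun x => c * g x := by
  refine ⟨hY.1.const_mul c, fun x hx => ?_⟩
  rw [intervalIntegral.integral_const_mul]
  change c * Y x = c * Y 0 + _
  rw [hY.2 x hx]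
  ring

lemma continuousOn (hY : IsPrimitiveOn l Y g) : ContinuousOn Y (Icc 0 l) := by
  rcases lt_or_ge l 0 with hl | hl
  · rw [Icc_eq_empty (not_le.2 hl)]; exact continuousOn_empty _
  refine ContinuousOn.congr (f := fun x => Y 0 + ∫ s in (0 : ℝ)..x, g s) ?_ hY.2
  refine continuousOn_const.add ?_
  have h1 : IntegrableOn g (uIcc 0 l) := by
    rw [uIcc_of_le hl, integrableOn_Icc_iff_integrableOn_Ioo]; exact hY.1
  have h2 := intervalIntegral.continuousOn_primitive_interval h1
  rwa [uIcc_of_le hl] at h2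

/-- The fundamental theorem of calculus for the product of two absolutely continuous functions. -/
lemma integral_mul_add_mul (hl : 0 ≤ l) (hY : IsPrimitiveOn l Y g) (hZ : IsPrimitiveOn l Z h) :
    ∫ x in (0 : ℝ)..l, (g x * Z x + Y x * h x) = Y l * Z l - Y 0 * Z 0 := by
  have hgi := intervalIntegrable_of_integrableOn_Ioo hY.1 ⟨hl, le_rfl⟩
  have hhi := intervalIntegrable_of_integrableOn_Ioo hZ.1 ⟨hl, le_rfl⟩
  have hac : ∀ {g : ℝ → ℝ}, IntervalIntegrable g volume 0 l → ∀ c : ℝ,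
      AbsolutelyContinuousOnInterval (fun x => c + ∫ s in (0 : ℝ)..x, g s) 0 l := fun hg c =>
    ((LipschitzWith.const' (K := 0) c).lipschitzOnWith).absolutelyContinuousOnInterval.fun_add
      (hg.absolutelyContinuousOnInterval_intervalIntegral (c := 0) (by simp))
  have h1 := (hac hgi (Y 0)).integral_deriv_mul_eq_sub (hac hhi (Z 0))
  rw [← hY.2 l ⟨hl, le_rfl⟩, ← hZ.2 l ⟨hl, le_rfl⟩] at h1
  simp only [intervalIntegral.integral_same, add_zero] at h1
  rw [← h1]
  refine intervalIntegral.integral_congr_ae ?_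
  filter_upwards [hgi.ae_hasDerivAt_integral, hhi.ae_hasDerivAt_integral] with x hx1 hx2 hx
  have hx' : x ∈ uIcc 0 l := uIoc_subset_uIcc hx
  have hxI : x ∈ Icc 0 l := by rwa [uIcc_of_le hl] at hx'
  have d1 := ((hx1 hx' 0 (by simp)).const_add (Y 0)).deriv
  have d2 := ((hx2 hx' 0 (by simp)).const_add (Z 0)).deriv
  rw [d1, d2, ← hY.2 x hxI, ← hZ.2 x hxI]

lemma integrableOn_mul (hY : IsPrimitiveOn l Y g) {k : ℝ → ℝ} (hk : IntegrableOn k (Ioo 0 l)) :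
    IntegrableOn (fun x => k x * Y x) (Ioo 0 l) := by
  obtain ⟨C, hC⟩ := isCompact_Icc.exists_bound_of_continuousOn hY.continuousOn
  refine Integrable.mul_bdd (c := C) hk
    ((hY.continuousOn.mono Ioo_subset_Icc_self).aestronglyMeasurable measurableSet_Ioo) ?_
  filter_upwards [ae_restrict_mem measurableSet_Ioo] with x hx
  exact hC x (Ioo_subset_Icc_self hx)

lemma mul (hY : IsPrimitiveOn l Y g) (hZ : IsPrimitiveOn l Z h) :
    IsPrimitiveOn l (fun x => Y x * Z x) fun x => g x * Z x + Y x * h x := by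
  refine ⟨(hZ.integrableOn_mul hY.1).add ?_, fun x hx => ?_⟩
  · simpa only [mul_comm] using hY.integrableOn_mul hZ.1
  · rw [integral_mul_add_mul hx.1 (hY.mono hx.2) (hZ.mono hx.2)]
    ring

end IsPrimitiveOn

lemma IsTestFunction.isPrimitiveOn {l : ℝ} {φ : ℝ → ℝ} (hφ : IsTestFunction l φ) (k : ℝ) :
    IsPrimitiveOn k φ (_root_.deriv φ) := by
  have h1 : ContDiff ℝ 1 φ := hφ.1.of_le (by exact_mod_cast le_top)
  exact .of_hasDerivAt (fun x => (h1.differentiable one_ne_zero x).hasDerivAt)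
    (h1.continuous_deriv le_rfl)

lemma IsTestFunction.eq_zero {l : ℝ} {φ : ℝ → ℝ} (hφ : IsTestFunction l φ) {x : ℝ}
    (hx : x ∉ Ioo 0 l) : φ x = 0 :=
  image_eq_zero_of_notMem_tsupport fun h => hx (hφ.2.2 h)

lemma IsTestFunction.integrableOn_mul {l : ℝ} {φ : ℝ → ℝ} (hφ : IsTestFunction l φ) {k : ℝ → ℝ}
    (hk : IntegrableOn k (Ioo 0 l)) : IntegrableOn (fun x => k x * φ x) (Ioo 0 l) :=
  (hφ.isPrimitiveOn l).integrableOn_mul hk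

/-- An absolutely continuous function has its derivative as weak derivative. -/
lemma IsPrimitiveOn.integral_mul_deriv {l : ℝ} {Y g : ℝ → ℝ} (hY : IsPrimitiveOn l Y g)
    {φ : ℝ → ℝ} (hφ : IsTestFunction l φ) :
    ∫ x in Ioo 0 l, Y x * deriv φ x = -∫ x in Ioo 0 l, g x * φ x := by
  rcases lt_or_ge l 0 with hl | hl
  · simp [Ioo_eq_empty (not_lt.2 hl.le)]
  have h1 := (hY.mul (hφ.isPrimitiveOn l)).integral_eq hl
  rw [hφ.eq_zero (x := l) (by simp), hφ.eq_zero (x := 0) (by simp)] at h1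
  have h2 : IntegrableOn (fun x => Y x * deriv φ x) (Ioo 0 l) := by
    simpa only [mul_comm] using hY.integrableOn_mul (hφ.isPrimitiveOn l).1
  rw [integral_add (hφ.integrableOn_mul hY.1) h2] at h1
  linarith

lemma exists_testFunction_integral_one {l : ℝ} (hl : 0 < l) :
    ∃ η : ℝ → ℝ, IsTestFunction l η ∧ ∫ x in Ioo 0 l, η x = 1 := by
  let b : ContDiffBump (l / 2) := ⟨l / 8, l / 4, by positivity, by linarith⟩
  have hs : tsupport (b.normed volume) ⊆ Ioo 0 l := by
    rw [b.tsupport_normed_eq, Real.closedBall_eq_Icc]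
    intro x hx
    change x ∈ Icc (l / 2 - l / 4) (l / 2 + l / 4) at hx
    exact ⟨by linarith [hx.1], by linarith [hx.2]⟩
  refine ⟨b.normed volume, ⟨b.contDiff_normed, b.hasCompactSupport_normed, hs⟩, ?_⟩
  rw [setIntegral_eq_integral_of_forall_compl_eq_zero fun x hx =>
    image_eq_zero_of_notMem_tsupport fun h => hx (hs h)]
  exact b.integral_normed

/-- A test function with vanishing integral is the derivative of a test function. -/
lemma IsTestFunction.exists_primitive {l : ℝ} {ψ : ℝ → ℝ} (hψ : IsTestFunction l ψ)
    (h0 : ∫ x in Ioo 0 l, ψ x = 0) : ∃ θ, IsTestFunction l θ ∧ _root_.deriv θ = ψ := by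
  rcases le_or_gt l 0 with hl | hl
  · have hψ0 : ψ = 0 := funext fun x => hψ.eq_zero (by simp [Ioo_eq_empty (not_lt.2 hl)])
    refine ⟨0, ⟨contDiff_const, HasCompactSupport.zero, by simp [tsupport]⟩, ?_⟩
    rw [hψ0]; exact deriv_zero
  have hc := hψ.1.continuous
  set θ : ℝ → ℝ := fun x => ∫ s in (0 : ℝ)..x, ψ s with hθ
  have hd : ∀ x, HasDerivAt θ (ψ x) x := hasDerivAt_integral_of_continuous hc
  have hdθ : _root_.deriv θ = ψ := funext fun x => (hd x).deriv
  -- the support of `ψ` lies in a compact subinterval `[a,b]`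
  obtain ⟨a, b, ha, hab, hbl, hsupp⟩ : ∃ a b, 0 < a ∧ a < b ∧ b < l ∧ tsupport ψ ⊆ Icc a b := by
    have hK : IsCompact (tsupport ψ ∪ {l / 2}) := hψ.2.1.union isCompact_singleton
    have hne : (tsupport ψ ∪ {l / 2}).Nonempty := ⟨l / 2, Or.inr rfl⟩
    have hsub : tsupport ψ ∪ {l / 2} ⊆ Ioo 0 l :=
      union_subset hψ.2.2 (by rintro x rfl; exact ⟨by linarith, by linarith⟩)
    obtain ⟨m, hm, hmin⟩ := hK.exists_isLeast hne
    obtain ⟨M, hM, hmax⟩ := hK.exists_isGreatest hne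
    refine ⟨m / 2, (M + l) / 2, by linarith [(hsub hm).1], ?_, by linarith [(hsub hM).2],
      fun x hx => ⟨?_, ?_⟩⟩
    · linarith [hmin hM, (hsub hm).1, (hsub hM).2]
    · linarith [hmin (Or.inl hx), (hsub hm).1]
    · linarith [hmax (Or.inl hx), (hsub hM).2]
  have hψ0 : ∀ x, x ∉ Icc a b → ψ x = 0 := fun x hx =>
    image_eq_zero_of_notMem_tsupport fun h => hx (hsupp h)
  have hleft : ∀ x ≤ a, θ x = 0 := by
    intro x hx
    refine intervalIntegral.integral_zero_ae ?_
    have : ∀ᵐ s : ℝ, s ≠ a := Measure.ae_ne volume a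
    filter_upwards [this] with s hs hsx
    refine hψ0 s fun h => ?_
    rcases le_total 0 x with h' | h'
    · rw [uIoc_of_le h'] at hsx
      exact hs (le_antisymm (hsx.2.trans hx) h.1)
    · rw [uIoc_of_ge h'] at hsx
      linarith [hsx.2, h.1]
  have hright : ∀ x, b ≤ x → θ x = 0 := by
    intro x hx
    have h1 : θ l = 0 := by
      rw [← h0, setIntegral_Ioo_eq_intervalIntegral hl.le]
    have h2 : θ x = θ l + ∫ s in l..x, ψ s := by
      simp only [hθ]
      rw [intervalIntegral.integral_add_adjacent_intervals (hc.intervalIntegrable _ _)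
        (hc.intervalIntegrable _ _)]
    rw [h2, h1, zero_add]
    refine intervalIntegral.integral_zero_ae ?_
    have : ∀ᵐ s : ℝ, s ≠ b := Measure.ae_ne volume b
    filter_upwards [this] with s hs hsx
    refine hψ0 s fun h => hs (le_antisymm h.2 ?_)
    rcases le_total l x with h' | h'
    · rw [uIoc_of_le h'] at hsx
      linarith [hsx.1]
    · rw [uIoc_of_ge h'] at hsx
      linarith [hsx.1]
  have hts : tsupport θ ⊆ Icc a b := by
    refine closure_minimal (fun x hx => ?_) isClosed_Icc
    by_contra h
    rw [mem_Icc, not_and_or, not_le, not_le] at h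
    rcases h with h | h
    · exact hx (hleft x h.le)
    · exact hx (hright x h.le)
  refine ⟨θ, ⟨?_, HasCompactSupport.of_support_subset_isCompact isCompact_Icc
    ((subset_tsupport θ).trans hts), fun x hx => ⟨ha.trans_le (hts hx).1, (hts hx).2.trans_lt hbl⟩⟩,
    hdθ⟩
  rw [show ((⊤ : ℕ∞) : WithTop ℕ∞) = (⊤ : ℕ∞) + 1 from rfl, contDiff_succ_iff_deriv]
  refine ⟨fun x => (hd x).differentiableAt, by simp, ?_⟩
  rw [hdθ]
  exact hψ.1

/-- The du Bois-Reymond lemma: a function with an integrable weak derivative is absolutely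
continuous. -/
lemma exists_isPrimitiveOn_of_weak {l : ℝ} (hl : 0 < l) {a b : ℝ → ℝ}
    (ha : IntegrableOn a (Ioo 0 l)) (hb : IntegrableOn b (Ioo 0 l))
    (h : ∀ φ, IsTestFunction l φ →
      ∫ x in Ioo 0 l, a x * deriv φ x = -∫ x in Ioo 0 l, b x * φ x) :
    ∃ Y, IsPrimitiveOn l Y b ∧ a =ᵐ[volume.restrict (Ioo 0 l)] Y := by
  set B : ℝ → ℝ := fun x => ∫ s in (0 : ℝ)..x, b s with hB
  have hBp : IsPrimitiveOn l B b := ⟨hb, fun x _ => by simp [hB]⟩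
  have hBi : IntegrableOn B (Ioo 0 l) :=
    (hBp.continuousOn.integrableOn_Icc).mono_set Ioo_subset_Icc_self
  -- `a - B` is orthogonal to the derivatives of test functions, so it is almost everywhere constant
  set r : ℝ → ℝ := fun x => a x - B x with hr
  have hri : IntegrableOn r (Ioo 0 l) := ha.sub hBi
  have hr0 : ∀ φ, IsTestFunction l φ → ∫ x in Ioo 0 l, r x * deriv φ x = 0 := by
    intro φ hφ
    simp only [hr, sub_mul]
    rw [integral_sub (hφ.deriv.integrableOn_mul ha) (hφ.deriv.integrableOn_mul hBi), h φ hφ,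
      hBp.integral_mul_deriv hφ, sub_self]
  obtain ⟨η, hη, hη1⟩ := exists_testFunction_integral_one hl
  set c := ∫ x in Ioo 0 l, r x * η x with hc
  have hφi : ∀ φ, IsTestFunction l φ → IntegrableOn φ (Ioo 0 l) := fun φ hφ =>
    (hφ.1.continuous.integrableOn_Icc).mono_set Ioo_subset_Icc_self
  have hconst : ∀ φ, IsTestFunction l φ → ∫ x in Ioo 0 l, φ x * (r x - c) = 0 := by
    intro φ hφ
    set m := ∫ x in Ioo 0 l, φ x with hm
    have hψ : IsTestFunction l (fun x => φ x - m * η x) := by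
      refine ⟨hφ.1.sub (contDiff_const.mul hη.1), hφ.2.1.sub hη.2.1.mul_left, ?_⟩
      refine (tsupport_sub φ fun x => m * η x).trans (union_subset hφ.2.2 ?_)
      exact (tsupport_mul_subset_right (f := fun _ => m) (g := η)).trans hη.2.2
    obtain ⟨θ, hθ, hθd⟩ := hψ.exists_primitive (by
      rw [integral_sub (hφi φ hφ) ((hφi η hη).const_mul m), integral_const_mul, hη1]
      ring)
    have h1 := hr0 θ hθ
    rw [hθd] at h1
    have h2 : ∀ x, r x * (φ x - m * η x) = r x * φ x - m * (r x * η x) := fun x => by ring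
    simp only [h2] at h1
    rw [integral_sub (hφ.integrableOn_mul hri) ((hη.integrableOn_mul hri).const_mul m),
      integral_const_mul] at h1
    have h3 : ∀ x, φ x * (r x - c) = r x * φ x - c * φ x := fun x => by ring
    simp only [h3]
    rw [integral_sub (hφ.integrableOn_mul hri) ((hφi φ hφ).const_mul c), integral_const_mul]
    linarith
  have hae : ∀ᵐ x, x ∈ Ioo 0 l → r x - c = 0 := by
    refine isOpen_Ioo.ae_eq_zero_of_integral_contDiff_smul_eq_zero (μ := volume) ?_ ?_
    · exact (hri.sub (integrableOn_const (by simp))).locallyIntegrableOn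
    · intro φ h1 h2 h3
      rw [← hconst φ ⟨h1, h2, h3⟩, setIntegral_eq_integral_of_forall_compl_eq_zero]
      · rfl
      · intro x hx
        rw [image_eq_zero_of_notMem_tsupport fun h => hx (h3 h), zero_mul]
  refine ⟨fun x => c + B x, ?_, ?_⟩
  · simpa using (IsPrimitiveOn.const c).add hBp
  · rw [EventuallyEq, ae_restrict_iff' measurableSet_Ioo]
    filter_upwards [hae] with x hx hxI
    have := hx hxI
    simp only [hr] at this
    linarith

/-- Continuous functions on `[0,l]` that agree almost everywhere on `(0,l)` agree on `[0,l]`. -/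
lemma eqOn_Icc_of_ae_eq {l : ℝ} (hl : 0 < l) {Y Z : ℝ → ℝ} (hY : ContinuousOn Y (Icc 0 l))
    (hZ : ContinuousOn Z (Icc 0 l)) (h : Y =ᵐ[volume.restrict (Ioo 0 l)] Z) :
    EqOn Y Z (Icc 0 l) := by
  have h1 : Y =ᵐ[volume.restrict (Icc 0 l)] Z := by
    rwa [restrict_Ioo_eq_restrict_Icc] at h
  exact Measure.eqOn_Icc_of_ae_eq volume hl.ne h1 hY hZ

end Primitive

/-! ### Sobolev functions on an interval -/

section IntervalSobolev

open Filter Topology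
open scoped RealInnerProductSpace

variable {l : ℝ}

lemma IntervalL2.integrableOn (y : IntervalL2 l) : IntegrableOn y (Ioo 0 l) :=
  (Lp.memLp y).integrable one_le_two

lemma IntervalL2.inner_eq (y z : IntervalL2 l) : ⟪y, z⟫ = ∫ x in Ioo 0 l, y x * z x := by
  rw [L2.inner_def]
  refine integral_congr_ae (Eventually.of_forall fun x => ?_)
  simp [mul_comm]

lemma IsTestFunction.memLp {φ : ℝ → ℝ} (hφ : IsTestFunction l φ) :
    MemLp φ 2 (volume.restrict (Ioo (0 : ℝ) l)) :=
  (hφ.1.continuous.memLp_of_hasCompactSupport hφ.2.1).restrict _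

lemma IntervalL2.inner_toLp (y : IntervalL2 l) {w : ℝ → ℝ}
    (hw : MemLp w 2 (volume.restrict (Ioo (0 : ℝ) l))) :
    ⟪y, hw.toLp w⟫ = ∫ x in Ioo 0 l, y x * w x := by
  rw [IntervalL2.inner_eq]
  refine integral_congr_ae ?_
  filter_upwards [hw.coeFn_toLp] with x hx
  rw [hx]

/-- An `L²` function orthogonal to all test functions vanishes. -/
lemma IntervalL2.eq_zero_of_forall_testFunction {y : IntervalL2 l}
    (h : ∀ φ, IsTestFunction l φ → ∫ x in Ioo 0 l, y x * φ x = 0) : y = 0 := by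
  have h1 : ∀ᵐ x, x ∈ Ioo 0 l → y x = 0 := by
    refine isOpen_Ioo.ae_eq_zero_of_integral_contDiff_smul_eq_zero (μ := volume)
      y.integrableOn.locallyIntegrableOn fun φ h1 h2 h3 => ?_
    refine Eq.trans ?_ (h φ ⟨h1, h2, h3⟩)
    rw [← setIntegral_eq_integral_of_forall_compl_eq_zero (s := Ioo 0 l)]
    · exact integral_congr_ae (Eventually.of_forall fun x => mul_comm _ _)
    · intro x hx
      rw [image_eq_zero_of_notMem_tsupport fun h => hx (h3 h), zero_smul]
  refine Lp.ext ?_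
  refine EventuallyEq.trans ?_ (Lp.coeFn_zero ℝ 2 _).symm
  rw [EventuallyEq, ae_restrict_iff' measurableSet_Ioo]
  exact h1

lemma isWeakDeriv_iff_inner {y g : IntervalL2 l} : IsWeakDeriv y g ↔
    ∀ (φ : ℝ → ℝ) (hφ : IsTestFunction l φ),
      ⟪y, hφ.deriv.memLp.toLp _⟫ + ⟪g, hφ.memLp.toLp _⟫ = 0 := by
  simp only [IsWeakDeriv, IntervalL2.inner_toLp, eq_neg_iff_add_eq_zero]

lemma IsWeakDeriv.unique {y g g' : IntervalL2 l} (h : IsWeakDeriv y g) (h' : IsWeakDeriv y g') :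
    g = g' := by
  rw [← sub_eq_zero]
  refine IntervalL2.eq_zero_of_forall_testFunction fun φ hφ => ?_
  rw [← IntervalL2.inner_toLp _ hφ.memLp, inner_sub_left]
  linarith [isWeakDeriv_iff_inner.1 h φ hφ, isWeakDeriv_iff_inner.1 h' φ hφ]

lemma isWeakDeriv_weakDeriv {y : IntervalL2 l} (h : ∃ g, IsWeakDeriv y g) :
    IsWeakDeriv y (weakDeriv y) := by
  rw [weakDeriv, dif_pos h]
  exact h.choose_spec

/-- On a bounded interval, the weakly differentiable functions are those with an absolutely
continuous representative. -/
lemma isWeakDeriv_iff_exists_isPrimitiveOn (hl : 0 < l) {y g : IntervalL2 l} :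
    IsWeakDeriv y g ↔ ∃ Y, IsPrimitiveOn l Y g ∧ y =ᵐ[volume.restrict (Ioo 0 l)] Y := by
  constructor
  · exact fun h => exists_isPrimitiveOn_of_weak hl y.integrableOn g.integrableOn h
  · rintro ⟨Y, hY, hyY⟩ φ hφ
    rw [← hY.integral_mul_deriv hφ]
    refine integral_congr_ae ?_
    filter_upwards [hyY] with x hx
    rw [hx]

lemma isClosed_isWeakDeriv : IsClosed {p : IntervalL2 l × IntervalL2 l | IsWeakDeriv p.1 p.2} := by
  have h : {p : IntervalL2 l × IntervalL2 l | IsWeakDeriv p.1 p.2} =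
      ⋂ (φ : ℝ → ℝ) (hφ : IsTestFunction l φ),
        {p | ⟪p.1, hφ.deriv.memLp.toLp _⟫ + ⟪p.2, hφ.memLp.toLp _⟫ = 0} := by
    ext p
    simp only [mem_iInter]
    exact isWeakDeriv_iff_inner
  rw [h]
  refine isClosed_iInter fun φ => isClosed_iInter fun hφ => isClosed_eq ?_ continuous_const
  exact (continuous_fst.inner continuous_const).add (continuous_snd.inner continuous_const)

/-- The class in `L²(0,l)` of a continuous function. -/
def contL2 (l : ℝ) (w : C(ℝ, ℝ)) : IntervalL2 l :=
  MemLp.toLp (p := 2) (μ := volume.restrict (Ioo (0 : ℝ) l)) w <| by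
    obtain ⟨C, hC⟩ := isCompact_Icc.exists_bound_of_continuousOn
      (w.continuous.continuousOn (s := Icc 0 l))
    refine MemLp.of_bound w.continuous.aestronglyMeasurable C ?_
    filter_upwards [ae_restrict_mem measurableSet_Ioo] with x hx
    exact hC x (Ioo_subset_Icc_self hx)

lemma coeFn_contL2 (w : C(ℝ, ℝ)) : contL2 l w =ᵐ[volume.restrict (Ioo (0 : ℝ) l)] w :=
  MemLp.coeFn_toLp _

/-- The class in `L^∞(0,l)` of a continuous function. -/
def contLInfty (l : ℝ) (w : C(ℝ, ℝ)) : Lp ℝ ⊤ (volume.restrict (Ioo (0 : ℝ) l)) :=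
  MemLp.toLp (p := ⊤) (μ := volume.restrict (Ioo (0 : ℝ) l)) w <| by
    obtain ⟨C, hC⟩ := isCompact_Icc.exists_bound_of_continuousOn
      (w.continuous.continuousOn (s := Icc 0 l))
    refine memLp_top_of_bound w.continuous.aestronglyMeasurable C ?_
    filter_upwards [ae_restrict_mem measurableSet_Ioo] with x hx
    exact hC x (Ioo_subset_Icc_self hx)

/-- Multiplication by a bounded function, as an operator on `L²(0,l)`. -/
def mulL2 (q : Lp ℝ ⊤ (volume.restrict (Ioo (0 : ℝ) l))) : IntervalL2 l →L[ℝ] IntervalL2 l :=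
  (ContinuousLinearMap.mul ℝ ℝ).holderL (volume.restrict (Ioo (0 : ℝ) l)) ⊤ 2 2 q

lemma coeFn_mulL2 (q : Lp ℝ ⊤ (volume.restrict (Ioo (0 : ℝ) l))) (y : IntervalL2 l) :
    mulL2 q y =ᵐ[volume.restrict (Ioo 0 l)] fun x => q x * y x :=
  (ContinuousLinearMap.mul ℝ ℝ).coeFn_holder (r := 2) q y

/-- Multiplication by a continuous function, as an operator on `L²(0,l)`. -/
def mulCont (l : ℝ) (w : C(ℝ, ℝ)) : IntervalL2 l →L[ℝ] IntervalL2 l := mulL2 (contLInfty l w)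

lemma coeFn_mulCont (w : C(ℝ, ℝ)) (y : IntervalL2 l) :
    mulCont l w y =ᵐ[volume.restrict (Ioo 0 l)] fun x => w x * y x := by
  have h1 : contLInfty l w =ᵐ[volume.restrict (Ioo (0 : ℝ) l)] w := MemLp.coeFn_toLp _
  filter_upwards [coeFn_mulL2 (contLInfty l w) y, h1] with x hx hx1
  rw [mulCont, hx, hx1]

/-- The endpoint `0` (for `false`) or `l` (for `true`) of `[0,l]`. -/
def endPos (l : ℝ) (b : Bool) : ℝ := bif b then l else 0

/-- The value at an endpoint of a function `y` with weak derivative `g`, written as a continuous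
functional of `(y,g)`: the integral of `(w y)' = w' y + w g` for the affine function `w` with
`w = 1` at that endpoint (up to the orientation) and `w = 0` at the other one. -/
def endValue (l : ℝ) (b : Bool) : IntervalL2 l × IntervalL2 l →L[ℝ] ℝ :=
  (innerSL ℝ (contL2 l (.const ℝ l⁻¹))).comp (.fst ℝ _ _) +
    (innerSL ℝ (contL2 l (bif b then ⟨fun x => x / l, by fun_prop⟩
      else ⟨fun x => x / l - 1, by fun_prop⟩))).comp (.snd ℝ _ _)

lemma endValue_eq (hl : 0 < l) {y g : IntervalL2 l} {Y : ℝ → ℝ} (hY : IsPrimitiveOn l Y g)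
    (hy : y =ᵐ[volume.restrict (Ioo 0 l)] Y) (b : Bool) :
    endValue l b (y, g) = Y (endPos l b) := by
  set w : C(ℝ, ℝ) := bif b then ⟨fun x => x / l, by fun_prop⟩
      else ⟨fun x => x / l - 1, by fun_prop⟩ with hw
  have hwd : ∀ x, HasDerivAt w l⁻¹ x := by
    intro x
    have h1 : HasDerivAt (fun x : ℝ => x / l) l⁻¹ x := by
      simpa using (hasDerivAt_id x).div_const l
    cases b
    · exact h1.sub_const 1
    · exact h1
  have hwp : IsPrimitiveOn l w fun _ => l⁻¹ := .of_hasDerivAt hwd continuous_const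
  have h1 := (hY.mul hwp).integral_eq hl.le
  have h2 : Y l * w l - Y 0 * w 0 = Y (endPos l b) := by
    cases b
    · simp [hw, endPos, hl.ne']
    · simp [hw, endPos, hl.ne']
  rw [h2] at h1
  have h3 : endValue l b (y, g) = ⟪contL2 l (.const ℝ l⁻¹), y⟫ + ⟪contL2 l w, g⟫ := rfl
  have i1 : IntegrableOn (fun x => g x * w x) (Ioo 0 l) := hwp.integrableOn_mul hY.1
  have i2 : IntegrableOn (fun x => Y x * l⁻¹) (Ioo 0 l) := by
    simpa only [mul_comm] using hY.integrableOn_mul hwp.1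
  rw [integral_add i1 i2] at h1
  rw [h3, ← h1, IntervalL2.inner_eq, IntervalL2.inner_eq, add_comm]
  congr 1
  · refine integral_congr_ae ?_
    filter_upwards [coeFn_contL2 (l := l) w] with x hx
    rw [hx, mul_comm]
  · refine integral_congr_ae ?_
    filter_upwards [coeFn_contL2 (l := l) (.const ℝ l⁻¹), hy] with x hx hx'
    rw [hx, hx', mul_comm]
    rfl

end IntervalSobolev

/-! ### Sobolev spaces on a metric tree -/

namespace MetricTree

set_option linter.unusedSectionVars false

open Filter Topology
open scoped RealInnerProductSpace

variable {V E : Type*} [Fintype E] {Ω : MetricTree V E}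

/-- The vertex at which the edge `e` starts (for `false`) or ends (for `true`). -/
def endpt (Ω : MetricTree V E) (e : E) (b : Bool) : V := bif b then Ω.tgt e else Ω.src e

/-- The restriction of `(y, y')` to an edge. -/
def edgePair (Ω : MetricTree V E) (e : E) :
    WithLp 2 (Ω.L2 × Ω.L2) →L[ℝ] IntervalL2 (Ω.len e) × IntervalL2 (Ω.len e) :=
  ((PiLp.proj 2 (fun e : E => IntervalL2 (Ω.len e)) e).comp (WithLp.fstL 2 ℝ Ω.L2 Ω.L2)).prod
    ((PiLp.proj 2 (fun e : E => IntervalL2 (Ω.len e)) e).comp (WithLp.sndL 2 ℝ Ω.L2 Ω.L2))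

/-- The value of a function on the edge `e` at one of the ends of `e`. -/
def edgeValue (Ω : MetricTree V E) (e : E) (b : Bool) : WithLp 2 (Ω.L2 × Ω.L2) →L[ℝ] ℝ :=
  (endValue (Ω.len e) b).comp (Ω.edgePair e)

lemma edgeValue_apply (e : E) (b : Bool) (p : WithLp 2 (Ω.L2 × Ω.L2)) :
    Ω.edgeValue e b p = endValue (Ω.len e) b (p.fst e, p.snd e) := rfl

/-- Continuity on the metric tree as a condition on the end values on the edges. -/
lemma hasVertexValues_iff {p : WithLp 2 (Ω.L2 × Ω.L2)}
    (hp : ∀ e, IsWeakDeriv (p.fst e) (p.snd e)) (w : V → ℝ) :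
    Ω.HasVertexValues p.fst w ↔ ∀ e b, Ω.edgeValue e b p = w (Ω.endpt e b) := by
  refine forall_congr' fun e => ?_
  have hl := Ω.len_pos e
  obtain ⟨Y, hY, hyY⟩ := (isWeakDeriv_iff_exists_isPrimitiveOn hl).1 (hp e)
  have h1 := fun b => endValue_eq hl hY hyY b
  constructor
  · rintro ⟨Z, hZc, hyZ, h0, h2⟩ b
    have h3 := eqOn_Icc_of_ae_eq hl hY.continuousOn hZc (hyY.symm.trans hyZ)
    rw [edgeValue_apply, h1 b]
    cases b
    · exact (h3 ⟨le_rfl, hl.le⟩).trans h0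
    · exact (h3 ⟨hl.le, le_rfl⟩).trans h2
  · intro h
    refine ⟨Y, hY.continuousOn, hyY, ?_, ?_⟩
    · exact (h1 false).symm.trans (h false)
    · exact (h1 true).symm.trans (h true)

lemma mem_H1_iff {p : WithLp 2 (Ω.L2 × Ω.L2)} : p ∈ Ω.H1 ↔
    (∀ e, IsWeakDeriv (p.fst e) (p.snd e)) ∧
      ∃ w : V → ℝ, ∀ e b, Ω.edgeValue e b p = w (Ω.endpt e b) := by
  constructor
  · rintro ⟨h, w, hw⟩
    exact ⟨h, w, (hasVertexValues_iff h w).1 hw⟩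
  · rintro ⟨h, w, hw⟩
    exact ⟨h, w, (hasVertexValues_iff h w).2 hw⟩

lemma isClosed_H1 : IsClosed (Ω.H1 : Set (WithLp 2 (Ω.L2 × Ω.L2))) := by
  -- the end values of continuous functions form a finite-dimensional, hence closed, subspace
  let L : (V → ℝ) →ₗ[ℝ] (E × Bool → ℝ) := LinearMap.funLeft ℝ ℝ fun i => Ω.endpt i.1 i.2
  have h1 : (Ω.H1 : Set (WithLp 2 (Ω.L2 × Ω.L2))) =
      (⋂ e, {p | IsWeakDeriv (p.fst e) (p.snd e)}) ∩
        (fun p (i : E × Bool) => Ω.edgeValue i.1 i.2 p) ⁻¹' (LinearMap.range L) := by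
    ext p
    rw [SetLike.mem_coe, mem_H1_iff, mem_inter_iff, mem_iInter, mem_preimage, SetLike.mem_coe,
      LinearMap.mem_range]
    refine and_congr Iff.rfl (exists_congr fun w => ?_)
    rw [funext_iff, Prod.forall]
    exact ⟨fun h e b => (h e b).symm, fun h e b => (h e b).symm⟩
  have hc : Continuous fun (p : WithLp 2 (Ω.L2 × Ω.L2)) (i : E × Bool) =>
      Ω.edgeValue i.1 i.2 p := by
    refine continuous_pi fun i => ?_
    exact (Ω.edgeValue i.1 i.2).continuous
  have hL : IsClosed (LinearMap.range L : Set (E × Bool → ℝ)) :=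
    Submodule.closed_of_finiteDimensional _
  rw [h1]
  refine IsClosed.inter (isClosed_iInter fun e => ?_) (hL.preimage hc)
  exact isClosed_isWeakDeriv.preimage (Ω.edgePair e).continuous

instance : CompleteSpace Ω.H1 := isClosed_H1.completeSpace_coe

/-- The embedding `H¹(Ω) → L²(Ω)` as a continuous linear map. -/
def toL2L (Ω : MetricTree V E) : Ω.H1 →L[ℝ] Ω.L2 :=
  (WithLp.fstL 2 ℝ Ω.L2 Ω.L2).comp Ω.H1.subtypeL

/-- The weak derivative `H¹(Ω) → L²(Ω)` as a continuous linear map. -/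
def dxL (Ω : MetricTree V E) : Ω.H1 →L[ℝ] Ω.L2 :=
  (WithLp.sndL 2 ℝ Ω.L2 Ω.L2).comp Ω.H1.subtypeL

lemma isWeakDeriv_dx (y : Ω.H1) (e : E) : IsWeakDeriv (toL2 y e) (dx y e) := y.2.1 e

lemma norm_H1_le (y : Ω.H1) : ‖y‖ ≤ ‖toL2 y‖ + ‖dx y‖ := by
  have h1 : ‖y‖ ^ 2 = ‖toL2 y‖ ^ 2 + ‖dx y‖ ^ 2 := WithLp.prod_norm_sq_eq_of_L2 y.1
  refine abs_le_of_sq_le_sq' ?_ (by positivity) |>.2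
  nlinarith [norm_nonneg (toL2 y), norm_nonneg (dx y)]

lemma toL2_injective {y : Ω.H1} (h : toL2 y = 0) : y = 0 := by
  apply Subtype.ext
  refine withLp_prod_ext h ?_
  change dx y = 0
  ext1 e
  refine (isWeakDeriv_dx y e).unique ?_
  rw [h]
  exact IsWeakDeriv.zero

/-- The trace at a vertex is the end value on any incident edge. -/
lemma trace_endpt (y : Ω.H1) (e : E) (b : Bool) :
    trace y (Ω.endpt e b) = Ω.edgeValue e b y.1 :=
  ((hasVertexValues_iff y.2.1 _).1 y.2.2.choose_spec e b).symm

variable [Fintype V]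

lemma exists_endpt_of_mem_leaves {v : V} (hv : v ∈ Ω.leaves) : ∃ e b, Ω.endpt e b = v := by
  classical
  rw [leaves, Finset.mem_filter] at hv
  obtain ⟨e, he⟩ := Finset.card_pos.1 (hv.2.symm ▸ Nat.one_pos)
  rw [Finset.mem_filter] at he
  rcases he.2 with h | h
  · exact ⟨e, false, h⟩
  · exact ⟨e, true, h⟩

/-- The trace at a leaf as a continuous linear functional on `H¹(Ω)`. -/
def traceL (Ω : MetricTree V E) (v : Ω.leaves) : Ω.H1 →L[ℝ] ℝ :=
  (Ω.edgeValue (exists_endpt_of_mem_leaves v.2).choose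
    (exists_endpt_of_mem_leaves v.2).choose_spec.choose).comp Ω.H1.subtypeL

lemma traceL_apply (v : Ω.leaves) (y : Ω.H1) : Ω.traceL v y = trace y v := by
  conv_rhs => rw [← (exists_endpt_of_mem_leaves v.2).choose_spec.choose_spec]
  exact (trace_endpt y _ _).symm

/-- `H¹₀(Ω)`, like `H¹(Ω)`, as a space of pairs of a function and its weak derivative. -/
def H10 (Ω : MetricTree V E) : Submodule ℝ (WithLp 2 (Ω.L2 × Ω.L2)) :=
  (⨅ v : Ω.leaves, (Ω.traceL v).ker).map Ω.H1.subtype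

lemma mem_H10_iff {y : Ω.H1} : y.1 ∈ Ω.H10 ↔ VanishesOnLeaves y := by
  have h : y.1 ∈ Ω.H10 ↔ y ∈ ⨅ v : Ω.leaves, (Ω.traceL v).ker :=
    Function.Injective.mem_set_image Subtype.val_injective
  simp only [h, Submodule.mem_iInf, LinearMap.mem_ker, ContinuousLinearMap.coe_coe,
    traceL_apply, VanishesOnLeaves, Subtype.forall]

lemma H10_le_H1 : Ω.H10 ≤ Ω.H1 := Submodule.map_subtype_le _ _

instance : CompleteSpace Ω.H10 := by
  have h : IsClosed (⨅ v : Ω.leaves, (Ω.traceL v).ker : Submodule ℝ Ω.H1).carrier := by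
    change IsClosed ((⨅ v : Ω.leaves, (Ω.traceL v).ker : Submodule ℝ Ω.H1) : Set Ω.H1)
    simp only [Submodule.coe_iInf]
    exact isClosed_iInter fun v => (Ω.traceL v).isClosed_ker
  have h' : IsClosed (Ω.H10 : Set (WithLp 2 (Ω.L2 × Ω.L2))) :=
    isClosed_H1.isClosedEmbedding_subtypeVal.isClosedMap _ h
  exact h'.completeSpace_coe

/-- The embedding of `H¹₀(Ω)` into `H¹(Ω)`. -/
def H10.incl (Ω : MetricTree V E) : Ω.H10 →L[ℝ] Ω.H1 :=
  Ω.H10.subtypeL.codRestrict Ω.H1 fun y => H10_le_H1 y.2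

lemma H10.vanishesOnLeaves_incl (y : Ω.H10) : VanishesOnLeaves (H10.incl Ω y) :=
  mem_H10_iff.1 y.2

/-- Multiplication by the potential `q` on `L²(Ω)`. -/
def potentialL (q : Ω.LInfty) : Ω.L2 →L[ℝ] Ω.L2 :=
  (PiLp.continuousLinearEquiv 2 ℝ (fun e : E => IntervalL2 (Ω.len e))).symm.toContinuousLinearMap.comp
    (ContinuousLinearMap.pi fun e => (mulL2 (q e)).comp (PiLp.proj 2 _ e))

lemma potentialL_apply (q : Ω.LInfty) (y : Ω.L2) (e : E) :
    potentialL q y e = mulL2 (q e) (y e) := rfl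

lemma potentialForm_eq (q : Ω.LInfty) (y z : Ω.L2) :
    potentialForm q y z = ⟪potentialL q y, z⟫ := by
  rw [potentialForm, PiLp.inner_apply]
  refine Finset.sum_congr rfl fun e _ => ?_
  rw [potentialL_apply, IntervalL2.inner_eq]
  refine integral_congr_ae ?_
  filter_upwards [coeFn_mulL2 (q e) (y e)] with x hx
  rw [hx]

open Classical in
/-- A test function on one edge, extended by zero to the metric tree, belongs to `H¹₀(Ω)`. -/
lemma exists_testFunction_extension (e : E) {φ : ℝ → ℝ} (hφ : IsTestFunction (Ω.len e) φ) :
    ∃ y : Ω.H1, VanishesOnLeaves y ∧ (∀ z : Ω.L2, ⟪z, toL2 y⟫ = ∫ x in Ioo 0 (Ω.len e), z e x * φ x) ∧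
      ∀ z : Ω.L2, ⟪z, dx y⟫ = ∫ x in Ioo 0 (Ω.len e), z e x * deriv φ x := by
  let y : Ω.L2 := WithLp.toLp 2 (Pi.single e (hφ.memLp.toLp φ))
  let g : Ω.L2 := WithLp.toLp 2 (Pi.single e (hφ.deriv.memLp.toLp (deriv φ)))
  have hy : ∀ e', IsPrimitiveOn (Ω.len e') (Pi.single (M := fun _ => ℝ → ℝ) e φ e') (g e') ∧
      y e' =ᵐ[volume.restrict (Ioo 0 (Ω.len e'))] Pi.single (M := fun _ => ℝ → ℝ) e φ e' := by
    intro e'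
    by_cases h : e' = e
    · subst h
      simp only [y, g, Pi.single_eq_same]
      refine ⟨(hφ.isPrimitiveOn _).congr ?_, hφ.memLp.coeFn_toLp⟩
      filter_upwards [hφ.deriv.memLp.coeFn_toLp] with x hx
      rw [hx]
    · simp only [y, g, Pi.single_eq_of_ne h]
      refine ⟨(IsPrimitiveOn.const 0).congr ?_, Lp.coeFn_zero _ _ _⟩
      filter_upwards [Lp.coeFn_zero ℝ 2 (volume.restrict (Ioo 0 (Ω.len e')))] with x hx
      rw [hx]; rfl
  have hv : ∀ e' b, Ω.edgeValue e' b (WithLp.toLp 2 (y, g)) = 0 := by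
    intro e' b
    rw [edgeValue_apply]
    refine (endValue_eq (Ω.len_pos e') (hy e').1 (hy e').2 b).trans ?_
    by_cases h : e' = e
    · subst h
      rw [Pi.single_eq_same]
      refine hφ.eq_zero ?_
      cases b <;> simp [endPos]
    · rw [Pi.single_eq_of_ne h]; rfl
  have hmem : WithLp.toLp 2 (y, g) ∈ Ω.H1 := mem_H1_iff.2
    ⟨fun e' => (isWeakDeriv_iff_exists_isPrimitiveOn (Ω.len_pos e')).2 ⟨_, hy e'⟩, fun _ => 0, hv⟩
  have hsingle : ∀ (z : Ω.L2) (w : IntervalL2 (Ω.len e)),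
      ⟪z, (WithLp.toLp 2 (Pi.single e w) : Ω.L2)⟫ = ⟪z e, w⟫ := by
    intro z w
    rw [PiLp.inner_apply, Finset.sum_eq_single e]
    · simp
    · intro e' _ h
      simp [Pi.single_eq_of_ne h]
    · simp
  refine ⟨⟨_, hmem⟩, fun v hv' => ?_, fun z => ?_, fun z => ?_⟩
  · obtain ⟨e', b, rfl⟩ := exists_endpt_of_mem_leaves hv'
    rw [trace_endpt]
    exact hv e' b
  · exact (hsingle z _).trans (IntervalL2.inner_toLp _ _)
  · exact (hsingle z _).trans (IntervalL2.inner_toLp _ _)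

/-- `H¹₀(Ω)` is dense in `L²(Ω)`. -/
lemma eq_zero_of_forall_inner {z : Ω.L2}
    (h : ∀ y : Ω.H1, VanishesOnLeaves y → ⟪z, toL2 y⟫ = 0) : z = 0 := by
  ext1 e
  refine IntervalL2.eq_zero_of_forall_testFunction fun φ hφ => ?_
  obtain ⟨y, hy, h1, -⟩ := exists_testFunction_extension e hφ
  rw [← h1, h y hy]

end MetricTree

/-! ### Travelling waves on an edge -/

section TravellingWave

open Filter Topology
open scoped RealInnerProductSpace

/-- `H` is absolutely continuous on the real line with derivative `h`. -/
def IsGlobalPrimitive (H h : ℝ → ℝ) : Prop :=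
  (∀ a b, IntervalIntegrable h volume a b) ∧ ∀ a b, ∫ s in a..b, h s = H b - H a

/-- The distance from `x ∈ [0,l]` to an endpoint of `[0,l]`. -/
def endDist (l : ℝ) (b : Bool) (x : ℝ) : ℝ := bif b then l - x else x

/-- The derivative of `endDist`. -/
def endSign (b : Bool) : ℝ := bif b then -1 else 1

variable {l : ℝ} {b : Bool}

lemma endSign_mul_self : endSign b * endSign b = 1 := by cases b <;> norm_num [endSign]

lemma endDist_nonneg {x : ℝ} (hx : x ∈ Icc 0 l) : 0 ≤ endDist l b x := by
  cases b
  · exact hx.1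
  · exact sub_nonneg.2 hx.2

lemma continuous_endDist : Continuous (endDist l b) := by
  cases b
  · exact continuous_id
  · exact continuous_const.sub continuous_id

lemma hasDerivAt_endDist (x : ℝ) : HasDerivAt (endDist l b) (endSign b) x := by
  cases b
  · exact hasDerivAt_id x
  · exact (hasDerivAt_id x).const_sub l

lemma endDist_endPos : endDist l b (endPos l b) = 0 := by
  cases b <;> simp [endDist, endPos]

lemma endDist_endPos_not : endDist l b (endPos l (!b)) = l := by
  cases b <;> simp [endDist, endPos]

lemma measurePreserving_sub_endDist (l : ℝ) (b : Bool) (t : ℝ) :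
    MeasurePreserving (fun x => t - endDist l b x) volume volume := by
  cases b
  · exact Measure.measurePreserving_sub_left volume t
  · have h1 : (fun x => t - endDist l true x) = fun x => x + (t - l) := by
      funext x; simp only [endDist, cond_true]; ring
    rw [h1]
    exact measurePreserving_add_right volume (t - l)

lemma IsGlobalPrimitive.isPrimitiveOn {H h : ℝ → ℝ} (hH : IsGlobalPrimitive H h) (t l : ℝ)
    (b : Bool) : IsPrimitiveOn l (fun x => H (t - endDist l b x))
      fun x => -endSign b * h (t - endDist l b x) := by
  have key : ∀ x, IntervalIntegrable (fun x => h (t - endDist l b x)) volume 0 x ∧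
      -endSign b * ∫ y in (0 : ℝ)..x, h (t - endDist l b y) =
        H (t - endDist l b x) - H (t - endDist l b 0) := by
    intro x
    cases b
    · simp only [endDist, endSign, cond_false]
      refine ⟨?_, ?_⟩
      · have := (hH.1 (t - 0) (t - x)).comp_sub_left t
        simpa using this
      · rw [intervalIntegral.integral_comp_sub_left, hH.2]
        ring
    · simp only [endDist, endSign, cond_true]
      have h1 : (fun y => h (t - (l - y))) = fun y => h (y + (t - l)) := by
        funext y; congr 1; ring
      have h2 : t - (l - x) = x + (t - l) := by ring
      have h3 : t - (l - 0) = 0 + (t - l) := by ring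
      rw [h1, h2, h3]
      refine ⟨?_, ?_⟩
      · have := (hH.1 (0 + (t - l)) (x + (t - l))).comp_add_right (t - l)
        simpa using this
      · rw [intervalIntegral.integral_comp_add_right, hH.2]
        ring
  refine ⟨?_, fun x _ => ?_⟩
  · rcases le_or_gt l 0 with hl | hl
    · simp [Ioo_eq_empty (not_lt.2 hl)]
    · exact (((intervalIntegrable_iff_integrableOn_Ioo_of_le hl.le).1 (key l).1).const_mul _)
  · rw [intervalIntegral.integral_const_mul, (key x).2]
    ring

/-- The restriction to `(0,l)` of the wave with profile `h` that starts at an endpoint of `(0,l)`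
at time `0` and travels into the interval: at time `t` its value at `x` is `h (t - d)`, for the
distance `d` from `x` to that endpoint. -/
def travel (l : ℝ) (b : Bool) (t : ℝ) : Lp ℝ 2 (volume : Measure ℝ) →L[ℝ] IntervalL2 l :=
  (LpToLpRestrictCLM ℝ ℝ ℝ volume 2 (Ioo 0 l)).comp
    (Lp.compMeasurePreservingₗᵢ ℝ _ (measurePreserving_sub_endDist l b t)).toContinuousLinearMap

lemma coeFn_travel (t : ℝ) (h : Lp ℝ 2 (volume : Measure ℝ)) :
    travel l b t h =ᵐ[volume.restrict (Ioo 0 l)] fun x => h (t - endDist l b x) := by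
  have h1 := LpToLpRestrictCLM_coeFn ℝ (Ioo 0 l)
    (Lp.compMeasurePreserving _ (measurePreserving_sub_endDist l b t) h)
  have h2 := ae_restrict_of_ae (s := Ioo 0 l)
    (Lp.coeFn_compMeasurePreserving h (measurePreserving_sub_endDist l b t))
  filter_upwards [h1, h2] with x hx hx'
  exact hx.trans hx'

lemma norm_travel_le (t : ℝ) (h : Lp ℝ 2 (volume : Measure ℝ)) : ‖travel l b t h‖ ≤ ‖h‖ := by
  refine (norm_Lp_toLp_restrict_le _ _).trans (le_of_eq ?_)
  exact (Lp.compMeasurePreservingₗᵢ ℝ _ (measurePreserving_sub_endDist l b t)).norm_map h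

/-- Continuity of translations in `L²`. -/
lemma continuous_travel (h : Lp ℝ 2 (volume : Measure ℝ)) :
    Continuous fun t => travel l b t h := by
  refine (LpToLpRestrictCLM ℝ ℝ ℝ volume 2 (Ioo 0 l)).continuous.comp ?_
  have hc : Continuous fun p : ℝ × ℝ => p.1 - endDist l b p.2 :=
    continuous_fst.sub (continuous_endDist.comp continuous_snd)
  exact Continuous.compMeasurePreservingLp (f := fun _ : ℝ => h)
    (g := fun t : ℝ => (⟨fun x => t - endDist l b x, continuous_const.sub continuous_endDist⟩ :
      C(ℝ, ℝ))) continuous_const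
    (ContinuousMap.curry ⟨fun p : ℝ × ℝ => p.1 - endDist l b p.2, hc⟩).continuous
    (measurePreserving_sub_endDist l b) (by simp)

lemma inner_travel (t : ℝ) (h : Lp ℝ 2 (volume : Measure ℝ)) (z : IntervalL2 l) :
    ⟪travel l b t h, z⟫ = ∫ x in Ioo 0 l, h (t - endDist l b x) * z x := by
  rw [IntervalL2.inner_eq]
  refine integral_congr_ae ?_
  filter_upwards [coeFn_travel t h] with x hx
  rw [hx]

/-- The time integral of a travelling wave, tested against an `L²` function (Fubini). -/
lemma integral_inner_travel {h : Lp ℝ 2 (volume : Measure ℝ)} {H : ℝ → ℝ}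
    (hH : IsGlobalPrimitive H h) (z : IntervalL2 l) {t : ℝ} (ht : 0 ≤ t) :
    ∫ s in (0 : ℝ)..t, ⟪travel l b s h, z⟫ =
      ∫ x in Ioo 0 l, (H (t - endDist l b x) - H (-endDist l b x)) * z x := by
  have hmeas : StronglyMeasurable fun p : ℝ × ℝ => h (p.1 - endDist l b p.2) * z p.2 := by
    refine ((Lp.stronglyMeasurable h).comp_measurable ?_).mul
      ((Lp.stronglyMeasurable z).comp_measurable measurable_snd)
    exact measurable_fst.sub (continuous_endDist.measurable.comp measurable_snd)
  have hx : ∀ s, Integrable (fun x => h (s - endDist l b x) * z x)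
      (volume.restrict (Ioo 0 l)) := by
    intro s
    have h1 : Integrable (fun x => travel l b s h x * z x) (volume.restrict (Ioo 0 l)) :=
      (Lp.memLp (travel l b s h)).integrable_mul (Lp.memLp z)
    refine h1.congr ?_
    filter_upwards [coeFn_travel s h] with x hx
    rw [hx]
  have hint : Integrable (Function.uncurry fun s x => h (s - endDist l b x) * z x)
      ((volume.restrict (Ioc 0 t)).prod (volume.restrict (Ioo 0 l))) := by
    refine (integrable_prod_iff hmeas.aestronglyMeasurable).2 ⟨Eventually.of_forall hx, ?_⟩
    refine Integrable.of_bound (C := ‖h‖ * ‖z‖)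
      hmeas.aestronglyMeasurable.norm.integral_prod_right' (Eventually.of_forall fun s => ?_)
    have e1 : ∫ x in Ioo 0 l, ‖h (s - endDist l b x) * z x‖ = ⟪|travel l b s h|, |z|⟫ := by
      rw [IntervalL2.inner_eq]
      refine integral_congr_ae ?_
      filter_upwards [coeFn_travel s h, Lp.coeFn_abs (travel l b s h), Lp.coeFn_abs z]
        with x h1 h2 h3
      rw [h2, h3, h1, norm_mul, Real.norm_eq_abs, Real.norm_eq_abs]
    simp only
    rw [e1]
    refine (norm_inner_le_norm _ _).trans ?_
    rw [norm_abs_eq_norm, norm_abs_eq_norm]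
    gcongr
    exact norm_travel_le s h
  simp only [inner_travel]
  rw [intervalIntegral.integral_of_le ht, integral_integral_swap hint]
  refine integral_congr_ae (Eventually.of_forall fun x => ?_)
  simp only
  rw [integral_mul_const, ← intervalIntegral.integral_of_le ht,
    intervalIntegral.integral_comp_sub_right (fun s => h s) (endDist l b x), hH.2, zero_sub]

end TravellingWave

/-! ### Extension of the boundary data -/

section BoundaryData

open Filter Topology

/-- Extension by zero from `L²(0,T)` to `L²(ℝ)`. -/
lemma exists_extension_by_zero {T : ℝ} (g : IntervalL2 T) :
    ∃ h : Lp ℝ 2 (volume : Measure ℝ), h =ᵐ[volume] (Ioo 0 T).indicator g ∧ ‖h‖ = ‖g‖ := by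
  have h1 : MemLp ((Ioo 0 T).indicator g) 2 volume :=
    (memLp_indicator_iff_restrict measurableSet_Ioo).2 (Lp.memLp g)
  refine ⟨h1.toLp _, h1.coeFn_toLp, ?_⟩
  rw [Lp.norm_toLp, eLpNorm_indicator_eq_eLpNorm_restrict measurableSet_Ioo, Lp.norm_def]

lemma isGlobalPrimitive_of_intervalIntegrable {h : ℝ → ℝ}
    (hh : ∀ a b, IntervalIntegrable h volume a b) :
    IsGlobalPrimitive (fun x => ∫ s in (0 : ℝ)..x, h s) h :=
  ⟨hh, fun a b => by rw [intervalIntegral.integral_interval_sub_left (hh _ _) (hh _ _)]⟩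

lemma Lp.intervalIntegrable (h : Lp ℝ 2 (volume : Measure ℝ)) (a b : ℝ) :
    IntervalIntegrable h volume a b :=
  (((Lp.memLp h).locallyIntegrable one_le_two).integrableOn_isCompact
    isCompact_uIcc).intervalIntegrable

/-- Data `f ∈ H¹(0,T)` vanishing near the ends extend by zero to an absolutely continuous function
`Φ` on the real line, which belongs to `L²(ℝ)` together with its derivative. -/
lemma exists_global_data {T : ℝ} (hT : 0 < T) {f g : IntervalL2 T} (hfg : IsWeakDeriv f g)
    (hf : VanishesNearEnds f) :
    ∃ (fR gR : Lp ℝ 2 (volume : Measure ℝ)) (Φ : ℝ → ℝ), ‖fR‖ = ‖f‖ ∧ ‖gR‖ = ‖g‖ ∧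
      IsGlobalPrimitive Φ gR ∧ fR =ᵐ[volume] Φ ∧ (∀ x ≤ 0, Φ x = 0) ∧ Continuous Φ ∧
      f =ᵐ[volume.restrict (Ioo 0 T)] Φ := by
  obtain ⟨fR, hfR, hfn⟩ := exists_extension_by_zero f
  obtain ⟨gR, hgR, hgn⟩ := exists_extension_by_zero g
  obtain ⟨Y, hY, hfY⟩ := (isWeakDeriv_iff_exists_isPrimitiveOn hT).1 hfg
  obtain ⟨δ, hδ, hδf⟩ := hf
  set Φ : ℝ → ℝ := fun x => ∫ s in (0 : ℝ)..x, gR s with hΦ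
  have hΦp : IsGlobalPrimitive Φ gR :=
    isGlobalPrimitive_of_intervalIntegrable (Lp.intervalIntegrable gR)
  -- the continuous representative of `f` vanishes at the two ends of `[0,T]`
  have hends : Y 0 = 0 ∧ Y T = 0 := by
    have h1 : ∀ᵐ t ∂volume.restrict (Ioo 0 T), t < δ ∨ T - δ < t → Y t = 0 := by
      filter_upwards [hδf, hfY] with t h1 h2 h3
      rw [← h2, h1 h3]
    have hc := hY.continuousOn
    set U : Set ℝ := {t | t < δ ∨ T - δ < t} with hU
    set η : ℝ := min δ T with hη
    have hη0 : 0 < η := lt_min hδ hT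
    have h2 : ∀ a, 0 ≤ a → a + η ≤ T → (∀ t ∈ Ioo a (a + η), t ∈ U) →
        ∀ t ∈ Icc a (a + η), Y t = 0 := by
      intro a ha0 haT haU t ht
      have h3 : Y =ᵐ[volume.restrict (Icc a (a + η))] fun _ => 0 := by
        rw [← restrict_Ioo_eq_restrict_Icc]
        have h4 := ae_restrict_of_ae_restrict_of_subset
          (Ioo_subset_Ioo ha0 haT : Ioo a (a + η) ⊆ Ioo 0 T) h1
        filter_upwards [h4, ae_restrict_mem measurableSet_Ioo] with s hs hs'
        exact hs (haU s hs')
      exact Measure.eqOn_Icc_of_ae_eq volume (by linarith) h3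
        (hc.mono (Icc_subset_Icc ha0 haT)) continuousOn_const ht
    have hηδ : η ≤ δ := min_le_left _ _
    have hηT : η ≤ T := min_le_right _ _
    constructor
    · exact h2 0 le_rfl (by linarith) (fun t ht => Or.inl (by linarith [ht.2])) 0
        ⟨le_rfl, by linarith⟩
    · exact h2 (T - η) (by linarith) (by linarith) (fun t ht => Or.inr (by linarith [ht.1])) T
        ⟨by linarith, by linarith⟩
  have hΦY : ∀ x ∈ Icc 0 T, Φ x = Y x := by
    intro x hx
    rw [hY.2 x hx, hends.1, zero_add, ← setIntegral_Ioo_eq_intervalIntegral hx.1, hΦ]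
    simp only
    rw [← setIntegral_Ioo_eq_intervalIntegral hx.1]
    refine integral_congr_ae ?_
    filter_upwards [ae_restrict_of_ae hgR, ae_restrict_mem measurableSet_Ioo] with s hs hs'
    rw [hs, indicator_of_mem (Ioo_subset_Ioo_right hx.2 hs')]
  have hzero : ∀ a c, (∀ x ∈ uIoc a c, x ∉ Ioo 0 T) → ∫ s in a..c, gR s = 0 := by
    intro a c h
    refine intervalIntegral.integral_zero_ae ?_
    filter_upwards [hgR] with s hs hs'
    rw [hs, indicator_of_notMem (h s hs')]
  have hΦneg : ∀ x ≤ 0, Φ x = 0 := fun x hx => hzero 0 x fun s hs h => by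
    rw [uIoc_of_ge hx] at hs
    linarith [hs.2, h.1]
  have hΦT : ∀ x, T ≤ x → Φ x = 0 := fun x hx => by
    have h1 := hΦp.2 T x
    rw [hzero T x fun s hs h => by
      rw [uIoc_of_le hx] at hs
      linarith [hs.1, h.2], hΦY T ⟨hT.le, le_rfl⟩, hends.2] at h1
    linarith
  refine ⟨fR, gR, Φ, hfn, hgn, hΦp, ?_, hΦneg, ?_, ?_⟩
  · have hfY' := (ae_restrict_iff' measurableSet_Ioo).1 hfY
    filter_upwards [hfR, hfY'] with x hx hx'
    rw [hx]
    by_cases h : x ∈ Ioo 0 T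
    · rw [indicator_of_mem h, hx' h, hΦY x (Ioo_subset_Icc_self h)]
    · rw [indicator_of_notMem h]
      rcases le_or_gt x 0 with h0 | h0
      · rw [hΦneg x h0]
      · rw [hΦT x (not_lt.1 fun hlt => h ⟨h0, hlt⟩)]
  · exact intervalIntegral.continuous_primitive (Lp.intervalIntegrable gR) 0
  · filter_upwards [hfY, ae_restrict_mem measurableSet_Ioo] with x hx hx'
    rw [hx, hΦY x (Ioo_subset_Icc_self hx')]

end BoundaryData

/-! ### The lift of boundary data on an edge -/

section Lift

open Filter Topology
open scoped RealInnerProductSpace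

variable {l : ℝ} {b : Bool}

/-- The cutoff `(1 - d/l)²`, for the distance `d` to an endpoint of `(0,l)`. It equals `1` at this
endpoint, and it vanishes together with its derivative at the other one. -/
def cutoff (l : ℝ) (b : Bool) : C(ℝ, ℝ) :=
  ⟨fun x => (1 - endDist l b x / l) ^ 2,
    (continuous_const.sub (continuous_endDist.div_const l)).pow 2⟩

/-- The first derivative of `cutoff`. -/
def cutoffDeriv (l : ℝ) (b : Bool) : C(ℝ, ℝ) :=
  ⟨fun x => -(2 / l) * endSign b * (1 - endDist l b x / l),
    continuous_const.mul (continuous_const.sub (continuous_endDist.div_const l))⟩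

/-- The second derivative of `cutoff`. -/
def cutoffDerivTwo (l : ℝ) : C(ℝ, ℝ) := .const ℝ (2 / l ^ 2)

lemma isPrimitiveOn_cutoff : IsPrimitiveOn l (cutoff l b) (cutoffDeriv l b) := by
  refine .of_hasDerivAt (fun x => ?_) (cutoffDeriv l b).continuous
  have h1 := (((hasDerivAt_endDist (l := l) (b := b) x).div_const l).const_sub 1).fun_pow 2
  refine h1.congr_deriv ?_
  simp only [cutoffDeriv, ContinuousMap.coe_mk]
  push_cast
  ring

lemma isPrimitiveOn_cutoffDeriv : IsPrimitiveOn l (cutoffDeriv l b) (cutoffDerivTwo l) := by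
  refine .of_hasDerivAt (fun x => ?_) (cutoffDerivTwo l).continuous
  have h1 := (((hasDerivAt_endDist (l := l) (b := b) x).div_const l).const_sub 1).const_mul
    (-(2 / l) * endSign b)
  refine h1.congr_deriv ?_
  simp only [cutoffDerivTwo, ContinuousMap.const_apply]
  linear_combination 2 / l ^ 2 * endSign_mul_self (b := b)

lemma cutoff_endPos : cutoff l b (endPos l b) = 1 := by
  simp [cutoff, endDist_endPos]

lemma cutoff_endPos_not (hl : 0 < l) : cutoff l b (endPos l (!b)) = 0 := by
  simp [cutoff, endDist_endPos_not, hl.ne']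

lemma cutoffDeriv_endPos_not (hl : 0 < l) : cutoffDeriv l b (endPos l (!b)) = 0 := by
  simp [cutoffDeriv, endDist_endPos_not, hl.ne']

lemma inner_mulCont (w : C(ℝ, ℝ)) (y z : IntervalL2 l) :
    ⟪mulCont l w y, z⟫ = ∫ x in Ioo 0 l, y x * (w x * z x) := by
  rw [IntervalL2.inner_eq]
  refine integral_congr_ae ?_
  filter_upwards [coeFn_mulCont w y] with x hx
  rw [hx]
  ring

lemma inner_mulCont_right (w : C(ℝ, ℝ)) (y z : IntervalL2 l) :
    ⟪mulCont l w y, z⟫ = ⟪y, mulCont l w z⟫ := by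
  rw [inner_mulCont, IntervalL2.inner_eq]
  refine integral_congr_ae ?_
  filter_upwards [coeFn_mulCont w z] with x hx
  rw [hx]

/-- The lift `χ(x) f(t - d)` of boundary data `f` at an endpoint of `(0,l)`, where `d` is the
distance of `x` to this endpoint and `χ` the cutoff; it is a travelling wave close to the endpoint.
With the derivative of `f` in place of `f` it is the time derivative of the lift. -/
def lift (l : ℝ) (b : Bool) (t : ℝ) (f : Lp ℝ 2 (volume : Measure ℝ)) : IntervalL2 l :=
  mulCont l (cutoff l b) (travel l b t f)

/-- The spatial derivative of the lift of `f`, where `g` is the derivative of `f`. -/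
def liftDx (l : ℝ) (b : Bool) (t : ℝ) (f g : Lp ℝ 2 (volume : Measure ℝ)) : IntervalL2 l :=
  mulCont l (cutoffDeriv l b) (travel l b t f) - endSign b • mulCont l (cutoff l b) (travel l b t g)

/-- The image of the lift of `f` under `∂ₜ² - ∂ₓ²`, where `g` is the derivative of `f`. The second
derivatives of `f` cancel. -/
def liftSource (l : ℝ) (b : Bool) (t : ℝ) (f g : Lp ℝ 2 (volume : Measure ℝ)) : IntervalL2 l :=
  (2 * endSign b) • mulCont l (cutoffDeriv l b) (travel l b t g) -
    mulCont l (cutoffDerivTwo l) (travel l b t f)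

lemma continuous_mulCont_travel (w : C(ℝ, ℝ)) (f : Lp ℝ 2 (volume : Measure ℝ)) :
    Continuous fun t => mulCont l w (travel l b t f) :=
  (mulCont l w).continuous.comp (continuous_travel f)

lemma continuous_lift (f : Lp ℝ 2 (volume : Measure ℝ)) : Continuous fun t => lift l b t f :=
  continuous_mulCont_travel _ f

lemma continuous_liftDx (f g : Lp ℝ 2 (volume : Measure ℝ)) :
    Continuous fun t => liftDx l b t f g :=
  have h : Continuous fun t => endSign b • mulCont l (cutoff l b) (travel l b t g) :=
    (continuous_mulCont_travel (cutoff l b) g).const_smul (endSign b)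
  (continuous_mulCont_travel (cutoffDeriv l b) f).sub h

lemma continuous_liftSource (f g : Lp ℝ 2 (volume : Measure ℝ)) :
    Continuous fun t => liftSource l b t f g :=
  have h : Continuous fun t =>
      (2 * endSign b) • mulCont l (cutoffDeriv l b) (travel l b t g) :=
    (continuous_mulCont_travel (cutoffDeriv l b) g).const_smul (2 * endSign b)
  h.sub (continuous_mulCont_travel (cutoffDerivTwo l) f)

lemma norm_mulCont_travel_le (w : C(ℝ, ℝ)) (t : ℝ) (f : Lp ℝ 2 (volume : Measure ℝ)) :
    ‖mulCont l w (travel l b t f)‖ ≤ ‖mulCont l w‖ * ‖f‖ :=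
  ((mulCont l w).le_opNorm _).trans
    (mul_le_mul_of_nonneg_left (norm_travel_le t f) (norm_nonneg _))

/-- A bound for the norms of all components of a lift. -/
def liftBound (l : ℝ) (b : Bool) : ℝ :=
  ‖mulCont l (cutoff l b)‖ + 2 * ‖mulCont l (cutoffDeriv l b)‖ + ‖mulCont l (cutoffDerivTwo l)‖

lemma liftBound_nonneg : 0 ≤ liftBound l b := by unfold liftBound; positivity

lemma norm_endSign : ‖endSign b‖ = 1 := by cases b <;> simp [endSign]

lemma norm_lift_le (t : ℝ) (f : Lp ℝ 2 (volume : Measure ℝ)) :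
    ‖lift l b t f‖ ≤ liftBound l b * ‖f‖ := by
  refine (norm_mulCont_travel_le _ t f).trans ?_
  gcongr
  unfold liftBound
  linarith [norm_nonneg (mulCont l (cutoffDeriv l b)), norm_nonneg (mulCont l (cutoffDerivTwo l))]

lemma norm_liftDx_le (t : ℝ) (f g : Lp ℝ 2 (volume : Measure ℝ)) :
    ‖liftDx l b t f g‖ ≤ liftBound l b * (‖f‖ + ‖g‖) := by
  refine (norm_sub_le _ _).trans ?_
  rw [norm_smul, norm_endSign, one_mul, mul_add]
  refine add_le_add ((norm_mulCont_travel_le _ t f).trans ?_)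
    ((norm_mulCont_travel_le _ t g).trans ?_)
  all_goals
    gcongr
    unfold liftBound
    linarith [norm_nonneg (mulCont l (cutoffDeriv l b)), norm_nonneg (mulCont l (cutoff l b)),
      norm_nonneg (mulCont l (cutoffDerivTwo l))]

lemma norm_liftSource_le (t : ℝ) (f g : Lp ℝ 2 (volume : Measure ℝ)) :
    ‖liftSource l b t f g‖ ≤ liftBound l b * (‖f‖ + ‖g‖) := by
  refine (norm_sub_le _ _).trans ?_
  rw [norm_smul, norm_mul, norm_endSign, Real.norm_ofNat, mul_one, add_comm, mul_add]
  have h1 := norm_mulCont_travel_le (l := l) (b := b) (cutoffDeriv l b) t g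
  have h2 := norm_mulCont_travel_le (l := l) (b := b) (cutoffDerivTwo l) t f
  have h3 : 2 * ‖mulCont l (cutoffDeriv l b)‖ * ‖g‖ ≤ liftBound l b * ‖g‖ := by
    gcongr
    unfold liftBound
    linarith [norm_nonneg (mulCont l (cutoff l b)), norm_nonneg (mulCont l (cutoffDerivTwo l))]
  have h4 : ‖mulCont l (cutoffDerivTwo l)‖ * ‖f‖ ≤ liftBound l b * ‖f‖ := by
    gcongr
    unfold liftBound
    linarith [norm_nonneg (mulCont l (cutoff l b)), norm_nonneg (mulCont l (cutoffDeriv l b))]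
  linarith

variable {f g : Lp ℝ 2 (volume : Measure ℝ)} {Φ : ℝ → ℝ}

lemma ae_eq_comp_endDist (hf : f =ᵐ[volume] Φ) (t : ℝ) :
    ∀ᵐ x ∂volume.restrict (Ioo 0 l), f (t - endDist l b x) = Φ (t - endDist l b x) :=
  ae_restrict_of_ae ((measurePreserving_sub_endDist l b t).quasiMeasurePreserving.ae hf)

lemma lift_ae_eq (hf : f =ᵐ[volume] Φ) (t : ℝ) :
    lift l b t f =ᵐ[volume.restrict (Ioo 0 l)]
      fun x => cutoff l b x * Φ (t - endDist l b x) := by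
  filter_upwards [coeFn_mulCont (cutoff l b) (travel l b t f), coeFn_travel (b := b) t f,
    ae_eq_comp_endDist (b := b) hf t] with x h1 h2 h3
  rw [lift, h1, h2, h3]

lemma isPrimitiveOn_lift (hg : IsGlobalPrimitive Φ g) (hf : f =ᵐ[volume] Φ) (t : ℝ) :
    IsPrimitiveOn l (fun x => cutoff l b x * Φ (t - endDist l b x)) (liftDx l b t f g) := by
  refine (isPrimitiveOn_cutoff.mul (hg.isPrimitiveOn t l b)).congr ?_
  filter_upwards [coeFn_mulCont (cutoff l b) (travel l b t g),
    coeFn_mulCont (cutoffDeriv l b) (travel l b t f), coeFn_travel (b := b) t f,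
    coeFn_travel (b := b) t g, ae_eq_comp_endDist (b := b) hf t,
    Lp.coeFn_sub (mulCont l (cutoffDeriv l b) (travel l b t f))
      (endSign b • mulCont l (cutoff l b) (travel l b t g)),
    Lp.coeFn_smul (endSign b) (mulCont l (cutoff l b) (travel l b t g))] with x h1 h2 h3 h4 h5 h6 h7
  rw [liftDx, h6, Pi.sub_apply, h7, Pi.smul_apply, h1, h2, h3, h4, h5, smul_eq_mul]
  ring

/-- The time derivative of the lift of `f` is the lift of `f'`. -/
lemma lift_eq_integral (hg : IsGlobalPrimitive Φ g) (hf : f =ᵐ[volume] Φ)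
    (hΦ : ∀ x ≤ 0, Φ x = 0) {t : ℝ} (ht : 0 ≤ t) :
    lift l b t f = ∫ s in (0 : ℝ)..t, lift l b s g := by
  refine ext_inner_left ℝ fun z => ?_
  have h1 := (innerSL ℝ z).intervalIntegral_comp_comm
    ((continuous_lift (l := l) (b := b) g).intervalIntegrable (μ := volume) 0 t)
  simp only [innerSL_apply_apply] at h1
  rw [← h1]
  have hcomm : ∀ y : IntervalL2 l, ⟪z, y⟫ = ⟪y, z⟫ := fun y => real_inner_comm _ _
  simp only [hcomm, lift, inner_mulCont_right]
  rw [integral_inner_travel hg _ ht, inner_travel]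
  refine integral_congr_ae ?_
  filter_upwards [ae_eq_comp_endDist (b := b) hf t, ae_restrict_mem measurableSet_Ioo] with x h3 hx
  rw [h3, hΦ (-endDist l b x) (neg_nonpos.2 (endDist_nonneg (Ioo_subset_Icc_self hx))), sub_zero]

/-- The lift satisfies the wave equation with source `liftSource`, tested against functions that
vanish at the endpoint carrying the data, and integrated once in time. -/
lemma lift_equation (hl : 0 < l) (hg : IsGlobalPrimitive Φ g) (hf : f =ᵐ[volume] Φ)
    (hΦ : ∀ x ≤ 0, Φ x = 0) (hΦc : Continuous Φ) {t : ℝ} (ht : 0 ≤ t) {z z' : IntervalL2 l}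
    {Z : ℝ → ℝ} (hZ : IsPrimitiveOn l Z z') (hzZ : z =ᵐ[volume.restrict (Ioo 0 l)] Z)
    (hZ0 : Z (endPos l b) = 0) :
    ⟪lift l b t g, z⟫ + ∫ s in (0 : ℝ)..t, ⟪liftDx l b s f g, z'⟫ =
      ∫ s in (0 : ℝ)..t, ⟪liftSource l b s f g, z⟫ := by
  set σ := endSign b with hσ
  set Ψ : ℝ → ℝ := fun x => ∫ s in (0 : ℝ)..x, Φ s with hΨ
  have hΨp : IsGlobalPrimitive Ψ Φ :=
    isGlobalPrimitive_of_intervalIntegrable fun _ _ => hΦc.intervalIntegrable _ _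
  have hΨf : IsGlobalPrimitive Ψ f := by
    refine ⟨Lp.intervalIntegrable f, fun c d => ?_⟩
    rw [← hΨp.2]
    refine intervalIntegral.integral_congr_ae ?_
    filter_upwards [hf] with x hx _ using hx
  have hΨ0 : ∀ x ≤ 0, Ψ x = 0 := fun x hx => by
    refine intervalIntegral.integral_zero_ae (Eventually.of_forall fun s hs => ?_)
    rw [uIoc_of_ge hx] at hs
    exact hΦ s hs.2
  have hcont : ∀ (h : Lp ℝ 2 (volume : Measure ℝ)) (y : IntervalL2 l),
      IntervalIntegrable (fun s => ⟪travel l b s h, y⟫) volume 0 t := fun h y =>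
    ((continuous_travel h).inner continuous_const).intervalIntegrable _ _
  have hneg : ∀ᵐ x ∂volume.restrict (Ioo 0 l), -endDist l b x ≤ 0 := by
    filter_upwards [ae_restrict_mem measurableSet_Ioo] with x hx
    exact neg_nonpos.2 (endDist_nonneg (Ioo_subset_Icc_self hx))
  -- time integrals of travelling waves multiplied by a continuous function
  have If : ∀ (w : C(ℝ, ℝ)) (y : IntervalL2 l), ∫ s in (0 : ℝ)..t, ⟪travel l b s f, mulCont l w y⟫ =
      ∫ x in Ioo 0 l, Ψ (t - endDist l b x) * (w x * y x) := by
    intro w y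
    rw [integral_inner_travel hΨf _ ht]
    refine integral_congr_ae ?_
    filter_upwards [coeFn_mulCont w y, hneg] with x h1 h2
    rw [h1, hΨ0 _ h2, sub_zero]
  have Ig : ∀ (w : C(ℝ, ℝ)) (y : IntervalL2 l), ∫ s in (0 : ℝ)..t, ⟪travel l b s g, mulCont l w y⟫ =
      ∫ x in Ioo 0 l, Φ (t - endDist l b x) * (w x * y x) := by
    intro w y
    rw [integral_inner_travel hg _ ht]
    refine integral_congr_ae ?_
    filter_upwards [coeFn_mulCont w y, hneg] with x h1 h2
    rw [h1, hΦ _ h2, sub_zero]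
  have e1 : ∫ s in (0 : ℝ)..t, ⟪liftDx l b s f g, z'⟫ =
      (∫ x in Ioo 0 l, Ψ (t - endDist l b x) * (cutoffDeriv l b x * z' x)) -
        σ * ∫ x in Ioo 0 l, Φ (t - endDist l b x) * (cutoff l b x * z' x) := by
    simp only [liftDx, inner_sub_left, real_inner_smul_left, inner_mulCont_right]
    rw [intervalIntegral.integral_sub (hcont _ _) ((hcont _ _).const_mul _),
      intervalIntegral.integral_const_mul, If, Ig]
  have e2 : ∫ s in (0 : ℝ)..t, ⟪liftSource l b s f g, z⟫ =
      2 * σ * (∫ x in Ioo 0 l, Φ (t - endDist l b x) * (cutoffDeriv l b x * z x)) -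
        ∫ x in Ioo 0 l, Ψ (t - endDist l b x) * (cutoffDerivTwo l x * z x) := by
    simp only [liftSource, inner_sub_left, real_inner_smul_left, inner_mulCont_right]
    rw [intervalIntegral.integral_sub ((hcont _ _).const_mul _) (hcont _ _),
      intervalIntegral.integral_const_mul, If, Ig]
  have e3 : ⟪lift l b t g, z⟫ =
      ∫ x in Ioo 0 l, g (t - endDist l b x) * (cutoff l b x * z x) := by
    rw [lift, inner_mulCont]
    refine integral_congr_ae ?_
    filter_upwards [coeFn_travel (b := b) t g] with x hx
    rw [hx]
  -- the primitive in time of the spatial derivative of the lift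
  have hm := ((isPrimitiveOn_cutoffDeriv (b := b)).mul (hΨp.isPrimitiveOn t l b)).add
    (((isPrimitiveOn_cutoff (b := b)).mul (hg.isPrimitiveOn t l b)).const_mul (-σ))
  set m : ℝ → ℝ := fun x => cutoffDeriv l b x * Ψ (t - endDist l b x) +
    -σ * (cutoff l b x * Φ (t - endDist l b x)) with hmdef
  have hend : m (endPos l (!b)) = 0 := by
    simp only [hmdef, cutoff_endPos_not hl, cutoffDeriv_endPos_not hl]
    ring
  have hbd : m l * Z l - m 0 * Z 0 = 0 := by
    cases b
    · have h1 : m l = 0 := hend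
      have h2 : Z 0 = 0 := hZ0
      rw [h1, h2]; ring
    · have h1 : m 0 = 0 := hend
      have h2 : Z l = 0 := hZ0
      rw [h1, h2]; ring
  have hibp := (hm.mul hZ).integral_eq hl.le
  rw [hbd] at hibp
  -- integrability of the individual terms
  have hΨc := (hΨp.isPrimitiveOn t l b)
  have hΦp := (hg.isPrimitiveOn t l b)
  have hgi : IntegrableOn (fun x => g (t - endDist l b x)) (Ioo 0 l) := by
    refine IntegrableOn.congr_fun_ae (f := fun x => -σ * (-σ * g (t - endDist l b x)))
      (hΦp.1.const_mul _) (Eventually.of_forall fun x => ?_)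
    simp only
    linear_combination g (t - endDist l b x) * endSign_mul_self (b := b)
  have i1 : IntegrableOn (fun x => Ψ (t - endDist l b x) * (cutoffDeriv l b x * z' x))
      (Ioo 0 l) := by
    have := hΨc.integrableOn_mul ((isPrimitiveOn_cutoffDeriv (b := b)).integrableOn_mul hZ.1)
    exact this.congr_fun_ae (Eventually.of_forall fun x => by simp only; ring)
  have i2 : IntegrableOn (fun x => Φ (t - endDist l b x) * (cutoff l b x * z' x)) (Ioo 0 l) := by
    have := hΦp.integrableOn_mul ((isPrimitiveOn_cutoff (b := b)).integrableOn_mul hZ.1)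
    exact this.congr_fun_ae (Eventually.of_forall fun x => by simp only; ring)
  have i3 : IntegrableOn (fun x => Φ (t - endDist l b x) * (cutoffDeriv l b x * z x))
      (Ioo 0 l) := by
    have := hΦp.integrableOn_mul
      ((isPrimitiveOn_cutoffDeriv (b := b)).integrableOn_mul z.integrableOn)
    exact this.congr_fun_ae (Eventually.of_forall fun x => by simp only; ring)
  have i4 : IntegrableOn (fun x => Ψ (t - endDist l b x) * (cutoffDerivTwo l x * z x))
      (Ioo 0 l) := by
    have : IntegrableOn (fun x => 2 / l ^ 2 * (z x * Ψ (t - endDist l b x))) (Ioo 0 l) :=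
      (hΨc.integrableOn_mul z.integrableOn).const_mul (2 / l ^ 2)
    refine this.congr_fun_ae (Eventually.of_forall fun x => ?_)
    simp only [cutoffDerivTwo, ContinuousMap.const_apply]
    ring
  have i5 : IntegrableOn (fun x => g (t - endDist l b x) * (cutoff l b x * z x)) (Ioo 0 l) := by
    have := (hZ.mul (isPrimitiveOn_cutoff (b := b))).integrableOn_mul hgi
    refine this.congr_fun_ae ?_
    filter_upwards [hzZ] with x hx
    rw [hx]; ring
  rw [e1, e2, e3]
  have e4 : (0 : ℝ) = (∫ x in Ioo 0 l, Ψ (t - endDist l b x) * (cutoffDeriv l b x * z' x)) -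
      σ * (∫ x in Ioo 0 l, Φ (t - endDist l b x) * (cutoff l b x * z' x)) +
      ((∫ x in Ioo 0 l, Ψ (t - endDist l b x) * (cutoffDerivTwo l x * z x)) -
        2 * σ * (∫ x in Ioo 0 l, Φ (t - endDist l b x) * (cutoffDeriv l b x * z x)) +
        ∫ x in Ioo 0 l, g (t - endDist l b x) * (cutoff l b x * z x)) := by
    have j1 : IntegrableOn (fun x => Ψ (t - endDist l b x) * (cutoffDeriv l b x * z' x) -
        σ * (Φ (t - endDist l b x) * (cutoff l b x * z' x))) (Ioo 0 l) := i1.sub (i2.const_mul σ)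
    have j2 : IntegrableOn (fun x => Ψ (t - endDist l b x) * (cutoffDerivTwo l x * z x) -
        2 * σ * (Φ (t - endDist l b x) * (cutoffDeriv l b x * z x))) (Ioo 0 l) :=
      i4.sub (i3.const_mul (2 * σ))
    have j3 : IntegrableOn (fun x => Ψ (t - endDist l b x) * (cutoffDerivTwo l x * z x) -
        2 * σ * (Φ (t - endDist l b x) * (cutoffDeriv l b x * z x)) +
        g (t - endDist l b x) * (cutoff l b x * z x)) (Ioo 0 l) := j2.add i5
    refine hibp.symm.trans ?_
    rw [← integral_const_mul, ← integral_const_mul,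
      ← integral_sub i1 (i2.const_mul _), ← integral_sub i4 (i3.const_mul _),
      ← integral_add j2 i5, ← integral_add j1 j3]
    refine integral_congr_ae ?_
    filter_upwards [hzZ] with x hx
    rw [hx]
    simp only [hmdef]
    linear_combination (cutoff l b x * g (t - endDist l b x) * Z x) * endSign_mul_self (b := b)
  linarith

end Lift

/-! ### The lift of boundary data on a metric tree -/

namespace MetricTree

set_option linter.unusedSectionVars false

open Filter Topology
open scoped RealInnerProductSpace

variable {V E : Type*} [Fintype E] {Ω : MetricTree V E}

/-- The lift to the metric tree of boundary data `f` at the leaves (`f` being zero at the other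
vertices), as the sum of the lifts from the two ends of each edge. -/
def treeLift (Ω : MetricTree V E) (t : ℝ) (f : V → Lp ℝ 2 (volume : Measure ℝ)) : Ω.L2 :=
  WithLp.toLp 2 fun e => ∑ b, lift (Ω.len e) b t (f (Ω.endpt e b))

/-- The spatial derivative of `treeLift`, where `g` is the derivative of `f`. -/
def treeLiftDx (Ω : MetricTree V E) (t : ℝ) (f g : V → Lp ℝ 2 (volume : Measure ℝ)) : Ω.L2 :=
  WithLp.toLp 2 fun e => ∑ b, liftDx (Ω.len e) b t (f (Ω.endpt e b)) (g (Ω.endpt e b))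

/-- The image of `treeLift` under `∂ₜ² - ∂ₓ²`, where `g` is the derivative of `f`. -/
def treeLiftSource (Ω : MetricTree V E) (t : ℝ) (f g : V → Lp ℝ 2 (volume : Measure ℝ)) : Ω.L2 :=
  WithLp.toLp 2 fun e => ∑ b, liftSource (Ω.len e) b t (f (Ω.endpt e b)) (g (Ω.endpt e b))

lemma continuous_toLp_L2 {X : Type*} [TopologicalSpace X] {a : X → ∀ e, IntervalL2 (Ω.len e)}
    (h : ∀ e, Continuous fun t => a t e) : Continuous fun t => (WithLp.toLp 2 (a t) : Ω.L2) :=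
  (PiLp.continuous_toLp 2 _).comp (continuous_pi h)

lemma continuous_treeLift (f : V → Lp ℝ 2 (volume : Measure ℝ)) :
    Continuous fun t => Ω.treeLift t f :=
  continuous_toLp_L2 fun _ => continuous_finsetSum _ fun _ _ => continuous_lift _

lemma continuous_treeLiftDx (f g : V → Lp ℝ 2 (volume : Measure ℝ)) :
    Continuous fun t => Ω.treeLiftDx t f g :=
  continuous_toLp_L2 fun _ => continuous_finsetSum _ fun _ _ => continuous_liftDx _ _

lemma continuous_treeLiftSource (f g : V → Lp ℝ 2 (volume : Measure ℝ)) :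
    Continuous fun t => Ω.treeLiftSource t f g :=
  continuous_toLp_L2 fun _ => continuous_finsetSum _ fun _ _ => continuous_liftSource _ _

/-- A bound for the norms of `treeLift`, `treeLiftDx` and `treeLiftSource`. -/
def treeLiftBound (Ω : MetricTree V E) : ℝ := ∑ e, ∑ b, liftBound (Ω.len e) b

lemma treeLiftBound_nonneg : 0 ≤ Ω.treeLiftBound :=
  Finset.sum_nonneg fun _ _ => Finset.sum_nonneg fun _ _ => liftBound_nonneg

lemma norm_L2_le_sum (y : Ω.L2) : ‖y‖ ≤ ∑ e, ‖y e‖ := by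
  refine abs_le_of_sq_le_sq' ?_ (Finset.sum_nonneg fun _ _ => norm_nonneg _) |>.2
  rw [PiLp.norm_sq_eq_of_L2]
  exact Finset.sum_sq_le_sq_sum_of_nonneg fun _ _ => norm_nonneg _

lemma norm_toLp_sum_le {a : (e : E) → Bool → IntervalL2 (Ω.len e)} {D : ℝ}
    (h : ∀ e b, ‖a e b‖ ≤ liftBound (Ω.len e) b * D) :
    ‖(WithLp.toLp 2 (fun e => ∑ b, a e b) : Ω.L2)‖ ≤ Ω.treeLiftBound * D := by
  refine (norm_L2_le_sum _).trans ?_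
  rw [treeLiftBound, Finset.sum_mul]
  refine Finset.sum_le_sum fun e _ => ?_
  refine (norm_sum_le Finset.univ (a e)).trans ?_
  rw [Finset.sum_mul]
  exact Finset.sum_le_sum fun b _ => h e b

lemma inner_toLp_sum (a : (e : E) → Bool → IntervalL2 (Ω.len e)) (z : Ω.L2) :
    ⟪(WithLp.toLp 2 (fun e => ∑ b, a e b) : Ω.L2), z⟫ = ∑ e, ∑ b, ⟪a e b, z e⟫ := by
  rw [PiLp.inner_apply]
  exact Finset.sum_congr rfl fun e _ => sum_inner Finset.univ (a e) (z e)

lemma norm_treeLift_le [Fintype V] (t : ℝ) (f : V → Lp ℝ 2 (volume : Measure ℝ)) :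
    ‖Ω.treeLift t f‖ ≤ Ω.treeLiftBound * ∑ v, ‖f v‖ :=
  norm_toLp_sum_le fun e b => (norm_lift_le _ _).trans <|
    mul_le_mul_of_nonneg_left
      (Finset.single_le_sum (f := fun v => ‖f v‖) (fun _ _ => norm_nonneg _)
        (Finset.mem_univ (Ω.endpt e b))) liftBound_nonneg

lemma norm_treeLiftDx_le [Fintype V] (t : ℝ) (f g : V → Lp ℝ 2 (volume : Measure ℝ)) :
    ‖Ω.treeLiftDx t f g‖ ≤ Ω.treeLiftBound * ∑ v, (‖f v‖ + ‖g v‖) :=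
  norm_toLp_sum_le fun e b => (norm_liftDx_le _ _ _).trans <|
    mul_le_mul_of_nonneg_left
      (Finset.single_le_sum (f := fun v => ‖f v‖ + ‖g v‖) (fun _ _ => by positivity)
        (Finset.mem_univ (Ω.endpt e b))) liftBound_nonneg

lemma norm_treeLiftSource_le [Fintype V] (t : ℝ) (f g : V → Lp ℝ 2 (volume : Measure ℝ)) :
    ‖Ω.treeLiftSource t f g‖ ≤ Ω.treeLiftBound * ∑ v, (‖f v‖ + ‖g v‖) :=
  norm_toLp_sum_le fun e b => (norm_liftSource_le _ _ _).trans <|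
    mul_le_mul_of_nonneg_left
      (Finset.single_le_sum (f := fun v => ‖f v‖ + ‖g v‖) (fun _ _ => by positivity)
        (Finset.mem_univ (Ω.endpt e b))) liftBound_nonneg

variable {f g : V → Lp ℝ 2 (volume : Measure ℝ)} {Φ : V → ℝ → ℝ}

/-- The time derivative of the lift of `f` is the lift of `f'`. -/
lemma treeLift_eq_integral (hg : ∀ v, IsGlobalPrimitive (Φ v) (g v)) (hf : ∀ v, f v =ᵐ[volume] Φ v)
    (hΦ : ∀ v, ∀ x ≤ 0, Φ v x = 0) {t : ℝ} (ht : 0 ≤ t) :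
    Ω.treeLift t f = ∫ s in (0 : ℝ)..t, Ω.treeLift s g := by
  ext1 e
  have h1 := (PiLp.proj (𝕜 := ℝ) 2 (fun e : E => IntervalL2 (Ω.len e)) e).intervalIntegral_comp_comm
    ((continuous_treeLift (Ω := Ω) g).intervalIntegrable (μ := volume) 0 t)
  refine Eq.trans ?_ h1
  change ∑ b, lift (Ω.len e) b t (f (Ω.endpt e b)) =
    ∫ s in (0 : ℝ)..t, ∑ b, lift (Ω.len e) b s (g (Ω.endpt e b))
  rw [intervalIntegral.integral_finsetSum
    fun b _ => (continuous_lift (g (Ω.endpt e b))).intervalIntegrable 0 t]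
  exact Finset.sum_congr rfl fun b _ => lift_eq_integral (hg _) (hf _) (hΦ _) ht

/-- The continuous representative of the restriction of the lift to an edge. -/
lemma isPrimitiveOn_treeLift (hg : ∀ v, IsGlobalPrimitive (Φ v) (g v))
    (hf : ∀ v, f v =ᵐ[volume] Φ v) (t : ℝ) (e : E) :
    IsPrimitiveOn (Ω.len e) (fun x => cutoff (Ω.len e) true x *
        Φ (Ω.endpt e true) (t - endDist (Ω.len e) true x) + cutoff (Ω.len e) false x *
        Φ (Ω.endpt e false) (t - endDist (Ω.len e) false x)) (Ω.treeLiftDx t f g e) ∧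
      Ω.treeLift t f e =ᵐ[volume.restrict (Ioo 0 (Ω.len e))] fun x => cutoff (Ω.len e) true x *
        Φ (Ω.endpt e true) (t - endDist (Ω.len e) true x) + cutoff (Ω.len e) false x *
        Φ (Ω.endpt e false) (t - endDist (Ω.len e) false x) := by
  constructor
  · refine ((isPrimitiveOn_lift (hg _) (hf _) t).add
      (isPrimitiveOn_lift (hg _) (hf _) t)).congr ?_
    have h := Lp.coeFn_add
      (liftDx (Ω.len e) true t (f (Ω.endpt e true)) (g (Ω.endpt e true)))
      (liftDx (Ω.len e) false t (f (Ω.endpt e false)) (g (Ω.endpt e false)))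
    have h' : Ω.treeLiftDx t f g e =
        liftDx (Ω.len e) true t (f (Ω.endpt e true)) (g (Ω.endpt e true)) +
        liftDx (Ω.len e) false t (f (Ω.endpt e false)) (g (Ω.endpt e false)) :=
      Fintype.sum_bool _
    rw [h']
    filter_upwards [h] with x hx
    rw [hx]; rfl
  · have h := Lp.coeFn_add
      (lift (Ω.len e) true t (f (Ω.endpt e true))) (lift (Ω.len e) false t (f (Ω.endpt e false)))
    have h' : Ω.treeLift t f e =
        lift (Ω.len e) true t (f (Ω.endpt e true)) +
        lift (Ω.len e) false t (f (Ω.endpt e false)) := Fintype.sum_bool _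
    rw [h']
    filter_upwards [h, lift_ae_eq (b := true) (hf (Ω.endpt e true)) t,
      lift_ae_eq (b := false) (hf (Ω.endpt e false)) t] with x h1 h2 h3
    rw [h1, Pi.add_apply, h2, h3]

lemma edgeValue_treeLift (hg : ∀ v, IsGlobalPrimitive (Φ v) (g v))
    (hf : ∀ v, f v =ᵐ[volume] Φ v) (t : ℝ) (e : E) (b : Bool) :
    Ω.edgeValue e b (WithLp.toLp 2 (Ω.treeLift t f, Ω.treeLiftDx t f g)) =
      Φ (Ω.endpt e b) t := by
  obtain ⟨h1, h2⟩ := isPrimitiveOn_treeLift (Ω := Ω) hg hf t e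
  have hl := Ω.len_pos e
  rw [edgeValue_apply]
  refine (endValue_eq hl h1 h2 b).trans ?_
  cases b
  · have h3 : cutoff (Ω.len e) true (endPos (Ω.len e) false) = 0 :=
      cutoff_endPos_not (b := true) hl
    rw [h3, cutoff_endPos, endDist_endPos]
    ring_nf
  · have h3 : cutoff (Ω.len e) false (endPos (Ω.len e) true) = 0 :=
      cutoff_endPos_not (b := false) hl
    rw [h3, cutoff_endPos, endDist_endPos]
    ring_nf

lemma treeLift_mem_H1 (hg : ∀ v, IsGlobalPrimitive (Φ v) (g v))
    (hf : ∀ v, f v =ᵐ[volume] Φ v) (t : ℝ) :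
    WithLp.toLp 2 (Ω.treeLift t f, Ω.treeLiftDx t f g) ∈ Ω.H1 :=
  mem_H1_iff.2 ⟨fun e => (isWeakDeriv_iff_exists_isPrimitiveOn (Ω.len_pos e)).2
    ⟨_, isPrimitiveOn_treeLift hg hf t e⟩, fun v => Φ v t, edgeValue_treeLift hg hf t⟩

/-- The lift satisfies the wave equation with source `treeLiftSource` and the Kirchhoff-Neumann
condition, in the variational form, integrated once in time. -/
lemma treeLift_equation [Fintype V] (hg : ∀ v, IsGlobalPrimitive (Φ v) (g v))
    (hf : ∀ v, f v =ᵐ[volume] Φ v)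
    (hΦ : ∀ v, ∀ x ≤ 0, Φ v x = 0) (hΦc : ∀ v, Continuous (Φ v))
    (hsupp : ∀ v ∉ Ω.leaves, f v = 0 ∧ g v = 0) {t : ℝ} (ht : 0 ≤ t) {y : Ω.H1}
    (hy : VanishesOnLeaves y) :
    ⟪Ω.treeLift t g, toL2 y⟫ + ∫ s in (0 : ℝ)..t, ⟪Ω.treeLiftDx s f g, dx y⟫ =
      ∫ s in (0 : ℝ)..t, ⟪Ω.treeLiftSource s f g, toL2 y⟫ := by
  have key : ∀ e b, ⟪lift (Ω.len e) b t (g (Ω.endpt e b)), toL2 y e⟫ +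
      ∫ s in (0 : ℝ)..t, ⟪liftDx (Ω.len e) b s (f (Ω.endpt e b)) (g (Ω.endpt e b)), dx y e⟫ =
      ∫ s in (0 : ℝ)..t, ⟪liftSource (Ω.len e) b s (f (Ω.endpt e b)) (g (Ω.endpt e b)),
        toL2 y e⟫ := by
    intro e b
    by_cases hv : Ω.endpt e b ∈ Ω.leaves
    · obtain ⟨Z, hZ, hyZ⟩ :=
        (isWeakDeriv_iff_exists_isPrimitiveOn (Ω.len_pos e)).1 (isWeakDeriv_dx y e)
      refine lift_equation (Ω.len_pos e) (hg _) (hf _) (hΦ _) (hΦc _) ht hZ hyZ ?_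
      rw [← endValue_eq (Ω.len_pos e) hZ hyZ b]
      exact (trace_endpt y e b).symm.trans (hy _ hv)
    · rw [(hsupp _ hv).1, (hsupp _ hv).2]
      simp [lift, liftDx, liftSource]
  have hDx : ∀ e b, Continuous fun s =>
      ⟪liftDx (Ω.len e) b s (f (Ω.endpt e b)) (g (Ω.endpt e b)), dx y e⟫ :=
    fun e b => (continuous_liftDx _ _).inner continuous_const
  have hS : ∀ e b, Continuous fun s =>
      ⟪liftSource (Ω.len e) b s (f (Ω.endpt e b)) (g (Ω.endpt e b)), toL2 y e⟫ :=
    fun e b => (continuous_liftSource _ _).inner continuous_const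
  have e1 : ∀ s, ⟪Ω.treeLiftDx s f g, dx y⟫ =
      ∑ e, ∑ b, ⟪liftDx (Ω.len e) b s (f (Ω.endpt e b)) (g (Ω.endpt e b)), dx y e⟫ := fun s => inner_toLp_sum _ _
  have e2 : ∀ s, ⟪Ω.treeLiftSource s f g, toL2 y⟫ =
      ∑ e, ∑ b, ⟪liftSource (Ω.len e) b s (f (Ω.endpt e b)) (g (Ω.endpt e b)), toL2 y e⟫ := fun s => inner_toLp_sum _ _
  have e3 : ⟪Ω.treeLift t g, toL2 y⟫ =
      ∑ e, ∑ b, ⟪lift (Ω.len e) b t (g (Ω.endpt e b)), toL2 y e⟫ := inner_toLp_sum _ _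
  simp only [e1, e2, e3]
  rw [intervalIntegral.integral_finsetSum fun e _ =>
      (continuous_finsetSum _ fun b _ => hDx e b).intervalIntegrable 0 t,
    intervalIntegral.integral_finsetSum fun e _ =>
      (continuous_finsetSum _ fun b _ => hS e b).intervalIntegrable 0 t, ← Finset.sum_add_distrib]
  refine Finset.sum_congr rfl fun e _ => ?_
  rw [intervalIntegral.integral_finsetSum fun b _ => (hDx e b).intervalIntegrable 0 t,
    intervalIntegral.integral_finsetSum fun b _ => (hS e b).intervalIntegrable 0 t,
    ← Finset.sum_add_distrib]
  exact Finset.sum_congr rfl fun b _ => key e b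

end MetricTree

/-! ### Solutions of the equation integrated in time -/

namespace MetricTree

set_option linter.unusedSectionVars false

open Filter Topology
open scoped RealInnerProductSpace

variable {V E : Type*} [Fintype E] [Fintype V] {Ω : MetricTree V E}

/-- The form `(∂ₓy, ∂ₓφ) + (q y, φ)` of the variational equation, as a functional of `y`. -/
def energyL (q : Ω.LInfty) (φ : Ω.H1) : Ω.H1 →L[ℝ] ℝ :=
  (innerSL ℝ (dx φ)).comp Ω.dxL + ((innerSL ℝ (toL2 φ)).comp (potentialL q)).comp Ω.toL2L

lemma energyL_apply (q : Ω.LInfty) (φ y : Ω.H1) :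
    energyL q φ y = ⟪dx y, dx φ⟫ + ⟪potentialL q (toL2 y), toL2 φ⟫ :=
  congrArg₂ (· + ·) (real_inner_comm (dx y) (dx φ))
    (real_inner_comm (potentialL q (toL2 y)) (toL2 φ))

/-- The embedding of `H¹₀(Ω)` into `L²(Ω)`. -/
def H10.emb (Ω : MetricTree V E) : Ω.H10 →L[ℝ] Ω.L2 := Ω.toL2L.comp (H10.incl Ω)

lemma H10.emb_injective (y : Ω.H10) (h : H10.emb Ω y = 0) : y = 0 := by
  have h1 : H10.incl Ω y = 0 := toL2_injective h
  have h2 : (H10.incl Ω y).1 = (0 : Ω.H1).1 := by rw [h1]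
  exact Subtype.ext h2

lemma H10.emb_dense (z : Ω.L2) (h : ∀ φ, ⟪z, H10.emb Ω φ⟫ = 0) : z = 0 :=
  eq_zero_of_forall_inner fun y hy => h ⟨y.1, mem_H10_iff.2 hy⟩

/-- Relative to the inner product of `H¹(Ω)`, the form of the variational equation is perturbed by
the multiplication by `q - 1`. -/
lemma inner_H10_add (q : Ω.LInfty) (y φ : Ω.H10) :
    ⟪y, φ⟫ + ⟪(potentialL q - .id ℝ Ω.L2) (H10.emb Ω y), H10.emb Ω φ⟫ =
      energyL q (H10.incl Ω φ) (H10.incl Ω y) := by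
  have h1 : ⟪y, φ⟫ = ⟪toL2 (H10.incl Ω y), toL2 (H10.incl Ω φ)⟫ +
    ⟪dx (H10.incl Ω y), dx (H10.incl Ω φ)⟫ := rfl
  have h2 : (potentialL q - .id ℝ Ω.L2) (H10.emb Ω y) =
    potentialL q (toL2 (H10.incl Ω y)) - toL2 (H10.incl Ω y) := rfl
  have h3 : H10.emb Ω φ = toL2 (H10.incl Ω φ) := rfl
  rw [h1, h2, h3, energyL_apply, inner_sub_left]
  ring

/-- The initial-boundary value problem with the time derivative `p` of `u` as an additional
unknown, and with the equations for `∂ₜu` and `∂ₜp` integrated over `(0,t)`. -/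
structure IsMildSolution (T : ℝ) (q : Ω.LInfty) (F : ℝ → Ω.L2) (f : Ω.leaves → IntervalL2 T)
    (u : ℝ → Ω.H1) (p : ℝ → Ω.L2) : Prop where
  continuousOn : ContinuousOn u (Icc 0 T)
  continuousOn_dt : ContinuousOn p (Icc 0 T)
  toL2_eq : ∀ t ∈ Icc 0 T, toL2 (u t) = ∫ s in (0 : ℝ)..t, p s
  equation : ∀ t ∈ Icc 0 T, ∀ φ : Ω.H1, VanishesOnLeaves φ →
    ⟪p t, toL2 φ⟫ + ∫ s in (0 : ℝ)..t, energyL q φ (u s) = ∫ s in (0 : ℝ)..t, ⟪F s, toL2 φ⟫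
  boundary : ∀ v : Ω.leaves, ∀ᵐ t ∂(volume.restrict (Ioo (0 : ℝ) T)), trace (u t) v = f v t

variable {T : ℝ} {q : Ω.LInfty} {F : ℝ → Ω.L2} {f : Ω.leaves → IntervalL2 T}
  {u u' : ℝ → Ω.H1} {p p' : ℝ → Ω.L2}

lemma _root_.ContinuousOn.intervalIntegrable_of_mem_Icc {X : Type*} [NormedAddCommGroup X]
    {T : ℝ} {h : ℝ → X} (hh : ContinuousOn h (Icc 0 T)) {t : ℝ} (ht : t ∈ Icc 0 T) :
    IntervalIntegrable h volume 0 t :=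
  (hh.mono (Icc_subset_Icc_right ht.2)).intervalIntegrable_of_Icc ht.1

lemma IsMildSolution.unique (hT : 0 < T) (h : IsMildSolution T q F f u p)
    (h' : IsMildSolution T q F f u' p') : EqOn u u' (Icc 0 T) := by
  have hc : ContinuousOn (fun t => u t - u' t) (Icc 0 T) := h.continuousOn.sub h'.continuousOn
  -- the difference belongs to `H¹₀` at all times, by continuity
  have h0 : ∀ t ∈ Icc 0 T, VanishesOnLeaves (u t - u' t) := by
    intro t ht v hv
    have hcv : ContinuousOn (fun t => Ω.traceL ⟨v, hv⟩ (u t - u' t)) (Icc 0 T) :=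
      (Ω.traceL ⟨v, hv⟩).continuous.comp_continuousOn hc
    have h1 := eqOn_Icc_of_ae_eq hT hcv (continuousOn_const (c := (0 : ℝ))) (by
      filter_upwards [h.boundary ⟨v, hv⟩, h'.boundary ⟨v, hv⟩] with s h2 h3
      rw [map_sub, traceL_apply, traceL_apply, h2, h3, sub_self]) ht
    exact (traceL_apply ⟨v, hv⟩ _).symm.trans h1
  classical
  -- the inclusion of `H¹₀` into `H¹` is inverted, with a junk value elsewhere
  let P : Ω.H1 → Ω.H10 := fun y => if h : y.1 ∈ Ω.H10 then ⟨y.1, h⟩ else 0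
  have hP : ∀ t ∈ Icc 0 T, H10.incl Ω (P (u t - u' t)) = u t - u' t := fun t ht => by
    have h1 : P (u t - u' t) = ⟨(u t - u' t).1, mem_H10_iff.2 (h0 t ht)⟩ := dif_pos _
    rw [h1]
    rfl
  have hPc : ContinuousOn (fun t => P (u t - u' t)) (Icc 0 T) :=
    IsInducing.subtypeVal.continuousOn_iff.2 <|
      (continuous_subtype_val.comp_continuousOn hc).congr fun t ht => congrArg Subtype.val (hP t ht)
  have hpc : ContinuousOn (fun t => p t - p' t) (Icc 0 T) :=
    h.continuousOn_dt.sub h'.continuousOn_dt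
  have key := @abstract_wave_unique Ω.H10 Ω.L2 _ _ _ _ _ _ (H10.emb Ω) H10.emb_injective
    (fun y h => by exact H10.emb_dense y h) (potentialL q - .id ℝ Ω.L2) T _ _ hPc hpc ?_ ?_
  · intro t ht
    have h1 := hP t ht
    rw [key t ht, map_zero] at h1
    exact (sub_eq_zero.1 h1.symm)
  · intro t ht
    have h1 : H10.emb Ω (P (u t - u' t)) = toL2 (H10.incl Ω (P (u t - u' t))) := rfl
    have h2 : toL2 (u t - u' t) = toL2 (u t) - toL2 (u' t) := rfl
    rw [h1, hP t ht, h2, h.toL2_eq t ht, h'.toL2_eq t ht, intervalIntegral.integral_sub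
      (h.continuousOn_dt.intervalIntegrable_of_mem_Icc ht)
      (h'.continuousOn_dt.intervalIntegrable_of_mem_Icc ht)]
  · intro t ht φ
    refine (congrArg (⟪p t - p' t, H10.emb Ω φ⟫ + ·) (intervalIntegral.integral_congr fun s _ =>
      inner_H10_add q (P (u s - u' s)) φ)).trans ?_
    set ψ := H10.incl Ω φ with hψ
    have hint : ∀ {w : ℝ → Ω.H1}, ContinuousOn w (Icc 0 T) →
        IntervalIntegrable (fun s => energyL q ψ (w s)) volume 0 t := fun hw =>
      ((energyL q ψ).continuous.comp_continuousOn hw).intervalIntegrable_of_mem_Icc ht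
    have h1 : ∫ s in (0 : ℝ)..t, energyL q ψ (H10.incl Ω (P (u s - u' s))) =
        ∫ s in (0 : ℝ)..t, (energyL q ψ (u s) - energyL q ψ (u' s)) := by
      refine intervalIntegral.integral_congr fun s hs => ?_
      rw [uIcc_of_le ht.1] at hs
      rw [hP s ⟨hs.1, hs.2.trans ht.2⟩, map_sub]
    have h2 : H10.emb Ω φ = toL2 ψ := rfl
    rw [h1, h2, inner_sub_left,
      intervalIntegral.integral_sub (hint h.continuousOn) (hint h'.continuousOn)]
    linarith [h.equation t ht ψ (H10.vanishesOnLeaves_incl φ),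
      h'.equation t ht ψ (H10.vanishesOnLeaves_incl φ)]

/-- The solvability for boundary data of class `H¹`. -/
theorem exists_isMildSolution (Ω : MetricTree V E) (hT : 0 < T) (q : Ω.LInfty) :
    ∃ C, 0 ≤ C ∧ ∀ (F : ℝ → Ω.L2) (f g : Ω.leaves → IntervalL2 T),
      Integrable F (volume.restrict (Ioo 0 T)) → (∀ v, IsWeakDeriv (f v) (g v)) →
      (∀ v, VanishesNearEnds (f v)) → ∃ (u : ℝ → Ω.H1) (p : ℝ → Ω.L2),
        IsMildSolution T q F f u p ∧ ∀ t ∈ Icc 0 T,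
          ‖u t‖ ≤ C * ((∑ v, (‖f v‖ + ‖g v‖)) + ∫ s in Ioo 0 T, ‖F s‖) ∧
          ‖p t‖ ≤ C * ((∑ v, (‖f v‖ + ‖g v‖)) + ∫ s in Ioo 0 T, ‖F s‖) := by
  classical
  obtain ⟨C, hC, hex⟩ := @exists_abstract_wave Ω.H10 Ω.L2 _ _ _ _ _ _ (H10.emb Ω) H10.emb_injective
    (fun y h => by exact H10.emb_dense y h) (potentialL q - .id ℝ Ω.L2) T hT.le
  set B := Ω.treeLiftBound with hBdef
  have hB : 0 ≤ B := treeLiftBound_nonneg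
  refine ⟨2 * B + C * (1 + T * (B + ‖potentialL q‖ * B)), by positivity,
    fun F f g hF hfg hf0 => ?_⟩
  have hdata := fun v => exists_global_data hT (hfg v) (hf0 v)
  choose fR gR Φ₀ hnf hng hΦg₀ hΦf₀ hΦ0₀ hΦc₀ hfΦ using hdata
  -- extension of the data by zero to the interior vertices
  let f' : V → Lp ℝ 2 (volume : Measure ℝ) := fun v =>
    if h : v ∈ Ω.leaves then fR ⟨v, h⟩ else 0
  let g' : V → Lp ℝ 2 (volume : Measure ℝ) := fun v =>
    if h : v ∈ Ω.leaves then gR ⟨v, h⟩ else 0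
  let Φ : V → ℝ → ℝ := fun v => if h : v ∈ Ω.leaves then Φ₀ ⟨v, h⟩ else 0
  have hall : ∀ v, IsGlobalPrimitive (Φ v) (g' v) ∧ f' v =ᵐ[volume] Φ v ∧
      (∀ x ≤ 0, Φ v x = 0) ∧ Continuous (Φ v) := by
    intro v
    by_cases h : v ∈ Ω.leaves
    · simp only [Φ, f', g', dif_pos h]
      exact ⟨hΦg₀ _, hΦf₀ _, hΦ0₀ _, hΦc₀ _⟩
    · simp only [Φ, f', g', dif_neg h]
      refine ⟨⟨Lp.intervalIntegrable 0, fun a b => ?_⟩, Lp.coeFn_zero _ _ _, fun _ _ => rfl,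
        continuous_const⟩
      rw [Pi.zero_apply, Pi.zero_apply, sub_zero]
      refine intervalIntegral.integral_zero_ae ?_
      filter_upwards [Lp.coeFn_zero ℝ 2 (volume : Measure ℝ)] with x hx _ using hx
  have hg' := fun v => (hall v).1
  have hf' := fun v => (hall v).2.1
  have hΦ0 := fun v => (hall v).2.2.1
  have hΦc := fun v => (hall v).2.2.2
  have hsupp : ∀ v ∉ Ω.leaves, f' v = 0 ∧ g' v = 0 := fun v h => ⟨dif_neg h, dif_neg h⟩
  set D := ∑ v, (‖f v‖ + ‖g v‖) with hD
  have hD0 : 0 ≤ D := Finset.sum_nonneg fun _ _ => by positivity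
  have hsum : ∑ v, (‖f' v‖ + ‖g' v‖) = D := by
    rw [← Finset.sum_subset (Finset.subset_univ Ω.leaves), ← Finset.sum_coe_sort]
    · refine Finset.sum_congr rfl fun v _ => ?_
      simp only [f', g', dif_pos v.2, hnf, hng]
    · intro v _ hv
      rw [(hsupp v hv).1, (hsupp v hv).2, norm_zero, add_zero]
  have hsumf : ∑ v, ‖f' v‖ ≤ D := hsum ▸ Finset.sum_le_sum fun v _ => by simp
  have hsumg : ∑ v, ‖g' v‖ ≤ D := hsum ▸ Finset.sum_le_sum fun v _ => by simp
  have bL : ∀ t, ‖Ω.treeLift t f'‖ ≤ B * D := fun t => (norm_treeLift_le t f').trans (by gcongr)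
  have bLg : ∀ t, ‖Ω.treeLift t g'‖ ≤ B * D := fun t => (norm_treeLift_le t g').trans (by gcongr)
  have bDx : ∀ t, ‖Ω.treeLiftDx t f' g'‖ ≤ B * D := fun t =>
    (norm_treeLiftDx_le t f' g').trans_eq (by rw [hsum])
  have bS : ∀ t, ‖Ω.treeLiftSource t f' g'‖ ≤ B * D := fun t =>
    (norm_treeLiftSource_le t f' g').trans_eq (by rw [hsum])
  -- the solution is the sum of the lift `L` and a function `w` with values in `H¹₀`; the source for
  -- `w` is `F - R`
  let L : ℝ → Ω.H1 := fun t =>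
    ⟨WithLp.toLp 2 (Ω.treeLift t f', Ω.treeLiftDx t f' g'), treeLift_mem_H1 hg' hf' t⟩
  have hLc : Continuous L := by
    refine Continuous.subtype_mk ?_ _
    exact (WithLp.prod_continuous_toLp 2 Ω.L2 Ω.L2).comp
      ((continuous_treeLift f').prodMk (continuous_treeLiftDx f' g'))
  have hqc : Continuous fun t => potentialL q (Ω.treeLift t f') :=
    (potentialL q).continuous.comp (continuous_treeLift f')
  let R : ℝ → Ω.L2 := fun t => Ω.treeLiftSource t f' g' + potentialL q (Ω.treeLift t f')
  have hRc : Continuous R := (continuous_treeLiftSource f' g').add hqc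
  have hRint : Integrable R (volume.restrict (Ioo 0 T)) :=
    (hRc.continuousOn.integrableOn_Icc (a := 0) (b := T)).mono_set Ioo_subset_Icc_self
  obtain ⟨w, p, hwc, hpc, hw, hwe, hwb⟩ := hex (fun t => F t - R t) (hF.sub hRint)
  have hFint : ∀ t ∈ Icc 0 T, ∀ y : Ω.L2, IntervalIntegrable (fun s => ⟪F s, y⟫) volume 0 t := by
    intro t ht y
    have h : IntegrableOn (fun s => ⟪F s, y⟫) (Ioo 0 T) := hF.inner_const y
    exact intervalIntegrable_of_integrableOn_Ioo h ht
  have hbound : ∫ s in Ioo 0 T, ‖F s - R s‖ ≤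
      (∫ s in Ioo 0 T, ‖F s‖) + T * ((B + ‖potentialL q‖ * B) * D) := by
    have hRb : ∀ s, ‖R s‖ ≤ (B + ‖potentialL q‖ * B) * D := fun s => by
      have h1 := (potentialL q).le_opNorm (Ω.treeLift s f')
      have h2 : ‖potentialL q‖ * ‖Ω.treeLift s f'‖ ≤ ‖potentialL q‖ * (B * D) := by
        gcongr
        exact bL s
      calc ‖R s‖ ≤ _ := norm_add_le _ _
        _ ≤ _ := by linarith [bS s]
    calc ∫ s in Ioo 0 T, ‖F s - R s‖
        ≤ ∫ s in Ioo 0 T, (‖F s‖ + (B + ‖potentialL q‖ * B) * D) := by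
          refine integral_mono (hF.sub hRint).norm (hF.norm.add (integrable_const _)) fun s => ?_
          exact (norm_sub_le _ _).trans (by linarith [hRb s])
      _ = _ := by
          rw [integral_add hF.norm (integrable_const _), integral_const]
          simp [hT.le]
  have hF0 : 0 ≤ ∫ s in Ioo 0 T, ‖F s‖ := integral_nonneg fun _ => norm_nonneg _
  set I := ∫ s in Ioo 0 T, ‖F s‖ with hI
  have hfin : ∀ a x : ℝ, a ≤ 2 * (B * D) → x ≤ C * ∫ s in Ioo 0 T, ‖F s - R s‖ →
      a + x ≤ (2 * B + C * (1 + T * (B + ‖potentialL q‖ * B))) * (D + I) := by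
    intro a x ha hx
    have h1 : C * ∫ s in Ioo 0 T, ‖F s - R s‖ ≤ C * (I + T * ((B + ‖potentialL q‖ * B) * D)) := by
      gcongr
    have h2 : 0 ≤ 2 * B * I + C * (D + T * (B + ‖potentialL q‖ * B) * I) := by positivity
    linarith
  refine ⟨fun t => L t + H10.incl Ω (w t), fun t => Ω.treeLift t g' + p t, ⟨?_, ?_, ?_, ?_, ?_⟩, ?_⟩
  · exact (hLc.add ((H10.incl Ω).continuous.comp hwc)).continuousOn
  · exact ((continuous_treeLift g').add hpc).continuousOn
  · intro t ht
    have h1 : toL2 (L t + H10.incl Ω (w t)) = Ω.treeLift t f' + H10.emb Ω (w t) := rfl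
    rw [h1, hw t ht, treeLift_eq_integral hg' hf' hΦ0 ht.1, intervalIntegral.integral_add
      ((continuous_treeLift g').intervalIntegrable _ _) (hpc.intervalIntegrable _ _)]
  · intro t ht φ hφ
    have h1 := treeLift_equation hg' hf' hΦ0 hΦc hsupp ht.1 hφ
    have h2 := hwe t ht ⟨φ.1, mem_H10_iff.2 hφ⟩
    simp only [inner_H10_add] at h2
    have h3 : H10.emb Ω ⟨φ.1, mem_H10_iff.2 hφ⟩ = toL2 φ := rfl
    have h3' : H10.incl Ω ⟨φ.1, mem_H10_iff.2 hφ⟩ = φ := rfl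
    have hcDx : Continuous fun s => ⟪Ω.treeLiftDx s f' g', dx φ⟫ :=
      (continuous_treeLiftDx f' g').inner continuous_const
    have hcq : Continuous fun s => ⟪potentialL q (Ω.treeLift s f'), toL2 φ⟫ :=
      hqc.inner continuous_const
    have hcS : Continuous fun s => ⟪Ω.treeLiftSource s f' g', toL2 φ⟫ :=
      (continuous_treeLiftSource f' g').inner continuous_const
    have hcR : Continuous fun s => ⟪R s, toL2 φ⟫ := hRc.inner continuous_const
    have hcw : Continuous fun s => energyL q φ (H10.incl Ω (w s)) :=
      (energyL q φ).continuous.comp ((H10.incl Ω).continuous.comp hwc)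
    have hcL : Continuous fun s => energyL q φ (L s) := (energyL q φ).continuous.comp hLc
    have h4 : ∫ s in (0 : ℝ)..t, energyL q φ (L s + H10.incl Ω (w s)) =
        (∫ s in (0 : ℝ)..t, energyL q φ (L s)) + ∫ s in (0 : ℝ)..t, energyL q φ (H10.incl Ω (w s)) := by
      simp only [map_add]
      exact intervalIntegral.integral_add (hcL.intervalIntegrable _ _)
        (hcw.intervalIntegrable _ _)
    have h5 : ∫ s in (0 : ℝ)..t, energyL q φ (L s) =
        (∫ s in (0 : ℝ)..t, ⟪Ω.treeLiftDx s f' g', dx φ⟫) +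
          ∫ s in (0 : ℝ)..t, ⟪potentialL q (Ω.treeLift s f'), toL2 φ⟫ := by
      simp only [energyL_apply]
      exact intervalIntegral.integral_add (hcDx.intervalIntegrable _ _)
        (hcq.intervalIntegrable _ _)
    have h6 : ∫ s in (0 : ℝ)..t, ⟪F s - R s, toL2 φ⟫ =
        (∫ s in (0 : ℝ)..t, ⟪F s, toL2 φ⟫) - ∫ s in (0 : ℝ)..t, ⟪R s, toL2 φ⟫ := by
      simp only [inner_sub_left]
      exact intervalIntegral.integral_sub (hFint t ht _) (hcR.intervalIntegrable _ _)
    have h7 : ∫ s in (0 : ℝ)..t, ⟪R s, toL2 φ⟫ =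
        (∫ s in (0 : ℝ)..t, ⟪Ω.treeLiftSource s f' g', toL2 φ⟫) +
          ∫ s in (0 : ℝ)..t, ⟪potentialL q (Ω.treeLift s f'), toL2 φ⟫ := by
      simp only [R, inner_add_left]
      exact intervalIntegral.integral_add (hcS.intervalIntegrable _ _)
        (hcq.intervalIntegrable _ _)
    rw [h3, h3'] at h2
    rw [h4, h5, inner_add_left]
    linarith
  · intro v
    filter_upwards [hfΦ v] with t ht
    obtain ⟨e, b, hv⟩ := exists_endpt_of_mem_leaves v.2
    have h1 : Ω.traceL v (H10.incl Ω (w t)) = 0 := by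
      rw [traceL_apply]
      exact H10.vanishesOnLeaves_incl (w t) v v.2
    have h2 : Ω.traceL v (L t) = Φ v t := by
      rw [traceL_apply, ← hv, trace_endpt]
      exact edgeValue_treeLift hg' hf' t e b
    have h3 : Φ v = Φ₀ v := dif_pos v.2
    rw [← traceL_apply, map_add, h1, h2, h3, add_zero, ht]
  · intro t ht
    obtain ⟨h1, h2⟩ := hwb t ht
    constructor
    · refine (norm_add_le _ _).trans (hfin _ _ ((norm_H1_le (L t)).trans ?_) h1)
      have h3 : toL2 (L t) = Ω.treeLift t f' := rfl
      have h4 : dx (L t) = Ω.treeLiftDx t f' g' := rfl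
      rw [h3, h4]
      linarith [bL t, bDx t]
    · refine (norm_add_le _ _).trans (hfin _ _ ?_ h2)
      have := mul_nonneg hB hD0
      linarith [bLg t]

end MetricTree

/-! ### Curves and their derivatives -/

section Curves

open Filter Topology

variable {X : Type*} [NormedAddCommGroup X] [NormedSpace ℝ X] {T : ℝ}

lemma hasDerivWithinAt_integral_Icc [CompleteSpace X] {p : ℝ → X} (hp : ContinuousOn p (Icc 0 T))
    {t : ℝ} (ht : t ∈ Icc 0 T) :
    HasDerivWithinAt (fun r => ∫ s in (0 : ℝ)..r, p s) (p t) (Icc 0 T) t := by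
  have hT : 0 ≤ T := ht.1.trans ht.2
  let p' : ℝ → X := IccExtend hT ((Icc 0 T).domRestrict p)
  have hp' : ∀ s ∈ Icc 0 T, p' s = p s := fun s hs => IccExtend_of_mem hT _ hs
  have hc : Continuous p' := hp.domRestrict.comp continuous_projIcc
  have h1 := (hasDerivAt_integral_of_continuous hc t).hasDerivWithinAt (s := Icc 0 T)
  rw [hp' t ht] at h1
  have h2 : ∀ r ∈ Icc 0 T, ∫ s in (0 : ℝ)..r, p s = ∫ s in (0 : ℝ)..r, p' s := fun r hr =>
    intervalIntegral.integral_congr fun s hs => by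
      rw [uIcc_of_le hr.1] at hs
      exact (hp' s ⟨hs.1, hs.2.trans hr.2⟩).symm
  exact h1.congr h2 (h2 t ht)

/-- The fundamental theorem of calculus for a curve of class `C¹` on `[0,T]`. -/
lemma ContDiffOn.eq_add_integral_derivWithin [CompleteSpace X] {h : ℝ → X} (hT : 0 < T)
    (hh : ContDiffOn ℝ 1 h (Icc 0 T)) {t : ℝ} (ht : t ∈ Icc 0 T) :
    h t = h 0 + ∫ s in (0 : ℝ)..t, derivWithin h (Icc 0 T) s := by
  obtain ⟨h1, h2⟩ := (contDiffOn_one_iff_derivWithin (uniqueDiffOn_Icc hT)).1 hh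
  have hsub : Icc 0 t ⊆ Icc 0 T := Icc_subset_Icc_right ht.2
  rw [intervalIntegral.integral_eq_sub_of_hasDerivAt_of_le ht.1 (hh.continuousOn.mono hsub)
    (fun x hx => ?_) ((h2.mono hsub).intervalIntegrable_of_Icc ht.1), add_sub_cancel]
  have hx' : Icc 0 T ∈ 𝓝 x := Icc_mem_nhds hx.1 (hx.2.trans_le ht.2)
  exact ((h1 x (mem_of_mem_nhds hx')).hasDerivWithinAt).hasDerivAt hx'

/-- The support of the weak derivative is contained in the support of the function. -/
lemma VanishesNearEnds.of_isWeakDeriv {f g : IntervalL2 T} (hf : VanishesNearEnds f)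
    (hfg : IsWeakDeriv f g) : VanishesNearEnds g := by
  obtain ⟨δ, hδ, h⟩ := hf
  rw [ae_restrict_iff' measurableSet_Ioo] at h
  refine ⟨δ, hδ, ?_⟩
  rw [ae_restrict_iff' measurableSet_Ioo]
  have hU : IsOpen (Ioo 0 T ∩ {t | t < δ ∨ T - δ < t}) :=
    isOpen_Ioo.inter (isOpen_Iio.union isOpen_Ioi)
  have h1 : ∀ᵐ x, x ∈ Ioo 0 T ∩ {t | t < δ ∨ T - δ < t} → g x = 0 := by
    refine hU.ae_eq_zero_of_integral_contDiff_smul_eq_zero (μ := volume)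
      (g.integrableOn.mono_set inter_subset_left).locallyIntegrableOn fun φ h1 h2 h3 => ?_
    have hφ : IsTestFunction T φ := ⟨h1, h2, h3.trans inter_subset_left⟩
    have h4 : ∫ x in Ioo 0 T, f x * deriv φ x = 0 := by
      refine integral_eq_zero_of_ae ?_
      rw [EventuallyEq, ae_restrict_iff' measurableSet_Ioo]
      filter_upwards [h] with x hx hxT
      by_cases hxφ : x ∈ tsupport φ
      · rw [hx hxT (h3 hxφ).2, zero_mul, Pi.zero_apply]
      · have h5 : deriv φ x = 0 := by
          by_contra h6
          exact hxφ (support_deriv_subset h6)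
        rw [h5, mul_zero, Pi.zero_apply]
    rw [hfg φ hφ, neg_eq_zero] at h4
    refine Eq.trans ?_ h4
    rw [← setIntegral_eq_integral_of_forall_compl_eq_zero (s := Ioo 0 T)]
    · exact integral_congr_ae (Eventually.of_forall fun x => mul_comm _ _)
    · intro x hx
      rw [image_eq_zero_of_notMem_tsupport fun h => hx (hφ.2.2 h), zero_smul]
  filter_upwards [h1] with x hx hxT hxδ using hx ⟨hxT, hxδ⟩

/-- A function that vanishes near `0` is the integral of its weak derivative. -/
lemma VanishesNearEnds.ae_eq_integral (hT : 0 < T) {f g : IntervalL2 T} (hf : VanishesNearEnds f)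
    (hfg : IsWeakDeriv f g) :
    f =ᵐ[volume.restrict (Ioo 0 T)] fun t => ∫ s in (0 : ℝ)..t, g s := by
  obtain ⟨Y, hY, hfY⟩ := (isWeakDeriv_iff_exists_isPrimitiveOn hT).1 hfg
  obtain ⟨δ, hδ, h⟩ := hf
  have hm : 0 < min δ T := lt_min hδ hT
  have hsub : Ioo 0 (min δ T) ⊆ Ioo 0 T := Ioo_subset_Ioo_right (min_le_right _ _)
  have h0 : Y 0 = 0 := by
    refine eqOn_Icc_of_ae_eq hm (Z := fun _ => 0) (hY.mono (min_le_right _ _)).continuousOn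
      continuousOn_const ?_ ⟨le_rfl, hm.le⟩
    filter_upwards [ae_restrict_of_ae_restrict_of_subset hsub h,
      ae_restrict_of_ae_restrict_of_subset hsub hfY, ae_restrict_mem measurableSet_Ioo]
      with x h1 h2 hx
    rw [← h2, h1 (Or.inl (hx.2.trans_le (min_le_left _ _)))]
  filter_upwards [hfY, ae_restrict_mem measurableSet_Ioo] with x h1 hx
  rw [h1, hY.2 x (Ioo_subset_Icc_self hx), h0, zero_add]

lemma IsTestFunction.integral_sub_mul {ψ a b : ℝ → ℝ} (hψ : IsTestFunction T ψ)
    (ha : IntegrableOn a (Ioo 0 T)) (hb : IntegrableOn b (Ioo 0 T)) :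
    ∫ t in Ioo 0 T, (a t - b t) * ψ t =
      (∫ t in Ioo 0 T, ψ t * a t) - ∫ t in Ioo 0 T, ψ t * b t := by
  simp only [mul_comm (ψ _)]
  have h : ∀ {k : ℝ → ℝ}, IntegrableOn k (Ioo 0 T) →
      IntegrableOn (fun t => k t * ψ t) (Ioo 0 T) := fun hk => by
    simpa only [mul_comm] using hψ.integrableOn_mul hk
  rw [← integral_sub (h ha) (h hb)]
  simp only [sub_mul]

end Curves

/-! ### Weak solutions and their regularity -/

namespace MetricTree

set_option linter.unusedSectionVars false

open Filter Topology
open scoped RealInnerProductSpace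

variable {V E : Type*} [Fintype E] [Fintype V] {Ω : MetricTree V E}
  {T : ℝ} {q : Ω.LInfty} {f : Ω.leaves → IntervalL2 T} {u : ℝ → Ω.H1} {p : ℝ → Ω.L2}

lemma energyL_eq_potentialForm (q : Ω.LInfty) (φ y : Ω.H1) :
    energyL q φ y = ⟪dx y, dx φ⟫ + potentialForm q (toL2 y) (toL2 φ) := by
  rw [energyL_apply, potentialForm_eq]

namespace IsMildSolution

section

variable {F : ℝ → Ω.L2}

lemma hasDerivWithinAt (h : IsMildSolution T q F f u p) {t : ℝ} (ht : t ∈ Icc 0 T) :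
    HasDerivWithinAt (fun s => toL2 (u s)) (p t) (Icc 0 T) t :=
  (hasDerivWithinAt_integral_Icc h.continuousOn_dt ht).congr h.toL2_eq (h.toL2_eq t ht)

lemma dt_eq (hT : 0 < T) (h : IsMildSolution T q F f u p) {t : ℝ} (ht : t ∈ Icc 0 T) :
    dt T u t = p t :=
  (h.hasDerivWithinAt ht).derivWithin (uniqueDiffOn_Icc hT t ht)

lemma congr_source {G : ℝ → Ω.L2} (h : IsMildSolution T q F f u p)
    (hFG : F =ᵐ[volume.restrict (Ioo 0 T)] G) : IsMildSolution T q G f u p where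
  continuousOn := h.continuousOn
  continuousOn_dt := h.continuousOn_dt
  toL2_eq := h.toL2_eq
  equation t ht φ hφ := by
    rw [h.equation t ht φ hφ, ← setIntegral_Ioo_eq_intervalIntegral ht.1,
      ← setIntegral_Ioo_eq_intervalIntegral ht.1]
    refine integral_congr_ae ?_
    filter_upwards [ae_restrict_of_ae_restrict_of_subset (Ioo_subset_Ioo_right ht.2) hFG]
      with s hs
    rw [hs]
  boundary := h.boundary

lemma initial (hT : 0 ≤ T) (h : IsMildSolution T q F f u p) : u 0 = 0 :=
  toL2_injective (by rw [h.toL2_eq 0 ⟨le_rfl, hT⟩, intervalIntegral.integral_same])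

lemma initial_dt (hT : 0 ≤ T) (h : IsMildSolution T q F f u p) : p 0 = 0 :=
  eq_zero_of_forall_inner fun φ hφ => by
    simpa only [intervalIntegral.integral_same, add_zero] using h.equation 0 ⟨le_rfl, hT⟩ φ hφ

end

variable {F : Lp Ω.L2 1 (volume.restrict (Ioo (0 : ℝ) T))}

/-- A solution of the equation integrated in time is a solution in the sense of distributions. -/
lemma isSolution (hT : 0 < T) (h : IsMildSolution T q F f u p) : IsSolution T q F f u where
  memE1 := by
    refine ⟨h.continuousOn, (contDiffOn_one_iff_derivWithin (uniqueDiffOn_Icc hT)).2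
      ⟨fun t ht => (h.hasDerivWithinAt ht).differentiableWithinAt, ?_⟩⟩
    exact h.continuousOn_dt.congr fun t ht => h.dt_eq hT ht
  equation := by
    intro φ hφ ψ hψ
    have hF : IntegrableOn (fun t => ⟪F t, toL2 φ⟫) (Ioo 0 T) :=
      (L1.integrable_coeFn F).inner_const (toL2 φ)
    have hu : ContinuousOn (fun t => energyL q φ (u t)) (Icc 0 T) :=
      (energyL q φ).continuous.comp_continuousOn h.continuousOn
    have hu' : IntegrableOn (fun t => energyL q φ (u t)) (Ioo 0 T) :=
      hu.integrableOn_Icc.mono_set Ioo_subset_Icc_self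
    have hp : IsPrimitiveOn T (fun t => ⟪p t, toL2 φ⟫)
        (fun t => ⟪F t, toL2 φ⟫ - energyL q φ (u t)) := by
      refine ⟨hF.sub hu', fun t ht => ?_⟩
      simp only
      rw [h.initial_dt hT.le, inner_zero_left, zero_add, intervalIntegral.integral_sub
        (intervalIntegrable_of_integrableOn_Ioo hF ht) (hu.intervalIntegrable_of_mem_Icc ht)]
      linarith [h.equation t ht φ hφ]
    have h1 := hp.integral_mul_deriv hψ
    have h2 : ∫ t in Ioo 0 T, deriv ψ t * ⟪dt T u t, toL2 φ⟫ =
        ∫ t in Ioo 0 T, ⟪p t, toL2 φ⟫ * deriv ψ t :=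
      setIntegral_congr_fun measurableSet_Ioo fun t ht => by
        rw [h.dt_eq hT (Ioo_subset_Icc_self ht), mul_comm]
    have h3 : ∫ t in Ioo 0 T, (⟪F t, toL2 φ⟫ - energyL q φ (u t)) * ψ t =
        (∫ t in Ioo 0 T, ψ t * ⟪F t, toL2 φ⟫) - ∫ t in Ioo 0 T, ψ t * energyL q φ (u t) :=
      hψ.integral_sub_mul hF hu'
    simp only [← energyL_eq_potentialForm]
    linarith
  boundary := h.boundary
  initial := h.initial hT.le
  initial_dt := by rw [h.dt_eq hT ⟨le_rfl, hT.le⟩, h.initial_dt hT.le]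

end IsMildSolution

/-- A solution in the sense of distributions solves the equation integrated in time, by the
du Bois-Reymond lemma. -/
lemma IsSolution.isMildSolution {F : Lp Ω.L2 1 (volume.restrict (Ioo (0 : ℝ) T))} (hT : 0 < T)
    (h : IsSolution T q F f u) : IsMildSolution T q F f u (dt T u) where
  continuousOn := h.memE1.1
  continuousOn_dt := h.memE1.2.continuousOn_derivWithin (uniqueDiffOn_Icc hT) le_rfl
  toL2_eq t ht := by
    have h1 : toL2 (u 0) = 0 := by rw [h.initial]; rfl
    exact (h.memE1.2.eq_add_integral_derivWithin hT ht).trans (by rw [h1, zero_add]; rfl)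
  equation := by
    intro t ht φ hφ
    have hdt : ContinuousOn (fun t => ⟪dt T u t, toL2 φ⟫) (Icc 0 T) :=
      (h.memE1.2.continuousOn_derivWithin (uniqueDiffOn_Icc hT) le_rfl).inner continuousOn_const
    have hF : IntegrableOn (fun t => ⟪F t, toL2 φ⟫) (Ioo 0 T) :=
      (L1.integrable_coeFn F).inner_const (toL2 φ)
    have hu : ContinuousOn (fun t => energyL q φ (u t)) (Icc 0 T) :=
      (energyL q φ).continuous.comp_continuousOn h.memE1.1
    have hu' : IntegrableOn (fun t => energyL q φ (u t)) (Ioo 0 T) :=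
      hu.integrableOn_Icc.mono_set Ioo_subset_Icc_self
    obtain ⟨Y, hY, hYe⟩ := exists_isPrimitiveOn_of_weak hT (b := fun t =>
        ⟪F t, toL2 φ⟫ - energyL q φ (u t))
      (hdt.integrableOn_Icc.mono_set Ioo_subset_Icc_self) (hF.sub hu') (by
        intro ψ hψ
        have h1 := h.equation φ hφ ψ hψ
        simp only [← energyL_eq_potentialForm] at h1
        simp only [mul_comm (deriv ψ _)] at h1
        rw [hψ.integral_sub_mul hF hu']
        linarith)
    have hE := eqOn_Icc_of_ae_eq hT hdt hY.continuousOn hYe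
    have h0 : Y 0 = 0 := by
      rw [← hE ⟨le_rfl, hT.le⟩]
      simp only
      rw [h.initial_dt, inner_zero_left]
    have h1 : ⟪dt T u t, toL2 φ⟫ = Y t := hE ht
    have h2 : ∫ s in (0 : ℝ)..t, (⟪F s, toL2 φ⟫ - energyL q φ (u s)) =
        (∫ s in (0 : ℝ)..t, ⟪F s, toL2 φ⟫) - ∫ s in (0 : ℝ)..t, energyL q φ (u s) :=
      intervalIntegral.integral_sub (intervalIntegrable_of_integrableOn_Ioo hF ht)
        (hu.intervalIntegrable_of_mem_Icc ht)
    have h3 := hY.2 t ht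
    rw [h0, zero_add] at h3
    rw [h1]
    linarith
  boundary := h.boundary

section Regularity

variable {F G : ℝ → Ω.L2} {g : Ω.leaves → IntervalL2 T} {v : ℝ → Ω.H1}

/-- If `v` solves the problem with the differentiated data, then the primitive of `v` in time solves
the original problem, and the equation holds at every time. -/
lemma IsMildSolution.integral (hT : 0 < T) (hG : ContDiffOn ℝ 1 G (Icc 0 T)) (hG0 : G 0 = 0)
    (hf : ∀ v, VanishesNearEnds (f v)) (hfg : ∀ v, IsWeakDeriv (f v) (g v))
    (h : IsMildSolution T q (derivWithin G (Icc 0 T)) g v p) :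
    IsMildSolution T q G f (fun t => ∫ s in (0 : ℝ)..t, v s) (fun t => toL2 (v t)) ∧
      ∀ t ∈ Icc 0 T, ∀ φ : Ω.H1, VanishesOnLeaves φ →
        ⟪p t, toL2 φ⟫ + energyL q φ (∫ s in (0 : ℝ)..t, v s) = ⟪G t, toL2 φ⟫ := by
  have hG' : ContinuousOn (derivWithin G (Icc 0 T)) (Icc 0 T) :=
    hG.continuousOn_derivWithin (uniqueDiffOn_Icc hT) le_rfl
  have hvi : ∀ t ∈ Icc 0 T, IntervalIntegrable v volume 0 t := fun t ht =>
    h.continuousOn.intervalIntegrable_of_mem_Icc ht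
  have hcomm : ∀ (A : Ω.H1 →L[ℝ] ℝ), ∀ t ∈ Icc 0 T,
      A (∫ s in (0 : ℝ)..t, v s) = ∫ s in (0 : ℝ)..t, A (v s) := fun A t ht =>
    (A.intervalIntegral_comp_comm (hvi t ht)).symm
  have hUd : ∀ t ∈ Icc 0 T, HasDerivWithinAt (fun r => ∫ s in (0 : ℝ)..r, v s) (v t) (Icc 0 T) t :=
    fun t ht => hasDerivWithinAt_integral_Icc h.continuousOn ht
  have hUc : ContinuousOn (fun r => ∫ s in (0 : ℝ)..r, v s) (Icc 0 T) := fun t ht =>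
    (hUd t ht).continuousWithinAt
  have hpt : ∀ t ∈ Icc 0 T, ∀ φ : Ω.H1, VanishesOnLeaves φ →
      ⟪p t, toL2 φ⟫ + energyL q φ (∫ s in (0 : ℝ)..t, v s) = ⟪G t, toL2 φ⟫ := by
    intro t ht φ hφ
    have h1 := hG.eq_add_integral_derivWithin hT ht
    rw [hG0, zero_add] at h1
    have h2 := (innerSL ℝ (toL2 φ)).intervalIntegral_comp_comm
      (hG'.intervalIntegrable_of_mem_Icc ht)
    have h3 := h.equation t ht φ hφ
    rw [hcomm _ t ht, h3, h1, real_inner_comm]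
    refine Eq.trans ?_ h2
    exact intervalIntegral.integral_congr fun s _ => real_inner_comm _ _
  refine ⟨⟨hUc, Ω.toL2L.continuous.comp_continuousOn h.continuousOn, fun t ht => ?_,
    fun t ht φ hφ => ?_, fun w => ?_⟩, hpt⟩
  · exact (Ω.toL2L.intervalIntegral_comp_comm (hvi t ht)).symm
  · have hp : ContinuousOn (fun s => ⟪p s, toL2 φ⟫) (Icc 0 T) :=
      h.continuousOn_dt.inner continuousOn_const
    have hU : ContinuousOn (fun s => energyL q φ (∫ r in (0 : ℝ)..s, v r)) (Icc 0 T) :=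
      (energyL q φ).continuous.comp_continuousOn hUc
    have h1 : ∫ s in (0 : ℝ)..t, ⟪G s, toL2 φ⟫ = ∫ s in (0 : ℝ)..t,
        (⟪p s, toL2 φ⟫ + energyL q φ (∫ r in (0 : ℝ)..s, v r)) := by
      refine intervalIntegral.integral_congr fun s hs => ?_
      rw [uIcc_of_le ht.1] at hs
      exact (hpt s ⟨hs.1, hs.2.trans ht.2⟩ φ hφ).symm
    have h2 := (innerSL ℝ (toL2 φ)).intervalIntegral_comp_comm
      (h.continuousOn_dt.intervalIntegrable_of_mem_Icc ht)
    have h3 : ⟪toL2 (v t), toL2 φ⟫ = ∫ s in (0 : ℝ)..t, ⟪p s, toL2 φ⟫ := by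
      rw [h.toL2_eq t ht, real_inner_comm]
      exact h2.symm.trans (intervalIntegral.integral_congr fun s _ => real_inner_comm (p s) _)
    rw [h1, intervalIntegral.integral_add (hp.intervalIntegrable_of_mem_Icc ht)
      (hU.intervalIntegrable_of_mem_Icc ht), h3]
  · filter_upwards [(hf w).ae_eq_integral hT (hfg w), ae_restrict_mem measurableSet_Ioo]
      with t h1 ht
    have ht' := Ioo_subset_Icc_self ht
    rw [← traceL_apply, hcomm _ t ht', h1]
    refine intervalIntegral.integral_congr_ae ?_
    have h2 := (ae_restrict_iff' measurableSet_Ioo).1 (h.boundary w)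
    filter_upwards [h2] with s hs hst
    rw [uIoc_of_le ht.1.le] at hst
    rw [traceL_apply, hs ⟨hst.1, hst.2.trans_lt ht.2⟩]

/-- A function `y` with `-∂ₓ²y + q y = a` in the variational sense belongs to `H²` on each edge. -/
lemma memH2_of_forall_energyL {y : Ω.H1} {a : Ω.L2}
    (h : ∀ φ : Ω.H1, VanishesOnLeaves φ → energyL q φ y = ⟪a, toL2 φ⟫) (e : E) :
    MemH2 (toL2 y e) := by
  refine ⟨dx y e, (potentialL q (toL2 y) - a) e, isWeakDeriv_dx y e, fun φ hφ => ?_⟩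
  obtain ⟨z, hz, h1, h2⟩ := exists_testFunction_extension e hφ
  have h3 := h z hz
  rw [energyL_apply] at h3
  rw [← h2, ← h1, inner_sub_left]
  linarith

end Regularity

end MetricTree

/-! ### The norms of the boundary data -/

section Norms

variable {T : ℝ}

lemma hHalfNormSq_nonneg (k : ℕ) (y : IntervalL2 T) : 0 ≤ hHalfNormSq k y :=
  add_nonneg (Finset.sum_nonneg fun _ _ => sq_nonneg _) ENNReal.toReal_nonneg

lemma norm_iterate_weakDeriv_le_hHalfNorm {ι : Type*} [Fintype ι] {k j : ℕ} (hj : j ≤ k)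
    (f : ι → IntervalL2 T) (i : ι) : ‖weakDeriv^[j] (f i)‖ ≤ hHalfNorm k f := by
  refine Real.le_sqrt_of_sq_le ?_
  calc ‖weakDeriv^[j] (f i)‖ ^ 2
      ≤ ∑ j ∈ Finset.range (k + 1), ‖weakDeriv^[j] (f i)‖ ^ 2 :=
        Finset.single_le_sum (f := fun j => ‖weakDeriv^[j] (f i)‖ ^ 2) (fun _ _ => sq_nonneg _)
          (Finset.mem_range.2 (Nat.lt_succ_of_le hj))
    _ ≤ hHalfNormSq k (f i) := le_add_of_nonneg_right ENNReal.toReal_nonneg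
    _ ≤ ∑ i, hHalfNormSq k (f i) :=
        Finset.single_le_sum (f := fun i => hHalfNormSq k (f i)) (fun _ _ => hHalfNormSq_nonneg k _)
          (Finset.mem_univ i)

lemma MemHHalf.isWeakDeriv {k j : ℕ} {y : IntervalL2 T} (hy : MemHHalf k y) (hj : j < k) :
    IsWeakDeriv (weakDeriv^[j] y) (weakDeriv^[j + 1] y) := by
  rw [Function.iterate_succ_apply']
  exact isWeakDeriv_weakDeriv (hy.1 j hj)

lemma sum_norm_le_hHalfNorm {ι : Type*} [Fintype ι] (f : ι → IntervalL2 T) :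
    ∑ i, (‖f i‖ + ‖weakDeriv (f i)‖) ≤ 2 * Fintype.card ι * hHalfNorm 1 f := by
  calc ∑ i, (‖f i‖ + ‖weakDeriv (f i)‖) ≤ ∑ _i : ι, 2 * hHalfNorm 1 f := by
        refine Finset.sum_le_sum fun i _ => ?_
        have h0 : ‖f i‖ ≤ hHalfNorm 1 f :=
          norm_iterate_weakDeriv_le_hHalfNorm (j := 0) zero_le_one f i
        have h1 : ‖weakDeriv (f i)‖ ≤ hHalfNorm 1 f :=
          norm_iterate_weakDeriv_le_hHalfNorm (j := 1) le_rfl f i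
        linarith
    _ = _ := by
        rw [Finset.sum_const, Finset.card_univ, nsmul_eq_mul]
        ring

end Norms

end

theorem proposition6p1 {V E : Type*} [Fintype V] [Fintype E] [Nonempty E]
    (Ω : MetricTree V E) (T : ℝ) (hT : 0 < T) (q : Ω.LInfty) :
    ∃ C : ℝ, ∀ (F : Lp Ω.L2 1 (volume.restrict (Ioo (0 : ℝ) T))) (f : Ω.leaves → IntervalL2 T),
      (∀ v, MemHHalf 1 (f v)) → (∀ v, VanishesNearEnds (f v)) →
      ∃ u : ℝ → Ω.H1,
        MetricTree.IsSolution T q F f u ∧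
        (∀ u' : ℝ → Ω.H1, MetricTree.IsSolution T q F f u' → EqOn u' u (Icc 0 T)) ∧
        MetricTree.e1Norm T u ≤ C * (hHalfNorm 1 f + ‖F‖) ∧
        ((∃ G : ℝ → Ω.L2, ContDiffOn ℝ 1 G (Icc 0 T) ∧ G 0 = 0 ∧
            F =ᵐ[volume.restrict (Ioo (0 : ℝ) T)] G) →
          (∀ v, MemHHalf 3 (f v)) →
          ∀ t ∈ Icc 0 T, ∀ e : E, MemH2 (MetricTree.toL2 (u t) e)) := by
  obtain ⟨C, hC, hex⟩ := MetricTree.exists_isMildSolution Ω hT q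
  set m : ℝ := (Fintype.card Ω.leaves : ℝ)
  refine ⟨2 * (C * (2 * m + 1)), fun F f hf hf0 => ?_⟩
  have hfg : ∀ v, IsWeakDeriv (f v) (weakDeriv (f v)) := fun v => (hf v).isWeakDeriv one_pos
  obtain ⟨u, p, hu, hb⟩ := hex F f (fun v => weakDeriv (f v)) (L1.integrable_coeFn F) hfg hf0
  refine ⟨u, hu.isSolution hT, fun u' hu' => (hu'.isMildSolution hT).unique hT hu, ?_, ?_⟩
  · have hN : 0 ≤ hHalfNorm 1 f := Real.sqrt_nonneg _
    have hm0 : 0 ≤ m := Nat.cast_nonneg _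
    have hF : ∫ s in Ioo 0 T, ‖F s‖ = ‖F‖ := (L1.norm_eq_integral_norm F).symm
    have hD : C * ((∑ v, (‖f v‖ + ‖weakDeriv (f v)‖)) + ∫ s in Ioo 0 T, ‖F s‖) ≤
        C * (2 * m + 1) * (hHalfNorm 1 f + ‖F‖) := by
      rw [mul_assoc]
      refine mul_le_mul_of_nonneg_left ?_ hC
      have h1 := sum_norm_le_hHalfNorm f
      have h2 := mul_nonneg hm0 (norm_nonneg F)
      rw [hF]
      linarith
    have : Nonempty (Icc (0 : ℝ) T) := ⟨⟨0, le_rfl, hT.le⟩⟩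
    have h1 : ⨆ t : Icc (0 : ℝ) T, ‖u t‖ ≤ C * (2 * m + 1) * (hHalfNorm 1 f + ‖F‖) :=
      ciSup_le fun t => ((hb t t.2).1).trans hD
    have h2 : ⨆ t : Icc (0 : ℝ) T, ‖MetricTree.dt T u t‖ ≤
        C * (2 * m + 1) * (hHalfNorm 1 f + ‖F‖) :=
      ciSup_le fun t => by
        rw [hu.dt_eq hT t.2]
        exact ((hb t t.2).2).trans hD
    rw [MetricTree.e1Norm]
    linarith
  · rintro ⟨G, hG, hG0, hFG⟩ hf3 t ht e
    have hG' : ContinuousOn (derivWithin G (Icc 0 T)) (Icc 0 T) :=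
      hG.continuousOn_derivWithin (uniqueDiffOn_Icc hT) le_rfl
    -- the problem with the data differentiated in time
    obtain ⟨v, pv, hv, -⟩ := hex (derivWithin G (Icc 0 T)) (fun v => weakDeriv (f v))
      (fun v => weakDeriv (weakDeriv (f v)))
      (hG'.integrableOn_Icc.mono_set Ioo_subset_Icc_self)
      (fun v => (hf3 v).isWeakDeriv (j := 1) (by norm_num))
      (fun v => (hf0 v).of_isWeakDeriv (hfg v))
    obtain ⟨hU, hUeq⟩ := hv.integral hT hG hG0 hf0 hfg
    have huU := (hu.congr_source hFG).unique hT hU ht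
    refine MetricTree.memH2_of_forall_energyL (q := q) (a := G t - pv t) (fun φ hφ => ?_) e
    rw [huU, inner_sub_left]
    linarith [hUeq t ht φ hφ]
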